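/- **Setting.** All algebras are unital complex algebras. A *noncommutative probability space over $D$* is a pair $(A,E)$ with $1_A\in D\subset A$ and $E:A\to D$ linear, $E(d)=d$, $E(dad')=dE(a)d'$ for $d,d'\in D$, $a\in A$. Its cumulants $c_E^{(n)}:A^n\to D$ are determined by $E(a_1\cdots a_n)=\sum_{\pi\in NC(n)}\widehat{c_E}(\pi)(a_1\otimes\cdots\otimes a_n)$, where $NC(n)$ is the set of noncrossing partitions of $\{1,\dots,n\}$ and $\widehat{c_E}(\pi)$ is the nested product of the cumulants over the blocks of $\pi$ (the value of the part of $\pi$ lying between two consecutive elements of a block is inserted there as an element of $D$). Subsets $X,Y\subset A$ are *free over $D$* if all mixed cumulants of elements of the two subalgebras generated by $X\cup D$ and by $Y\cup D$ vanish. The *R-transform* $R^{(E)}_{x_1,\dots,x_s}(z_1,\dots,z_s)$ is the formal series over $D$ in noncommuting indeterminates whose coefficient at $z_{i_1}\cdots z_{i_n}$ ($n\ge1$) is $c_E^{(n)}(x_{i_1}\otimes b_2x_{i_2}\otimes\cdots\otimes b_nx_{i_n})$, where $b_2,\dots,b_n\in D$ are arbitrary; an equality of series means equality of all coefficients for every choice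 of the $b_j$. The *trivial* R-transform $R^{(E):t}$ is obtained by taking all $b_j=1$. For series $f=R^{(E)}_{x_1,\dots,x_s}$ and $g=R^{(F)}_{y_1,\dots,y_s}$ over $D$, with inserted elements $b_j$ and $b'_j$ respectively, the $D$-valued *boxed convolution* $f\,\boxed{*}_D\,g$ has as coefficient at $z_{i_1}\cdots z_{i_n}$ $$\sum_{\pi\in NC(n)}(\widehat{c_E}\oplus\widehat{c_F})(\pi\cup Kr(\pi))\,(x_{i_1}\otimes y_{i_1}\otimes b_2x_{i_2}\otimes b'_2y_{i_2}\otimes\cdots\otimes b_nx_{i_n}\otimes b'_ny_{i_n}),$$ where $Kr(\pi)$ is the Kreweras complement, $\pi\cup Kr(\pi)$ is the alternating union in $NC(2n)$, and blocks of $\pi$ are evaluated with $c_E$ and blocks of $Kr(\pi)$ with $c_F$. (The nested evaluation uses the coefficients of $f$ and $g$ for all inserted elements.) Taking the second series to be the trivial R-transform means putting all $b'_j=1$ in this formula. **Theorem.** Let $\mathbb C\subset^{\varphi_0}B=A_0\subset^{\varphi_1}A_1\subset^{\varphi_2}A_2\subset\cdots$ be a tower of amalgamated noncommutative probability spaces: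 each $(A_j,\varphi_j:A_j\to A_{j-1})$, $j\ge1$, is a noncommutative probability space over $A_{j-1}$, and $\varphi_0:B\to\mathbb C$ is linear. For $1\le k\le j$ put $E_{k,j}=\varphi_k\varphi_{k+1}\cdots\varphi_j:A_j\to A_{k-1}$. Let $1\le k<m<n<N$, and let $X=\{x_1,\dots,x_s\}\subset\bigcup_{j=k}^mA_j$ and $Y=\{y_1,\dots,y_s\}\subset\bigcup_{j=m+1}^nA_j$ be free over $A_{k-1}$ in $(A_N,E_{k,N})$. Then 1. $R^{(E_{k,N})}_{x_1,\dots,x_s,y_1,\dots,y_s}(z_1,\dots,z_{2s})=R^{(E_{k,m})}_{x_1,\dots,x_s}(z_1,\dots,z_s)+R^{(E_{k,n})}_{y_1,\dots,y_s}(z_{s+1},\dots,z_{2s})$; 2. $R^{(E_{k,N})}_{x_1+y_1,\dots,x_s+y_s}(z_1,\dots,z_s)=\big(R^{(E_{k,m})}_{x_1,\dots,x_s}+R^{(E_{k,n})}_{y_1,\dots,y_s}\big)(z_1,\dots,z_s)$; 3. $R^{(E_{k,N})}_{x_1y_1,\dots,x_sy_s}(z_1,\dots,z_s)=\big(R^{(E_{k,m})}_{x_1,\dots,x_s}\,\boxed{*}_{A_{k-1}}\,R^{(E_{k,n}):t}_{y_1,\dots,y_s}\big)(z_1,\dots,z_s)$.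 -/

import Mathlib

open scoped BigOperators

noncomputable section

/-! ### Noncrossing partitions and nested evaluation -/

/-- A relation on a linearly ordered set is noncrossing when `a < b < c < d`, `a ~ c`, `b ~ d`
force `a ~ b`. -/
def NonCrossing {ι : Type*} [LinearOrder ι] (r : ι → ι → Prop) : Prop :=
  ∀ a b c d, a < b → b < c → c < d → r a c → r b d → r a b

theorem setoid_finite (ι : Type*) [Finite ι] : Finite (Setoid ι) :=
  Finite.of_injective (fun (σ : Setoid ι) => fun a b => σ a b) (fun σ τ h => by
    ext a b
    exact iff_of_eq (congrFun (congrFun h a) b))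

/-- `NC n`: the noncrossing partitions of `{0, …, n - 1}`, given as equivalence relations. -/
def NC (n : ℕ) : Finset (Setoid (Fin n)) :=
  haveI := setoid_finite (Fin n)
  (Set.toFinite {σ : Setoid (Fin n) | NonCrossing fun a b => σ a b}).toFinset

theorem mem_NC {n : ℕ} {σ : Setoid (Fin n)} : σ ∈ NC n ↔ NonCrossing fun a b => σ a b := by
  simp [NC]

/-- The points of the block of `p` (in `S`) other than `p`. -/
def blockRest {ι : Type*} [LinearOrder ι] (r : ι → ι → Prop) (S : Finset ι) (p : ι) :
    Finset ι :=
  open Classical in {t ∈ S | t ≠ p ∧ r p t}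

/-- The points of `S` after `p` that lie before `v` and after all those points of the block of
`p` that precede `v`. -/
def gapBefore {ι : Type*} [LinearOrder ι] (r : ι → ι → Prop) (S : Finset ι) (p v : ι) :
    Finset ι :=
  open Classical in {t ∈ S | p < t ∧ t < v ∧ ∀ u ∈ blockRest r S p, u < t ∨ v ≤ u}

/-- The points of `S` after `p` that lie after all the points of the block of `p`. -/
def tailAfter {ι : Type*} [LinearOrder ι] (r : ι → ι → Prop) (S : Finset ι) (p : ι) :
    Finset ι :=
  open Classical in {t ∈ S | p < t ∧ ∀ u ∈ blockRest r S p, u < t}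

theorem card_gapBefore_lt {ι : Type*} [LinearOrder ι] (r : ι → ι → Prop) {S : Finset ι} {p : ι}
    (hp : p ∈ S) (v : ι) : (gapBefore r S p v).card < S.card := by
  classical
  refine Finset.card_lt_card (Finset.ssubset_iff_subset_ne.2 ⟨Finset.filter_subset _ _, ?_⟩)
  intro h
  rw [← h] at hp
  simp [gapBefore] at hp

theorem card_tailAfter_lt {ι : Type*} [LinearOrder ι] (r : ι → ι → Prop) {S : Finset ι} {p : ι}
    (hp : p ∈ S) : (tailAfter r S p).card < S.card := by
  classical
  refine Finset.card_lt_card (Finset.ssubset_iff_subset_ne.2 ⟨Finset.filter_subset _ _, ?_⟩)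
  intro h
  rw [← h] at hp
  simp [tailAfter] at hp

/-- Nested evaluation of a multiplicative function along a noncrossing partition `r` of `S`.
Let `p = min S` and let `p < v₁ < ⋯ < v_k` be its block. The value is
`g p {v₁, …, v_k} w * (value of the tail)`, where `w v_j` is the value of the part of the
partition lying between `v_{j-1}` and `v_j` (with `v₀ = p`), and the tail is the part lying after
`v_k`. The value on the empty set is `1`. Here `g p {v₁, …, v_k} w` is the contribution of the
block when the elements `w v_j` are inserted in front of its `v_j`-th entries. -/
def nestedEval {ι D : Type*} [LinearOrder ι] [Monoid D] (r : ι → ι → Prop)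
    (g : ι → Finset ι → (ι → D) → D) (S : Finset ι) : D :=
  if h : S.Nonempty then
    g (S.min' h) (blockRest r S (S.min' h)) (fun v => nestedEval r g (gapBefore r S (S.min' h) v)) *
      nestedEval r g (tailAfter r S (S.min' h))
  else 1
termination_by S.card
decreasing_by
  · exact card_gapBefore_lt r (S.min'_mem h) v
  · exact card_tailAfter_lt r (S.min'_mem h)

theorem nestedEval_congr {ι D : Type*} [LinearOrder ι] [Monoid D] {r : ι → ι → Prop}
    {g g' : ι → Finset ι → (ι → D) → D}
    (h : ∀ (S : Finset ι) (p : ι), p ∈ S → g p (blockRest r S p) = g' p (blockRest r S p))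
    (S : Finset ι) : nestedEval r g S = nestedEval r g' S := by
  induction hn : S.card using Nat.strong_induction_on generalizing S with
  | _ n ih =>
    rw [nestedEval, nestedEval]
    split_ifs with hS
    · have hp := S.min'_mem hS
      rw [h S _ hp, ih _ (hn ▸ card_tailAfter_lt r hp) _ rfl]
      congr 2
      funext v
      exact ih _ (hn ▸ card_gapBefore_lt r hp v) _ rfl
    · rfl

theorem nestedEval_top {D : Type*} [Monoid D] (n : ℕ)
    (g : Fin (n+1) → Finset (Fin (n+1)) → (Fin (n+1) → D) → D)
    (hg : ∀ p V w w', (∀ v ∈ V, w v = w' v) → g p V w = g p V w') :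
    nestedEval (fun i j => (⊤ : Setoid (Fin (n+1))) i j) g Finset.univ =
      g 0 (Finset.univ.erase 0) (fun _ => 1) := by
  have h0 : (Finset.univ : Finset (Fin (n+1))).Nonempty := ⟨0, Finset.mem_univ _⟩
  have hm : (Finset.univ : Finset (Fin (n+1))).min' h0 = 0 :=
    le_antisymm (Finset.min'_le _ _ (Finset.mem_univ _)) (Fin.zero_le _)
  have hB : blockRest (fun i j => (⊤ : Setoid (Fin (n+1))) i j) Finset.univ 0
      = Finset.univ.erase 0 := by
    ext t; simp [blockRest, Setoid.top_def]
  have hT : tailAfter (fun i j => (⊤ : Setoid (Fin (n+1))) i j) Finset.univ 0 = ∅ := by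
    ext t
    simp only [tailAfter, hB, Finset.mem_filter, Finset.mem_univ, true_and, Finset.mem_erase, Finset.notMem_empty, iff_false]
    rintro ⟨h1, h2⟩
    exact lt_irrefl _ (h2 t ⟨h1.ne', trivial⟩)
  rw [nestedEval, dif_pos h0]
  simp only [hm, hB, hT]
  rw [nestedEval.eq_def _ _ ∅, dif_neg (by simp), mul_one]
  apply hg
  intro v hv
  have : gapBefore (fun i j => (⊤ : Setoid (Fin (n+1))) i j) Finset.univ 0 v = ∅ := by
    ext t
    simp only [gapBefore, hB, Finset.mem_filter, Finset.mem_univ, true_and, Finset.mem_erase, Finset.notMem_empty, iff_false]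
    rintro ⟨h1, h2, h3⟩
    rcases h3 t ⟨h1.ne', trivial⟩ with h | h
    · exact lt_irrefl _ h
    · exact absurd h2 (not_lt.2 h)
  rw [this, nestedEval.eq_def, dif_neg (by simp)]

theorem blockRest_card_lt {n : ℕ} {π : Setoid (Fin (n+1))} (h : π ≠ ⊤) (S : Finset (Fin (n+1)))
    (p : Fin (n+1)) : (blockRest (fun i j => π i j) S p).card < n := by
  by_contra hc
  have hsub : blockRest (fun i j => π i j) S p ⊆ Finset.univ.erase p := by
    intro t ht; simp [blockRest] at ht ⊢; exact ht.2.1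
  have heq := Finset.eq_of_subset_of_card_le hsub (by simp; omega)
  apply h
  have key : ∀ t, π p t := by
    intro t
    by_cases htp : t = p
    · rw [htp]
    · have : t ∈ blockRest (fun i j => π i j) S p := by rw [heq]; simp [htp]
      simp [blockRest] at this; exact this.2.2
  ext a b
  simp only [Setoid.top_def]
  exact ⟨fun _ => trivial, fun _ => π.trans (π.symm (key a)) (key b)⟩

/-! ### Amalgamated noncommutative probability spaces -/

section Amalgamated

variable {𝒜 : Type*} [Ring 𝒜] [Algebra ℂ 𝒜]

/-- `CondExp A D`: the algebra `A` is an algebra over its unital subalgebra `D`, and is equipped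
with a conditional expectation (a `D`-functional) `A → D`, so that it is a noncommutative
probability space over `D`. -/
structure CondExp (A D : Subalgebra ℂ 𝒜) where
  le : D ≤ A
  toLinearMap : A →ₗ[ℂ] D
  map_base : ∀ d : D, toLinearMap (Subalgebra.inclusion le d) = d
  map_bimodule : ∀ (d d' : D) (a : A),
    toLinearMap (Subalgebra.inclusion le d * a * Subalgebra.inclusion le d') =
      d * toLinearMap a * d'

namespace CondExp

variable {A D C : Subalgebra ℂ 𝒜}

/-- The identity of `D`. -/
def refl (D : Subalgebra ℂ 𝒜) : CondExp D D where
  le := le_rfl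
  toLinearMap := LinearMap.id
  map_base _ := rfl
  map_bimodule _ _ _ := rfl

/-- The composition `A → D → C` of conditional expectations. -/
def comp (F : CondExp D C) (E : CondExp A D) : CondExp A C where
  le := F.le.trans E.le
  toLinearMap := F.toLinearMap ∘ₗ E.toLinearMap
  map_base c := by
    have h := E.map_base (Subalgebra.inclusion F.le c)
    rw [Subalgebra.inclusion_inclusion] at h
    rw [LinearMap.comp_apply, h, F.map_base]
  map_bimodule c c' a := by
    have h := E.map_bimodule (Subalgebra.inclusion F.le c) (Subalgebra.inclusion F.le c') a
    rw [Subalgebra.inclusion_inclusion, Subalgebra.inclusion_inclusion] at h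
    rw [LinearMap.comp_apply, h, F.map_bimodule, LinearMap.comp_apply]

/-- The arguments `(a_p, w_{v₁} a_{v₁}, …, w_{v_k} a_{v_k})` attached to the block
`{p < v₁ < ⋯ < v_k}`, `V = {v₁, …, v_k}`. -/
def blockArgs (E : CondExp A D) {ι : Type*} [LinearOrder ι] (a : ι → A) (p : ι) (V : Finset ι)
    (w : ι → D) : Fin (V.card + 1) → A :=
  Fin.cons (a p) fun j => Subalgebra.inclusion E.le (w (V.orderEmbOfFin rfl j)) *
    a (V.orderEmbOfFin rfl j)

/-- The cumulants of `E`: `E.cumulant n` is the cumulant `c⁽ⁿ⁺¹⁾` of order `n + 1`. They are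
determined recursively by the moment-cumulant formula
`E (a₀ a₁ ⋯ a_n) = ∑_{π ∈ NC(n+1)} ĉ(π)(a₀ ⊗ ⋯ ⊗ a_n)`, in which the partition `π = 1_{n+1}`
contributes `c⁽ⁿ⁺¹⁾(a₀ ⊗ ⋯ ⊗ a_n)` and all other partitions involve only cumulants of lower
order, because their blocks have at most `n` points. -/
def cumulant (E : CondExp A D) (n : ℕ) (a : Fin (n + 1) → A) : D :=
  open Classical in
  E.toLinearMap (List.ofFn a).prod -
    ∑ π ∈ (NC (n + 1)).erase ⊤,
      nestedEval (fun i j => π i j)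
        (fun p V w => if V.card < n then E.cumulant V.card (E.blockArgs a p V w) else 0)
        Finset.univ
termination_by n

/-- The value `ĉ(π)(a₀ ⊗ ⋯ ⊗ a_{n-1})` of the multiplicative function of the cumulants. -/
def cumulantPart (E : CondExp A D) {n : ℕ} (π : Setoid (Fin n)) (a : Fin n → A) : D :=
  nestedEval (fun i j => π i j) (fun p V w => E.cumulant V.card (E.blockArgs a p V w))
    Finset.univ

/-- The moment-cumulant formula, which characterizes the cumulants. -/
theorem moment_cumulant (E : CondExp A D) (n : ℕ) (a : Fin (n+1) → A) :
   E.toLinearMap (List.ofFn a).prod = ∑ π ∈ NC (n+1), E.cumulantPart π a := by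
  classical
  have htop : (⊤ : Setoid (Fin (n+1))) ∈ NC (n+1) := by
    rw [mem_NC]; intro a b c d _ _ _ _ _; trivial
  rw [← Finset.add_sum_erase _ _ htop]
  have h1 : ∑ π ∈ (NC (n+1)).erase ⊤, E.cumulantPart π a = ∑ π ∈ (NC (n + 1)).erase ⊤,
      nestedEval (fun i j => π i j)
        (fun p V w => if V.card < n then E.cumulant V.card (E.blockArgs a p V w) else 0)
        Finset.univ := by
    refine Finset.sum_congr rfl fun π hπ => ?_
    refine nestedEval_congr (fun S p _ => ?_) _
    funext w
    rw [if_pos (blockRest_card_lt (Finset.ne_of_mem_erase hπ) S p)]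
  have h2 : E.cumulantPart ⊤ a = E.cumulant n a := by
    rw [cumulantPart, nestedEval_top]
    · have hc : (Finset.univ.erase (0 : Fin (n+1))).card = n := by simp
      have gen : ∀ (k : ℕ) (V : Finset (Fin (n+1))) (hV : V.card = k) , E.cumulant V.card (E.blockArgs a 0 V fun _ => 1) =
          E.cumulant k (Fin.cons (a 0) fun j => a (V.orderEmbOfFin hV j)) := by
        intro k V hV; subst hV; congr 1; funext j
        refine Fin.cases ?_ (fun j => ?_) j
        · rfl
        · simp [blockArgs]
      rw [gen n _ hc]
      congr 1
      funext j
      refine Fin.cases rfl (fun j => ?_) j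
      simp only [Fin.cons_succ]
      congr 1
      have := Finset.orderEmbOfFin_unique hc (f := Fin.succ) (by simp) (Fin.strictMono_succ)
      exact (congrFun this j).symm
    · intro p V w w' h
      congr 1
      unfold blockArgs
      congr 1; funext j
      rw [h _ (V.orderEmbOfFin_mem rfl j)]
  rw [h1, h2, cumulant.eq_def]
  simp only [sub_add_cancel]

/-- Subsets `X i` of `A` are free over `D`: all mixed cumulants of elements of the subalgebras
generated by `D` and the `X i` vanish. -/
def Free (E : CondExp A D) {I : Type*} (X : I → Set A) : Prop :=
  ∀ (n : ℕ) (ε : Fin (n + 1) → I), (∃ p q, ε p ≠ ε q) →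
    ∀ a : Fin (n + 1) → A,
      (∀ j, a j ∈ Algebra.adjoin ℂ (Set.range (Subalgebra.inclusion E.le) ∪ X (ε j))) →
        E.cumulant n a = 0

end CondExp

/-! ### Formal series, R-transforms, boxed convolution -/

/-- Formal series in the noncommuting indeterminates `z_i`, `i ∈ I`, over `D`, without constant
term. The coefficient of `z_{i₀} z_{i₁} ⋯ z_{i_n}` is an element of `D` depending on the
arbitrary inserted elements `b₁, …, b_n ∈ D`; equality of two series is equality of all
coefficients for all choices of the inserted elements. -/
abbrev FormalSeries (D I : Type*) : Type _ :=
  (n : ℕ) → (Fin (n + 1) → I) → (Fin n → D) → D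

/-- The series `f(z_{e 0}, z_{e 1}, …)` obtained by renaming the indeterminates along `e`. -/
def FormalSeries.rename {D I J : Type*} [AddCommMonoid D] [Fintype I] (e : I → J)
    (f : FormalSeries D I) : FormalSeries D J :=
  fun n i b => open Classical in ∑ l : Fin (n + 1) → I with e ∘ l = i, f n l b

/-- The R-transform of the tuple `x`: the coefficient of `z_{i₀} z_{i₁} ⋯ z_{i_n}` is
`c⁽ⁿ⁺¹⁾(x_{i₀} ⊗ b₁ x_{i₁} ⊗ ⋯ ⊗ b_n x_{i_n})`. -/
def CondExp.rTransform {A D : Subalgebra ℂ 𝒜} (E : CondExp A D) {I : Type*} (x : I → A) :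
    FormalSeries D I :=
  fun n i b => E.cumulant n
    (Fin.cons (x (i 0)) fun j => Subalgebra.inclusion E.le (b j) * x (i j.succ))

end Amalgamated

/-- The Kreweras complement of `π`: `i` and `j` (with `i ≤ j`) lie in the same block of `Kr(π)`
iff `{i + 1, …, j}` is a union of blocks of `π`. This is the largest partition of the points
`i'` for which `π ∪ Kr(π)` is noncrossing on `0 < 0' < 1 < 1' < ⋯ < n < n'`. -/
def kreweras {ι : Type*} [LinearOrder ι] (π : Setoid ι) : Setoid ι where
  r i j := ∀ a b, π a b →
    ((min i j < a ∧ a ≤ max i j) ↔ (min i j < b ∧ b ≤ max i j))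
  iseqv := by
    refine ⟨fun i a b _ => ?_, fun {i j} h a b hab => ?_, fun {i j l} h h' a b hab => ?_⟩
    · simp only [min_self, max_self]
      exact ⟨fun h => absurd h.1 (not_lt.2 h.2), fun h => absurd h.1 (not_lt.2 h.2)⟩
    · rw [min_comm, max_comm]
      exact h a b hab
    · have h1 := h a b hab
      have h2 := h' a b hab
      simp only [min_def, max_def] at *
      grind

/-- The alternating union of two relations `r` on `0 < 1 < ⋯` and `t` on `0' < 1' < ⋯`, as a
relation on `0 < 0' < 1 < 1' < ⋯`. Here `i` is `(i, false)` and `i'` is `(i, true)`. -/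
def alternatingUnion {ι : Type*} (r t : Setoid ι) (u v : ι ×ₗ Bool) : Prop :=
  ((ofLex u).2 = false ∧ (ofLex v).2 = false ∧ r (ofLex u).1 (ofLex v).1) ∨
    ((ofLex u).2 = true ∧ (ofLex v).2 = true ∧ t (ofLex u).1 (ofLex v).1)

/-- The boxed convolution of `f` and `g`, where `β` gives the inserted elements `b'₁, …, b'_n` at
which the second series is taken. The coefficient of `z_{i₀} ⋯ z_{i_n}` is
`∑_{π ∈ NC(n+1)} (f ⊕ g)(π ∪ Kr(π))(x_{i₀} ⊗ y_{i₀} ⊗ b₁ x_{i₁} ⊗ b'₁ y_{i₁} ⊗ ⋯ ⊗ b'_n y_{i_n})`,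
the blocks of `π` being evaluated by the coefficients of `f` and those of `Kr(π)` by the
coefficients of `g`. -/
def boxedConv {D I : Type*} [Ring D] (f g : FormalSeries D I)
    (β : (n : ℕ) → (Fin (n + 1) → I) → Fin n → D) : FormalSeries D I :=
  fun n i b =>
    -- the element of `D` written in front of the entry at position `v`
    let d : Fin (n + 1) ×ₗ Bool → D := fun v =>
      Fin.cons (α := fun _ => D) 1 (if (ofLex v).2 then β n i else b) (ofLex v).1
    ∑ π ∈ NC (n + 1),
      nestedEval (alternatingUnion π (kreweras π))
        (fun p V w =>
          d p * (if (ofLex p).2 then g else f) V.card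
            (Fin.cons (i (ofLex p).1) fun j => i (ofLex (V.orderEmbOfFin rfl j)).1)
            (fun j => w (V.orderEmbOfFin rfl j) * d (V.orderEmbOfFin rfl j)))
        Finset.univ

/-- The boxed convolution of `f` with the trivial series of `g`: the elements inserted in front of
the entries of the second series are all `1`. -/
def boxedConvTrivial {D I : Type*} [Ring D] (f g : FormalSeries D I) : FormalSeries D I :=
  boxedConv f g fun _ _ _ => 1

/-! ### Towers -/

/-- A tower `ℂ ⊂ B = A₀ ⊂ A₁ ⊂ A₂ ⊂ ⋯` of amalgamated noncommutative probability spaces, inside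
an enveloping algebra `𝒜`, with conditional expectations `φ n : A_{n+1} → A_n` and a linear
functional `φ₀` on `B`. -/
structure NCTower (𝒜 : Type*) [Ring 𝒜] [Algebra ℂ 𝒜] where
  alg : ℕ → Subalgebra ℂ 𝒜
  φ₀ : alg 0 →ₗ[ℂ] ℂ
  φ : (n : ℕ) → CondExp (alg (n + 1)) (alg n)

namespace NCTower

variable {𝒜 : Type*} [Ring 𝒜] [Algebra ℂ 𝒜] (T : NCTower 𝒜)

theorem alg_mono : Monotone T.alg := monotone_nat_of_le_succ fun n => (T.φ n).le

/-- The composition of the conditional expectations from `A_j` down to `A_i`. -/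
def condExpDown (i j : ℕ) (h : i ≤ j) : CondExp (T.alg j) (T.alg i) :=
  Nat.leRec (motive := fun l _ => CondExp (T.alg l) (T.alg i)) (CondExp.refl _)
    (fun l _ E => E.comp (T.φ l)) h

/-- `E_{k,j} : A_j → A_{k-1}`, for `1 ≤ k ≤ j`: the composition of the conditional expectations
`A_j → A_{j-1} → ⋯ → A_k → A_{k-1}`. -/
def condExp (k j : ℕ) (h : k ≤ j) : CondExp (T.alg j) (T.alg (k - 1)) :=
  T.condExpDown (k - 1) j ((Nat.sub_le k 1).trans h)

theorem mem_alg {k m l : ℕ} (h : m ≤ l) {a : 𝒜}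
    (ha : a ∈ ⋃ j ∈ Set.Icc k m, (T.alg j : Set 𝒜)) : a ∈ T.alg l := by
  simp only [Set.mem_iUnion] at ha
  obtain ⟨j, hj, ha⟩ := ha
  exact T.alg_mono (hj.2.trans h) ha

/-- A tuple in `A_k ∪ ⋯ ∪ A_m`, regarded as a tuple in `A_l`, where `m ≤ l`. -/
def lift {I : Type*} {k m l : ℕ} (h : m ≤ l) (x : I → 𝒜)
    (hx : ∀ i, x i ∈ ⋃ j ∈ Set.Icc k m, (T.alg j : Set 𝒜)) : I → T.alg l :=
  fun i => ⟨x i, T.mem_alg h (hx i)⟩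

end NCTower

end

/-! Each conditional expectation of the tower is the identity on its base, so `E_{k,N}` restricts to
`E_{k,m}` on `A_m`, and cumulants of elements of `A_m` agree in both spaces
(`condExpDown_inclusion`, `cumulant_inclusion`). The theorem thus concerns two families that are
free over `D = A_{k-1}` in the single space `(A_N, E_{k,N})`. Formula 1 is the vanishing of mixed
cumulants, read coefficient by coefficient. Formula 2 needs additivity of the cumulants in each
argument as well (`map_add_eq`).

Formula 3 rests on the expansion of a cumulant one of whose arguments is a product `a * b`: it is
the cumulant with `a, b` as separate arguments, plus all products of two cumulants, nested or side
by side, that separate `a` from `b` (`mergeDefect_eq_zero`). The proof uses a Fock space model of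
moments. The letters of a word act on a stack, the last letter first. A letter is pushed or, as the
first letter of its block, fed to `c` together with the top part of the stack, and the value
multiplies the entry that is now on top. By induction on the number of arguments, the action of `a *
b` differs from the action of `a` after `b` only by the defect of the expansion itself.
Multiplication is associative, so the moments agree and the defect is zero. The model does compute
the sum over noncrossing partitions, since both obey the same recursion on the second point of the
first block (`headMom_eq`, `sum_NCOn_next`, `sum_relEval_NC`).

The products `x_i * y_i` are then opened one at a time. Freeness enters through two rules: a
cumulant is zero if an entry from `X` is immediately followed by one from `Y`
(`eq_zero_of_adjacent`), or if it begins in `Y` and ends in `X` (`eq_zero_of_ends`). What survives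
are the expansions `first_product` and `products_among_right`. They have the shape of `π ∪ Kr(π)`: a
block of `π` steps from `i` to its next point `v` and encloses the interval from `i'` to `(v-1)'`,
while a block of `Kr(π)` steps from `i'` to `t'`, where `t` is the last point of the block of `i +
1` in `π`. Induction along these steps gives `sum_chainEval_same_colour` and `sum_chainEval_altRel`,
hence the boxed convolution. -/

open scoped BigOperators

noncomputable section

/-! ### Sums over the splittings of a list -/

section SplitSum

variable {A D : Type*} [Ring D]

/-- `splitSum f w` is the sum of `f p t q` over all decompositions `w = p ++ t :: q`. -/
def splitSum (f : List A → A → List A → D) : List A → D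
  | [] => 0
  | b :: w => f [] b w + splitSum (fun p => f (b :: p)) w

@[simp] theorem splitSum_nil (f : List A → A → List A → D) : splitSum f [] = 0 := rfl

theorem splitSum_cons (f : List A → A → List A → D) (b : A) (w : List A) :
    splitSum f (b :: w) = f [] b w + splitSum (fun p => f (b :: p)) w := rfl

theorem splitSum_append (f : List A → A → List A → D) (u w : List A) :
    splitSum f (u ++ w) = splitSum (fun p t q => f p t (q ++ w)) u +
      splitSum (fun p t q => f (u ++ p) t q) w := by
  induction u generalizing f with
  | nil => simp
  | cons b u ih => simp [splitSum_cons, ih, add_assoc]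

theorem splitSum_congr {f g : List A → A → List A → D} {w : List A}
    (h : ∀ p t q, w = p ++ t :: q → f p t q = g p t q) : splitSum f w = splitSum g w := by
  induction w generalizing f g with
  | nil => rfl
  | cons b w ih =>
    rw [splitSum_cons, splitSum_cons, h [] b w rfl]
    congr 1
    exact ih fun p t q hw => h (b :: p) t q (by simp [hw])

theorem splitSum_add (f g : List A → A → List A → D) (w : List A) :
    splitSum (fun p t q => f p t q + g p t q) w = splitSum f w + splitSum g w := by
  induction w generalizing f g with
  | nil => simp
  | cons b w ih => simp only [splitSum_cons, ih]; abel

theorem splitSum_eq_zero {f : List A → A → List A → D} {w : List A}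
    (h : ∀ p t q, w = p ++ t :: q → f p t q = 0) : splitSum f w = 0 := by
  induction w generalizing f with
  | nil => rfl
  | cons b w ih =>
    rw [splitSum_cons, h [] b w rfl, zero_add]
    exact ih fun p t q hw => h (b :: p) t q (by simp [hw])

theorem map_splitSum {D' : Type*} [Ring D'] (φ : D →+ D') (f : List A → A → List A → D)
    (w : List A) : φ (splitSum f w) = splitSum (fun p t q => φ (f p t q)) w := by
  induction w generalizing f with
  | nil => simp
  | cons b w ih => simp [splitSum_cons, ih]

theorem splitSum_sub (f g : List A → A → List A → D) (w : List A) :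
    splitSum (fun p t q => f p t q - g p t q) w = splitSum f w - splitSum g w := by
  induction w generalizing f g with
  | nil => simp
  | cons b w ih => simp only [splitSum_cons, ih]; abel

theorem mul_splitSum (d : D) (f : List A → A → List A → D) (w : List A) :
    d * splitSum f w = splitSum (fun p t q => d * f p t q) w :=
  map_splitSum (AddMonoidHom.mulLeft d) f w

theorem splitSum_mul (d : D) (f : List A → A → List A → D) (w : List A) :
    splitSum f w * d = splitSum (fun p t q => f p t q * d) w :=
  map_splitSum (AddMonoidHom.mulRight d) f w

/-- Both sides run over the ways to mark two entries of `w`; the left one chooses the earlier entry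
first, the right one the later. -/
theorem splitSum_comm (f : List A → A → List A → A → List A → D) (w : List A) :
    splitSum (fun p t q => splitSum (fun p' t' q' => f p t p' t' q') q) w =
      splitSum (fun r t' q' => splitSum (fun p t q => f p t q t' q') r) w := by
  induction w generalizing f with
  | nil => rfl
  | cons b w ih =>
    simp only [splitSum_cons, splitSum_nil, zero_add, splitSum_add]
    rw [ih fun p => f (b :: p)]

theorem splitSum_splitSum_comm (f : List A → A → List A → List A → A → List A → D)
    (v w : List A) :
    splitSum (fun p t q => splitSum (fun p' t' q' => f p t q p' t' q') w) v =
      splitSum (fun p' t' q' => splitSum (fun p t q => f p t q p' t' q') v) w := by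
  induction v generalizing f with
  | nil => simp only [splitSum_nil]; exact (splitSum_eq_zero fun _ _ _ _ => rfl).symm
  | cons b v ih => simp only [splitSum_cons, splitSum_add, ih fun p => f (b :: p)]

end SplitSum

/-! ### Additivity in each entry -/

/-- `F` is additive in each entry of its argument. -/
def SlotAdd {A D : Type*} [Ring A] [Ring D] (F : List A → D) : Prop :=
  ∀ u a b w, F (u ++ (a + b) :: w) = F (u ++ a :: w) + F (u ++ b :: w)

namespace SlotAdd

variable {A D : Type*} [Ring A] [Ring D] {F G : List A → D}

theorem cons (h : SlotAdd F) (a b : A) (w : List A) : F ((a + b) :: w) = F (a :: w) + F (b :: w) :=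
  h [] a b w

/-- The additive map obtained by fixing all entries but one. -/
def toAddMonoidHom (h : SlotAdd F) (u w : List A) : A →+ D :=
  AddMonoidHom.mk' (fun a => F (u ++ a :: w)) fun a b => h u a b w

theorem zero (h : SlotAdd F) (u w : List A) : F (u ++ 0 :: w) = 0 :=
  (h.toAddMonoidHom u w).map_zero

theorem sub (h : SlotAdd F) (u w : List A) (a b : A) :
    F (u ++ (a - b) :: w) = F (u ++ a :: w) - F (u ++ b :: w) :=
  (h.toAddMonoidHom u w).map_sub a b

theorem sum (h : SlotAdd F) (u w : List A) {κ : Type*} (s : Finset κ) (a : κ → A) :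
    F (u ++ (∑ i ∈ s, a i) :: w) = ∑ i ∈ s, F (u ++ a i :: w) :=
  map_sum (h.toAddMonoidHom u w) a s

theorem comp_cons (h : SlotAdd F) (e : A) : SlotAdd fun s => F (e :: s) :=
  fun u a b w => h (e :: u) a b w

theorem fun_add (h : SlotAdd F) (h' : SlotAdd G) : SlotAdd fun s => F s + G s := by
  intro u a b w
  simp only [h u a b w, h' u a b w]
  abel

end SlotAdd

/-! ### The Fock space model of a moment functional -/

section Fock

variable {A D : Type*} [Ring A] [Ring D] (ι : D →+* A) (E : A →+ D) (c : List A → D)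

/-- The (dual) action of a letter `e` on functionals of stacks: `e` is pushed onto the stack, or
is fed to `c` together with an initial part of the stack. The bottom of the stack stays. -/
def act (F : List A → D) (e : A) : List A → D :=
  fun s => F (e :: s) + splitSum (fun p t q => F ((ι (c (e :: p)) * t) :: q)) s

/-- The action of a word. -/
def fock (F : List A → D) (w : List A) : List A → D := w.foldl (act ι c) F

/-- The vacuum functional. -/
def vac : List A → D
  | [t] => E t
  | _ => 0

/-- The moments with cumulants `c`. -/
def mom (w : List A) : D := fock ι c (vac E) w [1]

/-- The functional that feeds the whole stack above its bottom to `c`, preceded by `u`. -/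
def blk (u : List A) : List A → D :=
  fun s => splitSum (fun p t q => vac E ((ι (c (u ++ p)) * t) :: q)) s

/-- The part of a moment in which the block of the first letter begins with `u`. -/
def headMom (u w : List A) : D := fock ι c (blk ι E c u) w [1]

variable {ι E c}

@[simp] theorem fock_nil (F : List A → D) : fock ι c F [] = F := rfl

theorem fock_cons (F : List A → D) (e : A) (w : List A) :
    fock ι c F (e :: w) = fock ι c (act ι c F e) w := rfl

theorem fock_append (F : List A → D) (u w : List A) :
    fock ι c F (u ++ w) = fock ι c (fock ι c F u) w := by
  simp [fock, List.foldl_append]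

theorem fock_snoc (F : List A → D) (u : List A) (e : A) :
    fock ι c F (u ++ [e]) = act ι c (fock ι c F u) e := by
  simp [fock, List.foldl_append]

theorem act_add (F G : List A → D) (e : A) :
    act ι c (fun s => F s + G s) e = fun s => act ι c F e s + act ι c G e s := by
  funext s
  simp only [act, splitSum_add]
  abel

theorem act_sub (F G : List A → D) (e : A) :
    act ι c (fun s => F s - G s) e = fun s => act ι c F e s - act ι c G e s := by
  funext s
  simp only [act, splitSum_sub]
  abel

theorem act_mul_left (d : D) (F : List A → D) (e : A) :
    act ι c (fun s => d * F s) e = fun s => d * act ι c F e s := by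
  funext s
  simp only [act, mul_add, mul_splitSum]

theorem fock_add (F G : List A → D) (w : List A) :
    fock ι c (fun s => F s + G s) w = fun s => fock ι c F w s + fock ι c G w s := by
  induction w generalizing F G with
  | nil => rfl
  | cons e w ih => simp only [fock_cons, act_add, ih]

theorem fock_sub (F G : List A → D) (w : List A) :
    fock ι c (fun s => F s - G s) w = fun s => fock ι c F w s - fock ι c G w s := by
  induction w generalizing F G with
  | nil => rfl
  | cons e w ih => simp only [fock_cons, act_sub, ih]

theorem fock_mul_left (d : D) (F : List A → D) (w : List A) :
    fock ι c (fun s => d * F s) w = fun s => d * fock ι c F w s := by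
  induction w generalizing F with
  | nil => rfl
  | cons e w ih => simp only [fock_cons, act_mul_left, ih]

/-- An action never produces the empty stack: a push adds an entry, and a feeding step leaves the
entry that receives the value. -/
theorem act_congr {F G : List A → D} (h : ∀ s, s ≠ [] → F s = G s) (e : A) (s : List A) :
    act ι c F e s = act ι c G e s := by
  simp only [act, h _ (List.cons_ne_nil _ _)]

theorem fock_congr {F G : List A → D} (h : ∀ s, s ≠ [] → F s = G s) (w : List A) {s : List A}
    (hs : s ≠ []) : fock ι c F w s = fock ι c G w s := by
  induction w generalizing F G with
  | nil => exact h s hs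
  | cons e w ih => exact ih fun s _ => act_congr h e s

theorem fock_eq_zero {F : List A → D} {w s : List A}
    (h : ∀ l, l.length ≤ w.length + s.length → F l = 0) : fock ι c F w s = 0 := by
  induction w using List.reverseRecOn generalizing s with
  | nil => exact h s (by simp)
  | append_singleton w e ih =>
    rw [fock_snoc, act, ih, splitSum_eq_zero, add_zero]
    · intro p t q hs
      subst hs
      exact ih fun l hl => h l (by simp at hl ⊢; omega)
    · exact fun l hl => h l (by simp at hl ⊢; omega)

/-- A push lengthens the stack by one and a feeding step never lengthens it, so only the path on
which every letter of `w` is pushed reaches the full length. -/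
theorem fock_eq_of_length {F : List A → D} {w s : List A}
    (h : ∀ l, l.length < w.length + s.length → F l = 0) : fock ι c F w s = F (w ++ s) := by
  induction w using List.reverseRecOn generalizing s with
  | nil => rfl
  | append_singleton w e ih =>
    rw [fock_snoc, act, ih, splitSum_eq_zero, add_zero]
    · simp
    · intro p t q hs
      subst hs
      exact fock_eq_zero fun l hl => h l (by simp at hl ⊢; omega)
    · exact fun l hl => h l (by simp at hl ⊢; omega)

theorem vac_cons_of_ne_nil (a : A) {s : List A} (hs : s ≠ []) : vac E (a :: s) = 0 := by
  cases s with
  | nil => exact absurd rfl hs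
  | cons b s => rfl

theorem vac_of_one_lt {s : List A} (hs : 1 < s.length) : vac E s = 0 := by
  match s, hs with
  | _ :: _ :: _, _ => rfl

theorem slotAdd_vac : SlotAdd (vac E) := by
  intro u a b w
  match u, w with
  | [], [] => simp [vac]
  | [], _ :: _ => simp [vac]
  | [_], _ => simp [vac]
  | _ :: _ :: _, _ => simp [vac]

theorem slotAdd_act (hc : SlotAdd c) {F : List A → D} (hF : SlotAdd F) (e : A) :
    SlotAdd (act ι c F e) := by
  refine (hF.comp_cons e).fun_add fun u a b w => ?_
  simp only [splitSum_append, splitSum_cons, List.append_nil, ← List.cons_append]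
  simp only [mul_add, hF.cons]
  rw [splitSum_congr fun p t q _ => hF ((ι (c (e :: p)) * t) :: q) a b w, splitSum_add,
    splitSum_congr (w := w) fun p t q _ => by
      rw [hc (e :: u) a b p, map_add, add_mul, hF.cons], splitSum_add]
  simp only [List.cons_append]
  abel

theorem slotAdd_fock (hc : SlotAdd c) {F : List A → D} (hF : SlotAdd F) (w : List A) :
    SlotAdd (fock ι c F w) := by
  induction w generalizing F with
  | nil => exact hF
  | cons e w ih => exact ih (slotAdd_act hc hF e)

theorem act_add_letter (hc : SlotAdd c) {F : List A → D} (hF : SlotAdd F) (a b : A) :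
    act ι c F (a + b) = fun s => act ι c F a s + act ι c F b s := by
  funext s
  simp only [act, hF.cons, hc.cons, map_add, add_mul, splitSum_add]
  abel

theorem slotAdd_mom (hc : SlotAdd c) : SlotAdd (mom ι E c) := by
  intro u a b w
  simp only [mom, fock_append, fock_cons]
  rw [act_add_letter hc (slotAdd_fock hc slotAdd_vac u), fock_add]

/-- `F` is left `D`-linear in its first entry. -/
def LeftLin (ι : D →+* A) (F : List A → D) : Prop := ∀ d a w, F (ι d * a :: w) = d * F (a :: w)

theorem leftLin_mom (hE : ∀ d a, E (ι d * a) = d * E a) (hc : LeftLin ι c) :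
    LeftLin ι (mom ι E c) := by
  intro d a w
  simp only [mom, fock_cons]
  have hv : LeftLin ι (vac E) := by
    intro d a w
    cases w with
    | nil => exact hE d a
    | cons b w => simp [vac]
  have : act ι c (vac E) (ι d * a) = fun s => d * act ι c (vac E) a s := by
    funext s
    simp only [act, hv d, hc d, map_mul, mul_add, mul_splitSum, mul_assoc]
  rw [this, fock_mul_left]

theorem slotAdd_blk (hc : SlotAdd c) (u : List A) : SlotAdd (blk ι E c u) := by
  intro v a b w
  have hv := slotAdd_vac (E := E)
  simp only [blk, splitSum_append, splitSum_cons, List.append_nil]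
  simp only [mul_add, hv.cons, ← List.cons_append]
  rw [splitSum_congr fun p t q _ => hv ((ι (c (u ++ p)) * t) :: q) a b w, splitSum_add,
    splitSum_congr (w := w) fun p t q _ => by
      rw [← List.append_assoc, hc (u ++ v) a b p, map_add, add_mul, hv.cons], splitSum_add]
  simp only [List.cons_append, List.append_assoc]
  abel

theorem blk_cons (u : List A) (x : A) {s : List A} (hs : s ≠ []) :
    blk ι E c u (x :: s) = blk ι E c (u ++ [x]) s := by
  simp [blk, splitSum_cons, vac_cons_of_ne_nil _ hs]

/-- The first letter acts last. The vacuum functional sees only stacks with one entry, so this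
letter must take everything above the bottom. -/
theorem mom_cons (a : A) (w : List A) : mom ι E c (a :: w) = headMom ι E c [a] w := by
  refine fock_congr (fun s hs => ?_) w (List.cons_ne_nil _ _)
  simp [act, blk, vac_cons_of_ne_nil _ hs]

/-- The bottom of the stack is never fed to `c` and is only multiplied from the left, so a right
factor survives until `E` is applied. -/
theorem fock_vac_right (hE : ∀ a d, E (a * ι d) = E a * d) (w u : List A) (t : A) (d : D) :
    fock ι c (vac E) w (u ++ [t * ι d]) = fock ι c (vac E) w (u ++ [t]) * d := by
  induction w using List.reverseRecOn generalizing u t with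
  | nil => cases u with
    | nil => exact hE t d
    | cons b u => simp [vac_cons_of_ne_nil]
  | append_singleton w e ih =>
    simp only [fock_snoc, act, splitSum_append, splitSum_cons, splitSum_nil, add_zero, add_mul,
      splitSum_mul]
    congr 1
    · exact ih (e :: u) t
    · congr 1
      · exact splitSum_congr fun p x q _ => ih ((ι (c (e :: p)) * x) :: q) t
      · rw [← mul_assoc]
        exact ih [] _

/-- The two sums say what follows `u` in the open block. Either it is a letter `b` of `w`, and the
letters `p` before it form a gap that contributes their moment; or no letter of `w` joins, and `w`
acts on an initial part `p` of the stack only, with its value landing on the next entry `t`. General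
stacks are needed because the induction removes the last letter of `w`, which changes the stack. -/
theorem fock_blk (hE : ∀ a d, E (a * ι d) = E a * d) (hE1 : E 1 = 1) (hc : SlotAdd c)
    (u w : List A) {s : List A} (hs : s ≠ []) :
    fock ι c (blk ι E c u) w s =
      splitSum (fun p b q => fock ι c (blk ι E c (u ++ [ι (mom ι E c p) * b])) q s) w +
      splitSum (fun p t q => blk ι E c u ((ι (fock ι c (vac E) w (p ++ [1])) * t) :: q)) s := by
  have hb := slotAdd_blk (ι := ι) (E := E) hc u
  have hb0 : ∀ q, blk ι E c u (0 :: q) = 0 := fun q => hb.zero [] q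
  induction w using List.reverseRecOn generalizing s with
  | nil =>
    cases s with
    | nil => exact absurd rfl hs
    | cons t q =>
      simp only [splitSum_nil, zero_add, fock_nil, splitSum_cons, List.nil_append]
      rw [splitSum_eq_zero, add_zero]
      · simp [vac, hE1]
      · intro p t q _
        rw [List.cons_append, vac_cons_of_ne_nil _ (by simp)]
        simp [hb0]
  | append_singleton w e ih =>
    have hM : ∀ d, fock ι c (vac E) w [ι d] = mom ι E c w * d := by
      intro d
      have := fock_vac_right (c := c) hE w [] 1 d
      simpa [mom] using this
    rw [fock_snoc, act, ih (List.cons_ne_nil _ _),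
      splitSum_congr fun p t q _ => ih (List.cons_ne_nil _ _), splitSum_add]
    simp only [splitSum_append, splitSum_cons, splitSum_nil, add_zero, fock_nil, List.append_nil,
      List.nil_append, fock_snoc]
    rw [splitSum_splitSum_comm]
    simp only [act, splitSum_add]
    -- The term split off is the one in which `e` takes all of `S`: its value falls on the bottom
    -- `1`, and `w` contributes its whole moment.
    have e1 : ∀ S : List A, splitSum (fun p t q => fock ι c (vac E) w (ι (c (e :: p)) * t :: q))
        (S ++ [1]) = splitSum (fun p t q => fock ι c (vac E) w (ι (c (e :: p)) * t :: (q ++ [1]))) S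
          + mom ι E c w * c (e :: S) := by
      intro S
      simp [splitSum_append, splitSum_cons, hM]
    simp only [e1, map_add, add_mul, hb.cons, splitSum_add]
    -- An entry on top of a nonempty stack joins the open block; this gives the summand of the first
    -- sum in which `e` is the marked letter.
    rw [blk_cons u _ hs]
    simp only [map_mul, mul_assoc, splitSum_comm, mom, List.cons_append]
    have e2 : ∀ (S q : List A) (t : A), blk ι E c u
        (ι (splitSum (fun p t q => fock ι c (vac E) w (ι (c (e :: p)) * t :: (q ++ [1]))) S) * t :: q)
        = splitSum (fun p t' q' => blk ι E c u
          (ι (fock ι c (vac E) w (ι (c (e :: p)) * t' :: (q' ++ [1]))) * t :: q)) S := by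
      intro S q t
      exact map_splitSum (((hb.toAddMonoidHom [] q).comp (AddMonoidHom.mulRight t)).comp
        ι.toAddMonoidHom) _ S
    simp only [e2]
    abel

/-- On the stack `[1]` the first block either is complete, and all of `w` comes after it, or has a
next entry `b`. This is the recursion that the sum over noncrossing partitions obeys in
`sum_NCOn_next`. -/
theorem headMom_eq (hl : ∀ d a, E (ι d * a) = d * E a) (hE : ∀ a d, E (a * ι d) = E a * d)
    (hE1 : E 1 = 1) (hc : SlotAdd c) (u w : List A) :
    headMom ι E c u w = c u * mom ι E c w +
      splitSum (fun p b q => headMom ι E c (u ++ [ι (mom ι E c p) * b]) q) w := by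
  rw [headMom, fock_blk hE hE1 hc u w (List.cons_ne_nil _ _), add_comm]
  congr 1
  have : E (ι (mom ι E c w)) = mom ι E c w := by
    have := hl (mom ι E c w) 1
    rwa [mul_one, hE1, mul_one] at this
  simp [splitSum_cons, blk, vac, hl]
  rw [← mom, this]

end Fock

/-! ### Cumulants with a product as one of the arguments -/

section Merge

variable {A D : Type*} [Ring D]

/-- `cuts f v` is the sum of `f p q` over all decompositions `v = p ++ q`. -/
def cuts (f : List A → List A → D) (v : List A) : D :=
  splitSum (fun p t q => f p (t :: q)) v + f v []

theorem cuts_cons (f : List A → List A → D) (b : A) (v : List A) :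
    cuts f (b :: v) = f [] (b :: v) + cuts (fun p => f (b :: p)) v := by
  simp only [cuts, splitSum_cons, add_assoc]

@[simp] theorem cuts_nil (f : List A → List A → D) : cuts f [] = f [] [] := by simp [cuts]

theorem cuts_eq_zero {f : List A → List A → D} {v : List A}
    (h : ∀ p q, v = p ++ q → f p q = 0) : cuts f v = 0 := by
  rw [cuts, h v [] (by simp), add_zero]
  exact splitSum_eq_zero fun p t q hv => h p (t :: q) hv

variable [Ring A] (ι : D →+* A) (E : A →+ D) (c : List A → D)

/-- The terms of the merging formula in which the second factor stays in the block of the first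
argument and the first factor does not. -/
def leftTerms (u : List A) (a b : A) (w : List A) : D :=
  match u with
  | [] => 0
  | e :: v => cuts (fun p q => c (e :: (p ++ ι (c (q ++ [a])) * b :: w))) v

/-- The defect of the merging formula. -/
def mergeDefect (u : List A) (a b : A) (w : List A) : D :=
  c (u ++ (a * b) :: w) - c (u ++ a :: b :: w) -
    splitSum (fun p t q => c (u ++ a :: ι (c (b :: p)) * t :: q)) w - c (u ++ [a]) * c (b :: w) -
    leftTerms ι c u a b w

/-- The defect of the merging formula on stacks. -/
def stackDefect (F : List A → D) (v : List A) (a b : A) (s : List A) : D :=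
  F (v ++ (a * b) :: s) - F (v ++ a :: b :: s) -
    splitSum (fun p t q => F (v ++ a :: ι (c (b :: p)) * t :: q)) s -
    cuts (fun p q => F (p ++ ι (c (q ++ [a])) * b :: s)) v

variable {ι E c}

theorem SlotAdd.head_mul_sum {F : List A → D} (hF : SlotAdd F) (f : List A → A → List A → D)
    (w : List A) (t : A) (q : List A) :
    F (ι (splitSum f w) * t :: q) = splitSum (fun p x r => F (ι (f p x r) * t :: q)) w :=
  map_splitSum (((hF.toAddMonoidHom [] q).comp (AddMonoidHom.mulRight t)).comp
        ι.toAddMonoidHom) f w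

theorem SlotAdd.head_mul_sub {F : List A → D} (hF : SlotAdd F) (d d' : D) (t : A) (q : List A) :
    F (ι (d - d') * t :: q) = F (ι d * t :: q) - F (ι d' * t :: q) := by
  rw [map_sub, sub_mul]
  exact hF.sub [] q _ _

theorem SlotAdd.head_mul_add {F : List A → D} (hF : SlotAdd F) (d d' : D) (t : A) (q : List A) :
    F (ι (d + d') * t :: q) = F (ι d * t :: q) + F (ι d' * t :: q) := by
  rw [map_add, add_mul, hF.cons]

/-- The terms are sorted by how far the block opened by `e` extends into the stack: `e` is pushed;
its block ends inside `v`; it is exactly `e :: v`, with value landing on the merged entry; or it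
contains the merged entry. In the last case the cumulants combine to the defect with prefix `e ::
v`. -/
theorem stackDefect_act (hl : LeftLin ι c) {F : List A → D} (hF : SlotAdd F) (e : A) (v : List A)
    (a b : A) (s : List A) :
    stackDefect ι c (act ι c F e) v a b s =
      stackDefect ι c F (e :: v) a b s +
      splitSum (fun p t q => stackDefect ι c F (ι (c (e :: p)) * t :: q) a b s) v +
      stackDefect ι c F [] (ι (c (e :: v)) * a) b s +
      splitSum (fun p t q => F (ι (mergeDefect ι c (e :: v) a b p) * t :: q)) s := by
  have hl' : ∀ d a w, c (ι d * a :: w) = d * c (a :: w) := hl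
  simp only [stackDefect, mergeDefect, leftTerms, cuts, act, splitSum_append,
    splitSum_cons, splitSum_add, splitSum_sub, hF.head_mul_sub, hF.head_mul_add, hF.head_mul_sum,
    splitSum_nil, List.nil_append, List.append_nil, List.cons_append, hl', map_mul, mul_assoc]
  simp only [splitSum_comm]
  rw [splitSum_splitSum_comm (v := v) (w := s), splitSum_splitSum_comm (v := v) (w := s)]
  abel

theorem act_mul_sub_act_act {F : List A → D} (hF : SlotAdd F) (a b : A) (s : List A) :
    act ι c F (a * b) s - act ι c (act ι c F a) b s =
      stackDefect ι c F [] a b s +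
      splitSum (fun p t q => F (ι (mergeDefect ι c [] a b p) * t :: q)) s := by
  simp only [stackDefect, mergeDefect, leftTerms, cuts_nil, act, splitSum_cons, splitSum_add,
    splitSum_sub, hF.head_mul_sub, hF.head_mul_sum, List.nil_append, map_mul, mul_assoc, sub_zero]
  simp only [splitSum_comm]
  abel

/-- The contribution of the defects of the merging formula for the prefix `l`. -/
def defectTop (ι : D →+* A) (E : A →+ D) (c : List A → D) (l : List A) (a b : A) (s : List A) : D :=
  splitSum (fun p t q => vac E (ι (mergeDefect ι c l a b p) * t :: q)) s

theorem stackDefect_vac (v : List A) (a b : A) {s : List A} (hs : s ≠ []) :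
    stackDefect ι c (vac E) v a b s = 0 := by
  have hs' : 0 < s.length := List.length_pos_iff.2 hs
  rw [stackDefect, vac_of_one_lt, vac_of_one_lt, splitSum_eq_zero, cuts_eq_zero]
  · simp
  · intro p q _
    exact vac_of_one_lt (by simp; omega)
  · intro p t q _
    exact vac_of_one_lt (by simp; omega)
  · simp; omega
  · simp; omega

theorem defectTop_eq_zero {n : ℕ}
    (h : ∀ u a b w, u.length + w.length < n → mergeDefect ι c u a b w = 0)
    {l : List A} (a b : A) {s : List A} (hs : l.length + s.length ≤ n) :
    defectTop ι E c l a b s = 0 := by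
  refine splitSum_eq_zero fun p t q hp => ?_
  subst hp
  rw [h l a b p (by simp at hs; omega), map_zero, zero_mul]
  exact slotAdd_vac.zero [] q

/-- The length bound makes every defect produced by `stackDefect_act` vanish by `h`, except the one
in which all letters of `u` have joined the prefix. The vacuum functional itself has no stack
defect, whence the exceptional case `u = []`. -/
theorem stackDefect_fock (hc : SlotAdd c) (hl : LeftLin ι c) {n : ℕ}
    (h : ∀ u a b w, u.length + w.length < n → mergeDefect ι c u a b w = 0)
    (u v : List A) (a b : A) {s : List A} (hs : s ≠ [])
    (hn : u.length + v.length + s.length ≤ n + 1) :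
    stackDefect ι c (fock ι c (vac E) u) v a b s =
      if u = [] then 0 else defectTop ι E c (u ++ v) a b s := by
  induction u using List.reverseRecOn generalizing v a s with
  | nil => simpa using stackDefect_vac v a b hs
  | append_singleton u e ih =>
    have hF := slotAdd_fock (ι := ι) hc (slotAdd_vac (E := E)) u
    have hz : ∀ (v' : List A) (a' : A), v'.length ≤ v.length →
        stackDefect ι c (fock ι c (vac E) u) v' a' b s = 0 := by
      intro v' a' hv'
      simp only [List.length_append, List.length_singleton] at hn
      rw [ih v' a' hs (by omega)]
      split_ifs
      · rfl
      · exact defectTop_eq_zero h a' b (by simp; omega)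
    rw [fock_snoc, stackDefect_act hl hF, hz [] _ (by simp), splitSum_eq_zero]
    · rw [ih (e :: v) a hs (by simp at hn ⊢; omega)]
      by_cases hu : u = []
      · subst hu
        simp [defectTop]
      · rw [splitSum_eq_zero]
        · simp [hu]
        · intro p t q hp
          have : 0 < u.length := List.length_pos_iff.2 hu
          subst hp
          rw [h _ _ _ _ (by simp at hn ⊢; omega), map_zero, zero_mul]
          exact hF.zero [] q
    · intro p t q hp
      exact hz _ _ (by simp [hp])

/-- The formula for cumulants with a product as one of the arguments. -/
theorem mergeDefect_eq_zero (hl' : ∀ d a, E (ι d * a) = d * E a) (hE1 : E 1 = 1)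
    (hc : SlotAdd c) (hl : LeftLin ι c)
    (hm : ∀ u a b w, mom ι E c (u ++ (a * b) :: w) = mom ι E c (u ++ a :: b :: w))
    (u : List A) (a b : A) (w : List A) : mergeDefect ι c u a b w = 0 := by
  induction hn : u.length + w.length using Nat.strong_induction_on generalizing u a b w with
  | _ n ih =>
    have h : ∀ u a b w, u.length + w.length < n → mergeDefect ι c u a b w = 0 :=
      fun u a b w hlt => ih _ hlt u a b w rfl
    have hF := slotAdd_fock (ι := ι) hc (slotAdd_vac (E := E)) u
    have key : ∀ s, s ≠ [] → s.length ≤ w.length + 1 →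
        act ι c (fock ι c (vac E) u) (a * b) s - act ι c (act ι c (fock ι c (vac E) u) a) b s =
          defectTop ι E c u a b s := by
      intro s hs hsn
      rw [act_mul_sub_act_act hF, stackDefect_fock hc hl h u [] a b hs (by simp; omega)]
      split_ifs with hu
      · subst hu
        simp [defectTop]
      · rw [splitSum_eq_zero, add_zero, List.append_nil]
        intro p t q hp
        have : 0 < u.length := List.length_pos_iff.2 hu
        subst hp
        rw [h _ _ _ _ (by simp at hsn ⊢; omega), map_zero, zero_mul]
        exact hF.zero [] q
    set G : List A → D := fun s => act ι c (fock ι c (vac E) u) (a * b) s -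
      act ι c (act ι c (fock ι c (vac E) u) a) b s with hG
    -- The function `G` is controlled on nonempty stacks only; its value at `[]` never matters and
    -- is set to `0` so that `fock_eq_of_length` applies.
    have h0 : fock ι c (fun s => if s = [] then 0 else G s) w [1] = 0 := by
      rw [fock_congr (G := G) (fun s hs => if_neg hs) w (List.cons_ne_nil _ _), hG, fock_sub]
      have := hm u a b w
      simp only [mom, fock_append, fock_cons] at this
      exact sub_eq_zero.2 this
    -- On shorter stacks `G` involves only shorter defects, which are zero. The difference of the
    -- two moments is therefore the value of `G` at `w ++ [1]`, which is the defect for `u` and `w`.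
    rw [fock_eq_of_length, if_neg (by simp)] at h0
    · rw [hG] at h0
      simp only at h0
      rw [key _ (by simp) (by simp), defectTop, splitSum_append, splitSum_eq_zero] at h0
      · have h1 := hl' (mergeDefect ι c u a b w) 1
        rw [mul_one, hE1, mul_one] at h1
        simpa [splitSum_cons, vac, h1] using h0
      · intro p t q _
        exact vac_of_one_lt (by simp)
    · intro s hs
      split_ifs with hs0
      · rfl
      · rw [hG]
        simp only
        simp only [List.length_singleton] at hs
        rw [key _ hs0 (by omega)]
        exact defectTop_eq_zero h a b (by omega)

end Merge

/-! ### Cumulants of words in two free families and their products -/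

section Cuts

variable {A D : Type*} [Ring D]

theorem cuts_append (f : List A → List A → D) (u w : List A) :
    cuts f (u ++ w) = splitSum (fun p t q => f p (t :: (q ++ w))) u + cuts (fun p => f (u ++ p)) w := by
  simp only [cuts, splitSum_append, add_assoc]

theorem cuts_congr {f g : List A → List A → D} {v : List A}
    (h : ∀ p q, v = p ++ q → f p q = g p q) : cuts f v = cuts g v := by
  rw [cuts, cuts, h v [] (by simp)]
  congr 1
  exact splitSum_congr fun p t q hv => h p (t :: q) hv

theorem cuts_splitSum (f : List A → A → List A → List A → D) (w : List A) :
    cuts (fun r s => splitSum (fun p t q => f p t q s) r) w =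
      splitSum (fun p t r => cuts (fun q s => f p t q s) r) w := by
  simp only [cuts, splitSum_add, splitSum_comm]

theorem splitSum_map {κ : Type*} (g : κ → A) (f : List A → A → List A → D) (w : List κ) :
    splitSum f (w.map g) = splitSum (fun p t q => f (p.map g) (g t) (q.map g)) w := by
  induction w generalizing f with
  | nil => rfl
  | cons b w ih => simp [splitSum_cons, ih]

theorem cuts_map {κ : Type*} (g : κ → A) (f : List A → List A → D) (w : List κ) :
    cuts f (w.map g) = cuts (fun p q => f (p.map g) (q.map g)) w := by
  simp [cuts, splitSum_map]

end Cuts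

/-- The number of entries outside of `X ∪ Y`. -/
def prodCount {A : Type*} (X Y : Set A) (l : List A) : ℕ :=
  open Classical in l.countP fun e => ¬ (e ∈ X ∨ e ∈ Y)

section ProdCount

variable {A : Type*} {X Y : Set A}

theorem prodCount_append (u w : List A) :
    prodCount X Y (u ++ w) = prodCount X Y u + prodCount X Y w := by
  simp [prodCount]

theorem prodCount_cons (e : A) (l : List A) :
    prodCount X Y (e :: l) = prodCount X Y [e] + prodCount X Y l :=
  prodCount_append [e] l

theorem prodCount_left {x : A} (hx : x ∈ X) : prodCount X Y [x] = 0 := by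
  simp [prodCount, hx]

theorem prodCount_right {y : A} (hy : y ∈ Y) : prodCount X Y [y] = 0 := by
  simp [prodCount, hy]

theorem prodCount_of_not {e : A} (he : ¬ (e ∈ X ∨ e ∈ Y)) : prodCount X Y [e] = 1 := by
  simp [prodCount, he]

end ProdCount

section TwoFamilies

variable {A D : Type*} [Ring A] [Ring D]

/-- The properties of the cumulants `c` for two free families `X` and `Y`. -/
structure FreeCumulants (ι : D →+* A) (c : List A → D) (X Y : Set A) : Prop where
  slotAdd : SlotAdd c
  merge : ∀ u a b w, mergeDefect ι c u a b w = 0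
  mul_mem_left : ∀ d, ∀ x ∈ X, ι d * x ∈ X
  mul_mem_right : ∀ d, ∀ y ∈ Y, ι d * y ∈ Y
  mixed : ∀ (u v w : List A) (a b : A), (∀ e ∈ u ++ v ++ w, e ∈ X ∨ e ∈ Y) →
    (a ∈ X ∧ b ∈ Y ∨ a ∈ Y ∧ b ∈ X) → c (u ++ a :: v ++ b :: w) = 0

/-- `IsLetter X Y e`: `e` lies in `X` or in `Y` or is a product of an element of `X` and an element
of `Y`. -/
def IsLetter (X Y : Set A) (e : A) : Prop := (e ∈ X ∨ e ∈ Y) ∨ ∃ p ∈ X, ∃ q ∈ Y, e = p * q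

namespace FreeCumulants

variable {ι : D →+* A} {c : List A → D} {X Y : Set A} (h : FreeCumulants ι c X Y)

include h

theorem merge_eq (u : List A) (a b : A) (w : List A) :
    c (u ++ (a * b) :: w) = c (u ++ a :: b :: w) +
      splitSum (fun p t q => c (u ++ a :: ι (c (b :: p)) * t :: q)) w + c (u ++ [a]) * c (b :: w) +
      leftTerms ι c u a b w := by
  have := h.merge u a b w
  rw [mergeDefect] at this
  rw [← sub_eq_zero, ← this]
  abel

theorem prodCount_mul (d : D) (t : A) : prodCount X Y [ι d * t] ≤ prodCount X Y [t] := by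
  by_cases ht : t ∈ X ∨ t ∈ Y
  · rcases ht with ht | ht
    · simp [prodCount_left (h.mul_mem_left d t ht)]
    · simp [prodCount_right (h.mul_mem_right d t ht)]
  · rw [prodCount_of_not ht]
    by_cases ht' : ι d * t ∈ X ∨ ι d * t ∈ Y
    · rcases ht' with ht' | ht'
      · simp [prodCount_left ht']
      · simp [prodCount_right ht']
    · rw [prodCount_of_not ht']

theorem isLetter_mul (d : D) {t : A} (ht : IsLetter X Y t) : IsLetter X Y (ι d * t) := by
  rcases ht with (ht | ht) | ⟨p, hp, q, hq, rfl⟩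
  · exact Or.inl (Or.inl (h.mul_mem_left d t ht))
  · exact Or.inl (Or.inr (h.mul_mem_right d t ht))
  · exact Or.inr ⟨ι d * p, h.mul_mem_left d p hp, q, hq, (mul_assoc _ _ _).symm⟩

theorem zero_entry (u w : List A) (t : A) {d : D} (hd : d = 0) : c (u ++ ι d * t :: w) = 0 := by
  rw [hd, map_zero, zero_mul]
  exact h.slotAdd.zero u w

omit h in
theorem leftTerms_eq_zero {u : List A} {a b : A} {w : List A}
    (hz : ∀ u₁ u₂, u₁ ≠ [] → u = u₁ ++ u₂ → c (u₁ ++ ι (c (u₂ ++ [a])) * b :: w) = 0) :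
    leftTerms ι c u a b w = 0 := by
  cases u with
  | nil => rfl
  | cons e v => exact cuts_eq_zero fun p q hv => hz (e :: p) q (by simp) (by simp [hv])

/-- A cumulant vanishes if an entry from `X` is immediately followed by an entry from `Y`. -/
theorem eq_zero_of_adjacent (u : List A) (a b : A) (w : List A) (hu : ∀ e ∈ u, IsLetter X Y e)
    (hw : ∀ e ∈ w, IsLetter X Y e) (ha : a ∈ X) (hb : b ∈ Y) : c (u ++ a :: b :: w) = 0 := by
  induction hn : prodCount X Y u + prodCount X Y w using Nat.strong_induction_on
    generalizing u a b w with
  | _ n ih =>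
    by_cases hpl : ∀ e ∈ u ++ w, e ∈ X ∨ e ∈ Y
    · simpa using h.mixed u [] w a b (by simpa using hpl) (Or.inl ⟨ha, hb⟩)
    push Not at hpl
    obtain ⟨e, he, heX, heY⟩ := hpl
    have he1 : prodCount X Y [e] = 1 := prodCount_of_not (by tauto)
    have IH : ∀ (u : List A) (a b : A) (w : List A), prodCount X Y u + prodCount X Y w < n →
        (∀ e ∈ u, IsLetter X Y e) → (∀ e ∈ w, IsLetter X Y e) → a ∈ X → b ∈ Y →
        c (u ++ a :: b :: w) = 0 := fun u a b w hlt hu hw ha hb => ih _ hlt u a b w hu hw ha hb rfl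
    rcases List.mem_append.1 he with hm | hm
    · obtain ⟨u₁, u₂, rfl⟩ := List.append_of_mem hm
      obtain ⟨p, hp, q, hq, rfl⟩ := (hu e (by simp)).resolve_left (by tauto)
      have hpc := prodCount_left (Y := Y) hp
      have hqc := prodCount_right (X := X) hq
      have hpl : IsLetter X Y p := Or.inl (Or.inl hp)
      have hql : IsLetter X Y q := Or.inl (Or.inr hq)
      rw [prodCount_append, prodCount_cons] at hn
      simp only [List.forall_mem_append, List.forall_mem_cons] at hu
      obtain ⟨hu₁, -, hu₂⟩ := hu
      rw [List.append_assoc, List.cons_append, h.merge_eq]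
      -- The product `p * q` is opened by `merge_eq`. In each resulting term `a` and `b` remain
      -- neighbours up to a factor from `D`, or a new neighbouring pair from `X` and `Y` appears, or
      -- the inserted cumulant vanishes. Every appeal to the induction hypothesis has fewer
      -- products.
      have t1 : c (u₁ ++ p :: q :: (u₂ ++ a :: b :: w)) = 0 := by
        have := IH (u₁ ++ p :: q :: u₂) a b w
          (by rw [prodCount_append, prodCount_cons, prodCount_cons q]; omega)
          (by simpa only [List.forall_mem_append, List.forall_mem_cons, List.not_mem_nil, IsEmpty.forall_iff,
            implies_true, and_true] using ⟨hu₁, hpl, hql, hu₂⟩) hw ha hb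
        simpa using this
      have t2 : ∀ r s, r ++ s = w → c (q :: (u₂ ++ a :: b :: r)) = 0 := by
        rintro r s rfl
        rw [prodCount_append] at hn
        exact IH (q :: u₂) a b r (by rw [prodCount_cons]; omega)
          (List.forall_mem_cons.2 ⟨hql, hu₂⟩) (List.forall_mem_append.1 hw).1 ha hb
      rw [t1, t2 w [] (by simp), splitSum_append, splitSum_cons, splitSum_cons, splitSum_eq_zero,
        splitSum_eq_zero, leftTerms_eq_zero]
      -- The inserted cumulant lands on `a`, which keeps the pair `a, b`; in `t4` it lands on `b`,
      -- and the pair is now `p` with a multiple of `b`.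
      · have t3 := IH (u₁ ++ [p]) (ι (c (q :: (u₂ ++ []))) * a) b w
          (by rw [prodCount_append]; omega)
          (by simpa only [List.forall_mem_append, List.forall_mem_cons, List.not_mem_nil, IsEmpty.forall_iff,
            implies_true, and_true] using ⟨hu₁, hpl⟩) hw (h.mul_mem_left _ _ ha) hb
        have t4 := IH u₁ p (ι (c (q :: (u₂ ++ [a]))) * b) w (by omega) hu₁ hw hp
          (h.mul_mem_right _ _ hb)
        simp only [List.append_assoc, List.cons_append, List.nil_append] at t3
        rw [t3, t4]
        simp
      · rintro v₁ v₂ hv₁ rfl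
        rw [prodCount_append] at hn
        rw [List.forall_mem_append] at hu₁
        have := IH (v₁ ++ (ι (c (v₂ ++ [p])) * q) :: u₂) a b w
          (by rw [prodCount_append, prodCount_cons, prodCount_right (h.mul_mem_right _ _ hq)]; omega)
          (by simpa only [List.forall_mem_append, List.forall_mem_cons, List.not_mem_nil, IsEmpty.forall_iff,
            implies_true, and_true] using ⟨hu₁.1, h.isLetter_mul _ hql, hu₂⟩) hw ha hb
        simpa using this
      · intro r t s hr
        have := t2 r (t :: s) hr.symm
        have := h.zero_entry (u₁ ++ [p]) s t this
        simpa using this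
      · rintro r t s rfl
        rw [prodCount_append, prodCount_cons t] at hn
        have hd := h.prodCount_mul (c (q :: r)) t
        simp only [List.forall_mem_append, List.forall_mem_cons] at hu₂
        have := IH (u₁ ++ p :: (ι (c (q :: r)) * t) :: s) a b w
          (by rw [prodCount_append, prodCount_cons, prodCount_cons (_ * _)]; omega)
          (by simpa only [List.forall_mem_append, List.forall_mem_cons, List.not_mem_nil, IsEmpty.forall_iff,
            implies_true, and_true] using
            ⟨hu₁, hpl, h.isLetter_mul _ hu₂.2.1, hu₂.2.2⟩) hw ha hb
        simpa using this
    · obtain ⟨w₁, w₂, rfl⟩ := List.append_of_mem hm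
      obtain ⟨p, hp, q, hq, rfl⟩ := (hw e (by simp)).resolve_left (by tauto)
      have hpc := prodCount_left (Y := Y) hp
      have hqc := prodCount_right (X := X) hq
      have hpl : IsLetter X Y p := Or.inl (Or.inl hp)
      have hql : IsLetter X Y q := Or.inl (Or.inr hq)
      rw [prodCount_append, prodCount_cons] at hn
      simp only [List.forall_mem_append, List.forall_mem_cons] at hw
      obtain ⟨hw₁, -, hw₂⟩ := hw
      have e0 : u ++ a :: b :: (w₁ ++ p * q :: w₂) = (u ++ a :: b :: w₁) ++ p * q :: w₂ := by simp
      rw [e0, h.merge_eq]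
      have t1 : c (u ++ a :: b :: w₁ ++ p :: q :: w₂) = 0 := by
        have := IH u a b (w₁ ++ p :: q :: w₂)
          (by rw [prodCount_append, prodCount_cons, prodCount_cons q]; omega) hu
          (by simpa only [List.forall_mem_append, List.forall_mem_cons, List.not_mem_nil, IsEmpty.forall_iff,
            implies_true, and_true] using ⟨hw₁, hpl, hql, hw₂⟩) ha hb
        simpa using this
      have t2 : ∀ u₁ u₂, u = u₁ ++ u₂ → c (u₂ ++ a :: b :: (w₁ ++ [p])) = 0 := by
        rintro u₁ u₂ rfl
        rw [prodCount_append] at hn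
        exact IH u₂ a b (w₁ ++ [p]) (by rw [prodCount_append]; omega)
          (List.forall_mem_append.1 hu).2 (by simpa only [List.forall_mem_append, List.forall_mem_cons, List.not_mem_nil, IsEmpty.forall_iff,
            implies_true, and_true] using ⟨hw₁, hpl⟩) ha hb
      have t2' := t2 [] u rfl
      rw [t1, splitSum_eq_zero, leftTerms_eq_zero]
      · simp [t2']
      · intro v₁ v₂ hv₁ hv
        -- The position of the cut decides. Before `a`, the pair lies in the inserted cumulant;
        -- between `a` and `b`, the entry `a` is followed by a multiple of `q`; after `b`, the pair
        -- stays in the outer cumulant.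
        rcases List.append_eq_append_iff.1 hv with ⟨l, rfl, hl⟩ | ⟨l, rfl, rfl⟩
        · rcases l with _ | ⟨a', _ | ⟨b', l⟩⟩
          · obtain rfl : v₂ = a :: b :: w₁ := by simpa using hl.symm
            exact h.zero_entry _ _ _ (by simpa using t2 u [] (by simp))
          · obtain ⟨rfl, rfl⟩ : a' = a ∧ v₂ = b :: w₁ := by
              simp at hl; exact ⟨hl.1.symm, hl.2.symm⟩
            have := IH u a' (ι (c (b :: w₁ ++ [p])) * q) w₂ (by omega) hu hw₂ ha
              (h.mul_mem_right _ _ hq)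
            simpa using this
          · obtain ⟨rfl, rfl, rfl⟩ : a = a' ∧ b = b' ∧ w₁ = l ++ v₂ := by simpa using hl
            rw [prodCount_append] at hn
            rw [List.forall_mem_append] at hw₁
            have := IH u a b (l ++ (ι (c (v₂ ++ [p])) * q) :: w₂)
              (by rw [prodCount_append, prodCount_cons,
                    prodCount_right (h.mul_mem_right _ _ hq)]; omega) hu
              (by simpa only [List.forall_mem_append, List.forall_mem_cons, List.not_mem_nil, IsEmpty.forall_iff,
            implies_true, and_true] using
                ⟨hw₁.1, h.isLetter_mul _ hql, hw₂⟩) ha hb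
            simpa using this
        · exact h.zero_entry _ _ _ (by simpa using t2 v₁ l rfl)
      · rintro r t s rfl
        rw [prodCount_append, prodCount_cons t] at hn
        have hd := h.prodCount_mul (c (q :: r)) t
        simp only [List.forall_mem_append, List.forall_mem_cons] at hw₂
        have := IH u a b (w₁ ++ p :: (ι (c (q :: r)) * t) :: s)
          (by rw [prodCount_append, prodCount_cons, prodCount_cons (_ * _)]; omega) hu
          (by simpa only [List.forall_mem_append, List.forall_mem_cons, List.not_mem_nil, IsEmpty.forall_iff,
            implies_true, and_true] using
            ⟨hw₁, hpl, h.isLetter_mul _ hw₂.2.1, hw₂.2.2⟩) ha hb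
        simpa using this

/-- A cumulant vanishes if its first entry comes from `Y` and its last entry from `X`. -/
theorem eq_zero_of_ends (y : A) (u : List A) (x : A) (hu : ∀ e ∈ u, IsLetter X Y e)
    (hy : y ∈ Y) (hx : x ∈ X) : c (y :: (u ++ [x])) = 0 := by
  induction hn : prodCount X Y u using Nat.strong_induction_on generalizing u x with
  | _ n ih =>
    by_cases hpl : ∀ e ∈ u, e ∈ X ∨ e ∈ Y
    · simpa using h.mixed [] u [] y x (by simpa using hpl) (Or.inr ⟨hy, hx⟩)
    push Not at hpl
    obtain ⟨e, he, heX, heY⟩ := hpl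
    have he1 : prodCount X Y [e] = 1 := prodCount_of_not (by tauto)
    have IH : ∀ (u : List A) (x : A), prodCount X Y u < n →
        (∀ e ∈ u, IsLetter X Y e) → x ∈ X → c (y :: (u ++ [x])) = 0 :=
      fun u x hlt hu hx => ih _ hlt u x hu hx rfl
    obtain ⟨u₁, u₂, rfl⟩ := List.append_of_mem he
    obtain ⟨p, hp, q, hq, rfl⟩ := (hu e (by simp)).resolve_left (by tauto)
    have hpc := prodCount_left (Y := Y) hp
    have hqc := prodCount_right (X := X) hq
    have hpl : IsLetter X Y p := Or.inl (Or.inl hp)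
    have hql : IsLetter X Y q := Or.inl (Or.inr hq)
    rw [prodCount_append, prodCount_cons] at hn
    simp only [List.forall_mem_append, List.forall_mem_cons] at hu
    obtain ⟨hu₁, -, hu₂⟩ := hu
    have e0 : y :: (u₁ ++ p * q :: u₂ ++ [x]) = (y :: u₁) ++ p * q :: (u₂ ++ [x]) := by simp
    rw [e0, h.merge_eq]
    have t1 : c (y :: u₁ ++ p :: q :: (u₂ ++ [x])) = 0 := by
      have := IH (u₁ ++ p :: q :: u₂) x
        (by rw [prodCount_append, prodCount_cons, prodCount_cons q]; omega)
        (by simpa only [List.forall_mem_append, List.forall_mem_cons, List.not_mem_nil, IsEmpty.forall_iff,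
            implies_true, and_true] using ⟨hu₁, hpl, hql, hu₂⟩) hx
      simpa using this
    have t2 : c (y :: u₁ ++ [p]) = 0 := IH u₁ p (by omega) hu₁ hp
    have t3 := IH (u₁ ++ [p]) (ι (c (q :: (u₂ ++ []))) * x) (by rw [prodCount_append]; omega)
      (by simpa only [List.forall_mem_append, List.forall_mem_cons, List.not_mem_nil, IsEmpty.forall_iff,
            implies_true, and_true] using ⟨hu₁, hpl⟩) (h.mul_mem_left _ _ hx)
    rw [t1, t2, splitSum_append, splitSum_cons, splitSum_nil, splitSum_eq_zero, leftTerms_eq_zero]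
    · simpa using t3
    -- The outer cumulant of a left term keeps the first argument, so it still begins with `y` and
    -- ends with `x`.
    · intro v₁ v₂ hv₁ hv
      cases v₁ with
      | nil => exact absurd rfl hv₁
      | cons y' v₁ =>
        obtain ⟨rfl, rfl⟩ : y = y' ∧ u₁ = v₁ ++ v₂ := by simpa using hv
        rw [prodCount_append] at hn
        rw [List.forall_mem_append] at hu₁
        have := IH (v₁ ++ (ι (c (v₂ ++ [p])) * q) :: u₂) x
          (by rw [prodCount_append, prodCount_cons, prodCount_right (h.mul_mem_right _ _ hq)]; omega)
          (by simpa only [List.forall_mem_append, List.forall_mem_cons, List.not_mem_nil, IsEmpty.forall_iff,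
            implies_true, and_true] using ⟨hu₁.1, h.isLetter_mul _ hql, hu₂⟩) hx
        simpa using this
    · rintro r t s rfl
      rw [prodCount_append, prodCount_cons t] at hn
      have hd := h.prodCount_mul (c (q :: r)) t
      simp only [List.forall_mem_append, List.forall_mem_cons] at hu₂
      have := IH (u₁ ++ p :: (ι (c (q :: r)) * t) :: s) x
        (by rw [prodCount_append, prodCount_cons, prodCount_cons (_ * _)]; omega)
        (by simpa only [List.forall_mem_append, List.forall_mem_cons, List.not_mem_nil, IsEmpty.forall_iff,
            implies_true, and_true] using
          ⟨hu₁, hpl, h.isLetter_mul _ hu₂.2.1, hu₂.2.2⟩) hx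
      simpa using this

/-- The first product after a sequence of entries from `X`. -/
theorem first_product {u : List A} (hu : ∀ e ∈ u, e ∈ X) {p q : A} (hp : p ∈ X) (hq : q ∈ Y)
    {w : List A} (hw : ∀ e ∈ w, IsLetter X Y e) :
    c (u ++ (p * q) :: w) = c (u ++ [p]) * c (q :: w) +
      splitSum (fun r t s => c (u ++ p :: ι (c (q :: r)) * t :: s)) w := by
  have hul : ∀ e ∈ u, IsLetter X Y e := fun e he => Or.inl (Or.inl (hu e he))
  rw [h.merge_eq, h.eq_zero_of_adjacent u p q w hul hw hp hq, leftTerms_eq_zero]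
  · abel
  -- What is left of `u` in the outer cumulant is nonempty and ends in `X`, and a multiple of `q`
  -- from `Y` follows it.
  · rintro v₁ v₂ hv₁ rfl
    obtain ⟨v, x, rfl⟩ := List.eq_nil_or_concat'  v₁ |>.resolve_left hv₁
    rw [List.append_assoc]
    refine h.eq_zero_of_adjacent v x _ w (fun e he => hul e (by simp [he])) hw (hu x (by simp))
      (h.mul_mem_right _ _ hq)

/-- The last product before a sequence of entries from `Y`. -/
theorem last_product {y : A} (hy : y ∈ Y) {u : List A} (hu : ∀ e ∈ u, IsLetter X Y e) {p q : A}
    (hp : p ∈ X) (hq : q ∈ Y) {w : List A} (hw : ∀ e ∈ w, e ∈ Y) :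
    c (y :: u ++ (p * q) :: w) =
      cuts (fun r s => c (y :: (r ++ ι (c (s ++ [p])) * q :: w))) u := by
  have hwl : ∀ e ∈ w, IsLetter X Y e := fun e he => Or.inl (Or.inr (hw e he))
  have hul : ∀ e ∈ y :: u, IsLetter X Y e := List.forall_mem_cons.2 ⟨Or.inl (Or.inr hy), hu⟩
  rw [h.merge_eq, h.eq_zero_of_adjacent (y :: u) p q w hul hwl hp hq, splitSum_eq_zero,
    List.cons_append, h.eq_zero_of_ends y u p hu hy hp, leftTerms]
  · simp
  · rintro r t s rfl
    simp only [List.forall_mem_append, List.forall_mem_cons] at hw hwl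
    exact h.eq_zero_of_adjacent (y :: u) p _ s hul hwl.2.2 hp (h.mul_mem_right _ _ hw.2.1)

variable {κ : Type*} {x y : κ → A}

/-- In `last_product` a cut inside `v` would insert a cumulant that begins in `Y` and ends with `x
k`. Such cumulants are zero, so only cuts among the products remain. -/
theorem last_product_of_right (hx : ∀ i, x i ∈ X) (hy : ∀ i, y i ∈ Y) {v w : List A} (hv : v ≠ [])
    (hvY : ∀ e ∈ v, e ∈ Y) (hw : ∀ e ∈ w, e ∈ Y) (L : List κ) (k : κ) :
    c (v ++ (L ++ [k]).map (fun i => x i * y i) ++ w) =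
      cuts (fun r s => c (v ++ r.map (fun i => x i * y i) ++
        ι (c (s.map (fun i => x i * y i) ++ [x k])) * y k :: w)) L := by
  have hL : ∀ e ∈ L.map (fun i => x i * y i), IsLetter X Y e := by
    simp only [List.forall_mem_map]
    exact fun i _ => Or.inr ⟨x i, hx i, y i, hy i, rfl⟩
  cases v with
  | nil => exact absurd rfl hv
  | cons b v =>
    rw [List.forall_mem_cons] at hvY
    have hvl : ∀ e ∈ v, IsLetter X Y e := fun e he => Or.inl (Or.inr (hvY.2 e he))
    have e0 : b :: v ++ (L ++ [k]).map (fun i => x i * y i) ++ w =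
        b :: (v ++ L.map fun i => x i * y i) ++ (x k * y k) :: w := by simp
    rw [e0, h.last_product hvY.1 (List.forall_mem_append.2 ⟨hvl, hL⟩) (hx k) (hy k) hw,
      cuts_append, splitSum_eq_zero, zero_add, cuts_map]
    · simp
    · rintro r t s rfl
      simp only [List.forall_mem_append, List.forall_mem_cons] at hvY hvl
      refine h.zero_entry (b :: r) w (y k) ?_
      have := h.eq_zero_of_ends t (s ++ L.map fun i => x i * y i) (x k)
        (List.forall_mem_append.2 ⟨hvl.2.2, hL⟩) hvY.2.2.1 (hx k)
      simpa using this

/-- Decomposition of a cumulant with a sequence of products among entries from `Y`. -/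
theorem products_among_right (hx : ∀ i, x i ∈ X) (hy : ∀ i, y i ∈ Y) {v w : List A} (hv : v ≠ [])
    (hvY : ∀ e ∈ v, e ∈ Y) (hw : ∀ e ∈ w, e ∈ Y) {L : List κ} (hL : L ≠ []) :
    c (v ++ L.map (fun i => x i * y i) ++ w) =
      splitSum (fun r t s => c (v ++ ι (c (r.map (fun i => x i * y i) ++ [x t])) * y t ::
        (s.map (fun i => x i * y i) ++ w))) L := by
  induction hn : L.length using Nat.strong_induction_on generalizing w L with
  | _ n ih =>
    obtain ⟨L, k, rfl⟩ := (List.eq_nil_or_concat' L).resolve_left hL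
    rw [h.last_product_of_right hx hy hv hvY hw, splitSum_append, splitSum_cons, splitSum_nil,
      add_zero, List.append_nil]
    -- Opening the last product turns it into an entry from `Y`, so the shorter sequence `r` is
    -- covered by the induction hypothesis with one more entry in `w`. The case `r = []` has no
    -- product left and is kept apart.
    have key : ∀ r s, L = r ++ s → c (v ++ r.map (fun i => x i * y i) ++
        ι (c (s.map (fun i => x i * y i) ++ [x k])) * y k :: w) =
        splitSum (fun p t q => c (v ++ ι (c (p.map (fun i => x i * y i) ++ [x t])) * y t ::
        (q.map (fun i => x i * y i) ++
          ι (c (s.map (fun i => x i * y i) ++ [x k])) * y k :: w))) r +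
        if r = [] then c (v ++ ι (c (L.map (fun i => x i * y i) ++ [x k])) * y k :: w) else 0 := by
      intro r s hrs
      by_cases hr : r = []
      · subst hr
        simp only [List.nil_append] at hrs
        subst hrs
        simp
      · rw [if_neg hr, add_zero]
        refine ih r.length ?_ ?_ hr rfl
        · rw [← hn, hrs]; simp
        · exact List.forall_mem_cons.2 ⟨h.mul_mem_right _ _ (hy k), hw⟩
    rw [cuts_congr key]
    have e1 : ∀ (f g : List κ → List κ → D), cuts (fun r s => f r s + g r s) L =
        cuts f L + cuts g L := by
      intro f g
      simp only [cuts, splitSum_add]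
      abel
    rw [e1, cuts_splitSum]
    congr 1
    -- For a fixed first opened product `t`, the sum over the later cuts is `last_product_of_right`
    -- read backwards, with the entry made from `t` appended to `v`.
    · refine splitSum_congr fun r t s hs => ?_
      have := h.last_product_of_right hx hy
        (v := v ++ [ι (c (r.map (fun i => x i * y i) ++ [x t])) * y t]) (w := w) (by simp)
        (List.forall_mem_append.2 ⟨hvY, by simpa using h.mul_mem_right _ _ (hy t)⟩) hw s k
      simp only [List.append_assoc, List.cons_append, List.nil_append] at this ⊢
      exact this.symm
    · cases L with
      | nil => simp
      | cons l L =>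
        rw [cuts_cons, cuts_eq_zero (fun p q _ => by simp)]
        simp

/-- Sums of entries from `X` and entries from `Y` do not contribute to mixed cumulants. -/
theorem mixed_sums {a b : A} (hab : a ∈ X ∧ b ∈ Y ∨ a ∈ Y ∧ b ∈ X) (u v : List A)
    (huv : ∀ e ∈ u ++ v, e ∈ X ∨ e ∈ Y) (hx : ∀ i, x i ∈ X) (hy : ∀ i, y i ∈ Y) (L : List κ) :
    c (u ++ a :: v ++ b :: L.map fun i => x i + y i) = 0 := by
  -- The list `w` collects the summands already chosen, so that the sums can be expanded one by one
  -- from the left.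
  suffices ∀ w, (∀ e ∈ w, e ∈ X ∨ e ∈ Y) →
      c (u ++ a :: v ++ b :: (w ++ L.map fun i => x i + y i)) = 0 from this [] (by simp)
  induction L with
  | nil =>
    intro w hw
    simp only [List.map_nil, List.append_nil]
    exact h.mixed u v w a b (List.forall_mem_append.2 ⟨huv, hw⟩) hab
  | cons i L ih =>
    intro w hw
    have e0 : ∀ z, u ++ a :: v ++ b :: (w ++ z :: L.map fun i => x i + y i) =
        (u ++ a :: v ++ b :: w) ++ z :: L.map fun i => x i + y i := by simp
    have e1 : ∀ z, u ++ a :: v ++ b :: (w ++ z :: L.map fun i => x i + y i) =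
        u ++ a :: v ++ b :: ((w ++ [z]) ++ L.map fun i => x i + y i) := by simp
    rw [List.map_cons, e0, h.slotAdd, ← e0, ← e0, e1, e1, ih, ih, add_zero]
    · simpa only [List.forall_mem_append, List.forall_mem_cons, List.not_mem_nil, IsEmpty.forall_iff,
            implies_true, and_true] using ⟨hw, Or.inr (hy i)⟩
    · simpa only [List.forall_mem_append, List.forall_mem_cons, List.not_mem_nil, IsEmpty.forall_iff,
            implies_true, and_true] using ⟨hw, Or.inl (hx i)⟩

/-- Once an entry comes from `X`, choosing `y i` in any later sum gives a mixed cumulant. -/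
theorem sums_after_left (hx : ∀ i, x i ∈ X) (hy : ∀ i, y i ∈ Y) (L : List κ) (u : List A) {a : A}
    (ha : a ∈ X) (hu : ∀ e ∈ u, e ∈ X) :
    c (a :: (u ++ L.map fun i => x i + y i)) = c (a :: (u ++ L.map x)) := by
  induction L generalizing u with
  | nil => simp
  | cons i L ih =>
    have hz := h.mixed_sums (Or.inl ⟨ha, hy i⟩) [] u (fun e he => Or.inl (hu e he)) hx hy L
    have e0 := h.slotAdd (a :: u) (x i) (y i) (L.map fun i => x i + y i)
    have e1 := ih (u ++ [x i]) (by simpa only [List.forall_mem_append, List.forall_mem_cons, List.not_mem_nil, IsEmpty.forall_iff,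
            implies_true, and_true] using ⟨hu, hx i⟩)
    simp only [List.cons_append, List.nil_append, List.append_assoc, List.map_cons] at *
    rw [e0, hz, e1, add_zero]

theorem sums_after_right (hx : ∀ i, x i ∈ X) (hy : ∀ i, y i ∈ Y) (L : List κ) (u : List A) {a : A}
    (ha : a ∈ Y) (hu : ∀ e ∈ u, e ∈ Y) :
    c (a :: (u ++ L.map fun i => x i + y i)) = c (a :: (u ++ L.map y)) := by
  induction L generalizing u with
  | nil => simp
  | cons i L ih =>
    have hz := h.mixed_sums (Or.inr ⟨ha, hx i⟩) [] u (fun e he => Or.inr (hu e he)) hx hy L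
    have e0 := h.slotAdd (a :: u) (x i) (y i) (L.map fun i => x i + y i)
    have e1 := ih (u ++ [y i]) (by simpa only [List.forall_mem_append, List.forall_mem_cons, List.not_mem_nil, IsEmpty.forall_iff,
            implies_true, and_true] using ⟨hu, hy i⟩)
    simp only [List.cons_append, List.nil_append, List.append_assoc, List.map_cons] at *
    rw [e0, hz, e1, zero_add]

theorem map_add_eq (hx : ∀ i, x i ∈ X) (hy : ∀ i, y i ∈ Y) {L : List κ} (hL : L ≠ []) :
    c (L.map fun i => x i + y i) = c (L.map x) + c (L.map y) := by
  cases L with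
  | nil => exact absurd rfl hL
  | cons i L =>
    have h1 := h.sums_after_left hx hy L [] (hx i) (by simp)
    have h2 := h.sums_after_right hx hy L [] (hy i) (by simp)
    simp only [List.nil_append] at h1 h2
    rw [List.map_cons, h.slotAdd.cons, h1, h2, List.map_cons, List.map_cons]

end FreeCumulants

end TwoFamilies

/-! ### Evaluation along a noncrossing relation -/

section Eval

variable {A D : Type*} [Ring A] [Ring D] (ι : D →+* A) (c : List A → D)

/-- The contribution of the block `{p} ∪ V` with the elements `w v` inserted. -/
def blockVal {κ : Type*} [LinearOrder κ] (a : κ → A) (p : κ) (V : Finset κ) (w : κ → D) : D :=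
  c (a p :: V.sort.map fun v => ι (w v) * a v)

/-- The nested evaluation in which the blocks contribute their values under `c`. -/
def relEval {κ : Type*} [LinearOrder κ] (a : κ → A) (r : κ → κ → Prop) (S : Finset κ) : D :=
  nestedEval r (blockVal ι c a) S

variable {ι c}

theorem blockVal_congr {κ : Type*} [LinearOrder κ] {a a' : κ → A} {p : κ} {V : Finset κ}
    {w w' : κ → D} (ha : a p = a' p) (h : ∀ v ∈ V, a v = a' v ∧ w v = w' v) :
    blockVal ι c a p V w = blockVal ι c a' p V w' := by
  rw [blockVal, blockVal, ha]
  congr 2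
  refine List.map_congr_left fun v hv => ?_
  obtain ⟨h1, h2⟩ := h v (by simpa using hv)
  rw [h1, h2]

theorem relEval_empty {κ : Type*} [LinearOrder κ] (a : κ → A) (r : κ → κ → Prop) :
    relEval ι c a r ∅ = 1 := by
  rw [relEval, nestedEval, dif_neg (by simp)]

theorem relEval_of_min {κ : Type*} [LinearOrder κ] (a : κ → A) (r : κ → κ → Prop) {S : Finset κ}
    {p : κ} (hp : p ∈ S) (hmin : ∀ t ∈ S, p ≤ t) :
    relEval ι c a r S =
      blockVal ι c a p (blockRest r S p) (fun v => relEval ι c a r (gapBefore r S p v)) *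
        relEval ι c a r (tailAfter r S p) := by
  have hS : S.Nonempty := ⟨p, hp⟩
  have : S.min' hS = p := le_antisymm (Finset.min'_le _ _ hp) (Finset.le_min' _ _ _ hmin)
  rw [relEval, nestedEval, dif_pos hS, this]
  rfl

theorem mem_blockRest {κ : Type*} [LinearOrder κ] {r : κ → κ → Prop} {S : Finset κ} {p t : κ} :
    t ∈ blockRest r S p ↔ t ∈ S ∧ t ≠ p ∧ r p t := by
  simp [blockRest]

theorem mem_gapBefore {κ : Type*} [LinearOrder κ] {r : κ → κ → Prop} {S : Finset κ} {p v t : κ} :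
    t ∈ gapBefore r S p v ↔ t ∈ S ∧ p < t ∧ t < v ∧ ∀ u ∈ blockRest r S p, u < t ∨ v ≤ u := by
  simp [gapBefore]

theorem mem_tailAfter {κ : Type*} [LinearOrder κ] {r : κ → κ → Prop} {S : Finset κ} {p t : κ} :
    t ∈ tailAfter r S p ↔ t ∈ S ∧ p < t ∧ ∀ u ∈ blockRest r S p, u < t := by
  simp [tailAfter]

/-- The evaluation is transported along an order embedding. -/
theorem relEval_map {κ κ' : Type*} [LinearOrder κ] [LinearOrder κ'] (e : κ ↪o κ') {a : κ → A}
    {a' : κ' → A} {r : κ → κ → Prop} {r' : κ' → κ' → Prop} (S : Finset κ)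
    (ha : ∀ i ∈ S, a' (e i) = a i) (hr : ∀ i ∈ S, ∀ j ∈ S, (r' (e i) (e j) ↔ r i j)) :
    relEval ι c a' r' (S.map e.toEmbedding) = relEval ι c a r S := by
  induction hn : S.card using Nat.strong_induction_on generalizing S with
  | _ n ih =>
    rcases S.eq_empty_or_nonempty with rfl | hS
    · simp [relEval_empty]
    obtain ⟨p, hp, hmin⟩ : ∃ p ∈ S, ∀ t ∈ S, p ≤ t :=
      ⟨S.min' hS, S.min'_mem hS, fun t ht => S.min'_le t ht⟩
    have hB : blockRest r' (S.map e.toEmbedding) (e p) = (blockRest r S p).map e.toEmbedding := by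
      ext t
      simp only [mem_blockRest, Finset.mem_map, RelEmbedding.coe_toEmbedding]
      constructor
      · rintro ⟨⟨t, ht, rfl⟩, h1, h2⟩
        exact ⟨t, ⟨ht, fun h => h1 (by rw [h]), (hr p hp t ht).1 h2⟩, rfl⟩
      · rintro ⟨t, ⟨ht, h1, h2⟩, rfl⟩
        exact ⟨⟨t, ht, rfl⟩, fun h => h1 (e.injective h), (hr p hp t ht).2 h2⟩
    have hG : ∀ v, gapBefore r' (S.map e.toEmbedding) (e p) (e v) =
        (gapBefore r S p v).map e.toEmbedding := by
      intro v
      ext t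
      simp only [mem_gapBefore, hB, Finset.mem_map, RelEmbedding.coe_toEmbedding]
      constructor
      · rintro ⟨⟨t, ht, rfl⟩, h1, h2, h3⟩
        exact ⟨t, ⟨ht, by simpa using h1, by simpa using h2, fun u hu => by
          simpa using h3 (e u) ⟨u, hu, rfl⟩⟩, rfl⟩
      · rintro ⟨t, ⟨ht, h1, h2, h3⟩, rfl⟩
        refine ⟨⟨t, ht, rfl⟩, by simpa using h1, by simpa using h2, ?_⟩
        rintro _ ⟨u, hu, rfl⟩
        simpa using h3 u hu
    have hT : tailAfter r' (S.map e.toEmbedding) (e p) = (tailAfter r S p).map e.toEmbedding := by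
      ext t
      simp only [mem_tailAfter, hB, Finset.mem_map, RelEmbedding.coe_toEmbedding]
      constructor
      · rintro ⟨⟨t, ht, rfl⟩, h1, h3⟩
        exact ⟨t, ⟨ht, by simpa using h1, fun u hu => by
          simpa using h3 (e u) ⟨u, hu, rfl⟩⟩, rfl⟩
      · rintro ⟨t, ⟨ht, h1, h3⟩, rfl⟩
        refine ⟨⟨t, ht, rfl⟩, by simpa using h1, ?_⟩
        rintro _ ⟨u, hu, rfl⟩
        simpa using h3 u hu
    have hsub : ∀ {S' : Finset κ}, (∀ t ∈ S', t ∈ S) → S'.card < S.card →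
        relEval ι c a' r' (S'.map e.toEmbedding) = relEval ι c a r S' := fun hS' hc =>
      ih _ (hn ▸ hc) _ (fun i hi => ha i (hS' i hi))
        (fun i hi j hj => hr i (hS' i hi) j (hS' j hj)) rfl
    have hmin' : ∀ t ∈ S.map e.toEmbedding, e p ≤ t := by
      intro t ht
      obtain ⟨t', ht', rfl⟩ := Finset.mem_map.1 ht
      simpa using hmin t' ht'
    rw [relEval_of_min a r hp hmin,
      relEval_of_min a' r' (Finset.mem_map_of_mem e.toEmbedding hp) hmin',
      RelEmbedding.coe_toEmbedding, hB, hT,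
      hsub (fun t ht => (mem_tailAfter.1 ht).1) (card_tailAfter_lt r hp)]
    congr 1
    rw [blockVal, blockVal, ha p hp,
      ← StrictMonoOn.map_finsetSort (f := e.toEmbedding) (s := blockRest r S p)
        (e.strictMono.strictMonoOn _), List.map_map]
    congr 2
    refine List.map_congr_left fun v hv => ?_
    have hv' : v ∈ S := (mem_blockRest.1 (by simpa using hv)).1
    simp only [Function.comp_apply, RelEmbedding.coe_toEmbedding]
    rw [hG, ha v hv', hsub (fun t ht => (mem_gapBefore.1 ht).1) (card_gapBefore_lt r hp v)]

theorem relEval_congr {κ : Type*} [LinearOrder κ] {a a' : κ → A} {r r' : κ → κ → Prop}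
    {S : Finset κ} (ha : ∀ i ∈ S, a' i = a i) (hr : ∀ i ∈ S, ∀ j ∈ S, (r' i j ↔ r i j)) :
    relEval ι c a' r' S = relEval ι c a r S := by
  have := relEval_map (ι := ι) (c := c) (RelEmbedding.refl (· ≤ ·)) (a := a) (a' := a')
    (r := r) (r' := r') S ha hr
  rw [← this]
  congr 1
  ext
  simp

variable (ι c)

/-- The evaluation over `{i, …, j - 1}`, where the block of `i` is preceded by the entries `u`,
and `d` is inserted in front of its first entry. -/
def chainEval (a : ℕ → A) (r : ℕ → ℕ → Prop) (u : List A) (d : D) (i j : ℕ) : D :=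
  c (u ++ (ι d * a i) :: (blockRest r (Finset.Ico i j) i).sort.map fun v =>
    ι (relEval ι c a r (gapBefore r (Finset.Ico i j) i v)) * a v) *
      relEval ι c a r (tailAfter r (Finset.Ico i j) i)

variable {ι c}

theorem relEval_Ico (a : ℕ → A) (r : ℕ → ℕ → Prop) {i j : ℕ} (hij : i < j) :
    relEval ι c a r (Finset.Ico i j) = chainEval ι c a r [] 1 i j := by
  rw [relEval_of_min a r (p := i) (by simp [hij]) (by simp; omega)]
  simp [chainEval, blockVal]

theorem chainEval_congr {a : ℕ → A} {r r' : ℕ → ℕ → Prop} {i j : ℕ} (hij : i < j)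
    (hr : ∀ s ∈ Finset.Ico i j, ∀ t ∈ Finset.Ico i j, (r' s t ↔ r s t)) (u : List A) (d : D) :
    chainEval ι c a r' u d i j = chainEval ι c a r u d i j := by
  have hi : i ∈ Finset.Ico i j := by simp [hij]
  have hB : blockRest r' (Finset.Ico i j) i = blockRest r (Finset.Ico i j) i := by
    ext t
    simp only [mem_blockRest]
    constructor
    · rintro ⟨h1, h2, h3⟩
      exact ⟨h1, h2, (hr i hi t h1).1 h3⟩
    · rintro ⟨h1, h2, h3⟩
      exact ⟨h1, h2, (hr i hi t h1).2 h3⟩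
  have hG : ∀ v, gapBefore r' (Finset.Ico i j) i v = gapBefore r (Finset.Ico i j) i v := by
    intro v
    ext t
    simp only [mem_gapBefore, hB]
  have hT : tailAfter r' (Finset.Ico i j) i = tailAfter r (Finset.Ico i j) i := by
    ext t
    simp only [mem_tailAfter, hB]
  have hE : ∀ S ⊆ Finset.Ico i j, relEval ι c a r' S = relEval ι c a r S := fun S hS =>
    relEval_congr (fun _ _ => rfl) fun s hs t ht => hr s (hS hs) t (hS ht)
  rw [chainEval, chainEval, hB, hT, hE _ fun t ht => (mem_tailAfter.1 ht).1]
  simp only [hG]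
  simp only [hE _ fun t ht => (mem_gapBefore.1 ht).1]

/-- The first point is the last one of its block. -/
theorem chainEval_last (a : ℕ → A) (r : ℕ → ℕ → Prop) (u : List A) (d : D) {i j : ℕ}
    (h : ∀ t, i < t → t < j → ¬ r i t) :
    chainEval ι c a r u d i j =
      c (u ++ [ι d * a i]) * relEval ι c a r (Finset.Ico (i + 1) j) := by
  have hB : blockRest r (Finset.Ico i j) i = ∅ := by
    ext t
    simp only [mem_blockRest, Finset.mem_Ico, Finset.notMem_empty, iff_false]
    rintro ⟨h1, h2, h3⟩
    exact h t (by omega) h1.2 h3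
  have hT : tailAfter r (Finset.Ico i j) i = Finset.Ico (i + 1) j := by
    ext t
    simp only [mem_tailAfter, hB, Finset.mem_Ico, Finset.notMem_empty]
    simp
    omega
  rw [chainEval, hB, hT]
  simp

/-- The point after the first one in its block is `v`. -/
theorem chainEval_next (a : ℕ → A) (r : ℕ → ℕ → Prop) (u : List A) (d : D) {i v j : ℕ}
    (hiv : i < v) (hvj : v < j) (hr : r i v) (hnext : ∀ t, i < t → t < v → ¬ r i t)
    (hv : ∀ t, v < t → t < j → (r i t ↔ r v t)) :
    chainEval ι c a r u d i j =
      chainEval ι c a r (u ++ [ι d * a i]) (relEval ι c a r (Finset.Ico (i + 1) v)) v j := by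
  have hB : blockRest r (Finset.Ico i j) i = insert v (blockRest r (Finset.Ico v j) v) := by
    ext t
    simp only [mem_blockRest, Finset.mem_Ico, Finset.mem_insert]
    constructor
    · rintro ⟨h1, h2, h3⟩
      rcases lt_trichotomy t v with h | h | h
      · exact absurd h3 (hnext t (by omega) h)
      · exact Or.inl h
      · exact Or.inr ⟨by omega, by omega, (hv t h h1.2).1 h3⟩
    · rintro (rfl | ⟨h1, h2, h3⟩)
      · exact ⟨by omega, by omega, hr⟩
      · exact ⟨by omega, by omega, (hv t (by omega) h1.2).2 h3⟩
  have hgt : ∀ t ∈ blockRest r (Finset.Ico v j) v, v < t := by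
    intro t ht
    simp only [mem_blockRest, Finset.mem_Ico] at ht
    omega
  have hGv : gapBefore r (Finset.Ico i j) i v = Finset.Ico (i + 1) v := by
    ext t
    simp only [mem_gapBefore, hB, Finset.mem_Ico, Finset.mem_insert, forall_eq_or_imp]
    constructor
    · rintro ⟨h1, h2, h3, -⟩
      omega
    · rintro ⟨h1, h2⟩
      exact ⟨by omega, by omega, h2, Or.inr le_rfl, fun s hs => Or.inr (hgt s hs).le⟩
  have hG : ∀ s ∈ blockRest r (Finset.Ico v j) v,
      gapBefore r (Finset.Ico i j) i s = gapBefore r (Finset.Ico v j) v s := by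
    intro s hs
    have := hgt s hs
    ext t
    simp only [mem_gapBefore, hB, Finset.mem_Ico, Finset.mem_insert, forall_eq_or_imp]
    constructor
    · rintro ⟨h1, h2, h3, h4, h5⟩
      exact ⟨by omega, by omega, h3, h5⟩
    · rintro ⟨h1, h2, h3, h5⟩
      exact ⟨by omega, by omega, h3, Or.inl h2, h5⟩
  have hT : tailAfter r (Finset.Ico i j) i = tailAfter r (Finset.Ico v j) v := by
    ext t
    simp only [mem_tailAfter, hB, Finset.mem_Ico, Finset.mem_insert, forall_eq_or_imp]
    constructor
    · rintro ⟨h1, h2, h3, h4⟩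
      exact ⟨by omega, by omega, h4⟩
    · rintro ⟨h1, h2, h3⟩
      exact ⟨by omega, by omega, h2, h3⟩
  rw [chainEval, chainEval, hB, hT, Finset.sort_insert _ (fun s hs => (hgt s hs).le)
    (fun hs => lt_irrefl _ (hgt v hs)), List.map_cons, hGv]
  congr 2
  simp only [List.append_assoc, List.cons_append, List.nil_append]
  congr 3
  exact List.map_congr_left fun s hs => by rw [hG s (by simpa using hs)]

/-- Additivity in the inserted element allows the partitions of a gap to be summed before the rest
of the block is evaluated. -/
theorem chainEval_sum (hc : SlotAdd c) (a : ℕ → A) (r : ℕ → ℕ → Prop) (u : List A) {κ : Type*}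
    (s : Finset κ) (d : κ → D) (i j : ℕ) :
    chainEval ι c a r u (∑ k ∈ s, d k) i j = ∑ k ∈ s, chainEval ι c a r u (d k) i j := by
  simp only [chainEval, map_sum, Finset.sum_mul, hc.sum]

end Eval

/-! ### Noncrossing partitions of intervals -/

section NCInterval

/-- `π` is noncrossing, and points outside of `{i, …, j - 1}` are singletons. -/
def IsNCOn (i j : ℕ) (π : Setoid ℕ) : Prop :=
  (NonCrossing fun a b => π a b) ∧ ∀ a b, π a b → a ≠ b → i ≤ a ∧ a < j

theorem finite_setOf_isNCOn (i j : ℕ) : {π | IsNCOn i j π}.Finite := by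
  refine Set.Finite.of_finite_image (f := fun π (a b : Fin j) => π (a : ℕ) (b : ℕ))
    (Set.toFinite _) ?_
  intro π hπ π' hπ' h
  have key : ∀ {π π' : Setoid ℕ}, IsNCOn i j π →
      (fun (a b : Fin j) => π (a : ℕ) (b : ℕ)) = (fun (a b : Fin j) => π' (a : ℕ) (b : ℕ)) →
      ∀ a b, π a b → π' a b := by
    intro π π' hπ h a b hab
    by_cases hne : a = b
    · rw [hne]
    · have ha := hπ.2 a b hab hne
      have hb := hπ.2 b a (π.symm hab) (Ne.symm hne)
      exact (congrFun (congrFun h ⟨a, ha.2⟩) ⟨b, hb.2⟩).mp hab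
  ext a b
  exact ⟨key hπ h a b, key hπ' h.symm a b⟩

/-- The noncrossing partitions of `{i, …, j - 1}`, as equivalence relations on `ℕ`. -/
def NCOn (i j : ℕ) : Finset (Setoid ℕ) := (finite_setOf_isNCOn i j).toFinset

theorem mem_NCOn {i j : ℕ} {π : Setoid ℕ} : π ∈ NCOn i j ↔ IsNCOn i j π := by
  simp [NCOn]

theorem IsNCOn.both {i j : ℕ} {π : Setoid ℕ} (h : IsNCOn i j π) {a b : ℕ} (hab : π a b)
    (hne : a ≠ b) : (i ≤ a ∧ a < j) ∧ i ≤ b ∧ b < j :=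
  ⟨h.2 a b hab hne, h.2 b a (π.symm hab) hne.symm⟩

theorem IsNCOn.mono {i j i' j' : ℕ} {π : Setoid ℕ} (h : IsNCOn i j π) (hi : i' ≤ i) (hj : j ≤ j') :
    IsNCOn i' j' π :=
  ⟨h.1, fun a b hab hne => by have := h.2 a b hab hne; omega⟩

/-- The restriction of `π` to `{i, …, j - 1}`. -/
def restrictSetoid (i j : ℕ) (π : Setoid ℕ) : Setoid ℕ where
  r a b := a = b ∨ (i ≤ a ∧ a < j ∧ i ≤ b ∧ b < j ∧ π a b)
  iseqv := by
    refine ⟨fun a => Or.inl rfl, ?_, ?_⟩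
    · rintro a b (h | ⟨h1, h2, h3, h4, h5⟩)
      · exact Or.inl h.symm
      · exact Or.inr ⟨h3, h4, h1, h2, π.symm h5⟩
    · rintro a b d (rfl | ⟨h1, h2, h3, h4, h5⟩) (rfl | ⟨h6, h7, h8, h9, h10⟩)
      · exact Or.inl rfl
      · exact Or.inr ⟨h6, h7, h8, h9, h10⟩
      · exact Or.inr ⟨h1, h2, h3, h4, h5⟩
      · exact Or.inr ⟨h1, h2, h8, h9, π.trans h5 h10⟩

theorem restrictSetoid_iff {i j : ℕ} {π : Setoid ℕ} {a b : ℕ} :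
    restrictSetoid i j π a b ↔ a = b ∨ (i ≤ a ∧ a < j ∧ i ≤ b ∧ b < j ∧ π a b) := Iff.rfl

theorem IsNCOn.restrict {i j : ℕ} {π : Setoid ℕ} (h : IsNCOn i j π) (i' j' : ℕ) :
    IsNCOn i' j' (restrictSetoid i' j' π) := by
  refine ⟨fun a b d e hab hbd hde hac hbe => ?_, fun a b hab hne => ?_⟩
  · beta_reduce at hac hbe ⊢
    rw [restrictSetoid_iff] at *
    rcases hac with hac | hac
    · omega
    rcases hbe with hbe | hbe
    · omega
    exact Or.inr ⟨by omega, by omega, by omega, by omega,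
      h.1 a b d e hab hbd hde hac.2.2.2.2 hbe.2.2.2.2⟩
  · rcases hab with hab | hab
    · exact absurd hab hne
    · omega

/-- The relation that is `π₁` below `s` and `π₂` from `s` on. -/
def joinSetoid (s : ℕ) (π₁ π₂ : Setoid ℕ) : Setoid ℕ where
  r a b := (a < s ∧ b < s ∧ π₁ a b) ∨ (s ≤ a ∧ s ≤ b ∧ π₂ a b)
  iseqv := by
    refine ⟨fun a => ?_, ?_, ?_⟩
    · rcases lt_or_ge a s with h | h
      · exact Or.inl ⟨h, h, π₁.refl a⟩
      · exact Or.inr ⟨h, h, π₂.refl a⟩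
    · rintro a b (⟨h1, h2, h3⟩ | ⟨h1, h2, h3⟩)
      · exact Or.inl ⟨h2, h1, π₁.symm h3⟩
      · exact Or.inr ⟨h2, h1, π₂.symm h3⟩
    · rintro a b d (⟨h1, h2, h3⟩ | ⟨h1, h2, h3⟩) (⟨h4, h5, h6⟩ | ⟨h4, h5, h6⟩)
      · exact Or.inl ⟨h1, h5, π₁.trans h3 h6⟩
      · omega
      · omega
      · exact Or.inr ⟨h1, h5, π₂.trans h3 h6⟩

theorem joinSetoid_iff {s : ℕ} {π₁ π₂ : Setoid ℕ} {a b : ℕ} :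
    joinSetoid s π₁ π₂ a b ↔ (a < s ∧ b < s ∧ π₁ a b) ∨ (s ≤ a ∧ s ≤ b ∧ π₂ a b) := Iff.rfl

theorem isNCOn_join {i s j : ℕ} {π₁ π₂ : Setoid ℕ} (his : i ≤ s) (hsj : s ≤ j)
    (h₁ : IsNCOn i s π₁) (h₂ : IsNCOn s j π₂) : IsNCOn i j (joinSetoid s π₁ π₂) := by
  refine ⟨fun a b d e hab hbd hde hac hbe => ?_, fun a b hab hne => ?_⟩
  · beta_reduce at hac hbe ⊢
    rw [joinSetoid_iff] at *
    rcases hac with hac | hac <;> rcases hbe with hbe | hbe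
    · exact Or.inl ⟨hac.1, hbe.1, h₁.1 a b d e hab hbd hde hac.2.2 hbe.2.2⟩
    · omega
    · omega
    · exact Or.inr ⟨hac.1, hbe.1, h₂.1 a b d e hab hbd hde hac.2.2 hbe.2.2⟩
  · rcases hab with ⟨-, -, hab⟩ | ⟨-, -, hab⟩
    · have := h₁.2 a b hab hne
      omega
    · have := h₂.2 a b hab hne
      omega

/-- The relation obtained from `joinSetoid v π₁ π₂` by adding `i` to the block of `v`. -/
def glueSetoid (i v : ℕ) (π₁ π₂ : Setoid ℕ) : Setoid ℕ :=
  (joinSetoid v π₁ π₂).comap fun a => if a = i then v else a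

theorem glueSetoid_iff {i v : ℕ} {π₁ π₂ : Setoid ℕ} {a b : ℕ} :
    glueSetoid i v π₁ π₂ a b ↔
      joinSetoid v π₁ π₂ (if a = i then v else a) (if b = i then v else b) := Iff.rfl

theorem glueSetoid_of_ne {i v : ℕ} {π₁ π₂ : Setoid ℕ} {a b : ℕ} (ha : a ≠ i) (hb : b ≠ i) :
    glueSetoid i v π₁ π₂ a b ↔ joinSetoid v π₁ π₂ a b := by
  rw [glueSetoid_iff, if_neg ha, if_neg hb]

theorem glueSetoid_left {i v : ℕ} {π₁ π₂ : Setoid ℕ} {b : ℕ} (hb : b ≠ i) :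
    glueSetoid i v π₁ π₂ i b ↔ v ≤ b ∧ π₂ v b := by
  rw [glueSetoid_iff, if_pos rfl, if_neg hb, joinSetoid_iff]
  simp

theorem isNCOn_glue {i v j : ℕ} {π₁ π₂ : Setoid ℕ} (hiv : i < v) (hvj : v < j)
    (h₁ : IsNCOn (i + 1) v π₁) (h₂ : IsNCOn v j π₂) : IsNCOn i j (glueSetoid i v π₁ π₂) := by
  have hJ := isNCOn_join (by omega) hvj.le h₁ h₂
  refine ⟨fun a b d e hab hbd hde hac hbe => ?_, fun a b hab hne => ?_⟩
  · beta_reduce at hac hbe ⊢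
    rcases Nat.lt_or_ge a i with hai | hai
    · exfalso
      rw [glueSetoid_iff, if_neg hai.ne] at hac
      split_ifs at hac with h
      · have := hJ.2 a v hac (by omega)
        omega
      · have := hJ.2 a d hac (by omega)
        omega
    rw [glueSetoid_of_ne (a := b) (b := e) (by omega) (by omega)] at hbe
    rcases Nat.eq_or_lt_of_le hai with rfl | hai
    · rw [glueSetoid_left (by omega)] at hac ⊢
      rw [joinSetoid_iff] at hbe
      rcases hbe with hbe | hbe
      · omega
      · refine ⟨hbe.1, ?_⟩
        rcases Nat.eq_or_lt_of_le hbe.1 with rfl | hvb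
        · exact π₂.refl _
        · exact h₂.1 v b d e hvb hbd hde hac.2 hbe.2.2
    · rw [glueSetoid_of_ne (by omega) (by omega)] at hac ⊢
      exact hJ.1 a b d e hab hbd hde hac hbe
  · by_cases ha : a = i
    · omega
    · rw [glueSetoid_iff, if_neg ha] at hab
      split_ifs at hab with h
      · by_cases hav : a = v
        · omega
        · have := hJ.2 a v hab hav
          omega
      · have := hJ.2 a b hab hne
        omega

/-- Decomposition of the noncrossing partitions according to the second element of the block of the
first point. -/
theorem sum_NCOn_next {M : Type*} [AddCommMonoid M] (f : Setoid ℕ → M) {i j : ℕ} (hij : i < j) :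
    ∑ π ∈ NCOn i j, f π = ∑ π ∈ NCOn (i + 1) j, f π +
      ∑ v ∈ Finset.Ioo i j, ∑ π₁ ∈ NCOn (i + 1) v, ∑ π₂ ∈ NCOn v j, f (glueSetoid i v π₁ π₂) := by
  classical
  rw [← Finset.sum_filter_add_sum_filter_not (NCOn i j) (fun π => ∀ t, i < t → ¬ π i t)]
  congr 1
  · refine Finset.sum_congr ?_ fun _ _ => rfl
    ext π
    simp only [Finset.mem_filter, mem_NCOn]
    constructor
    · rintro ⟨h, hi⟩
      refine ⟨h.1, fun a b hab hne => ?_⟩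
      have hb := h.both hab hne
      have : a ≠ i := by
        rintro rfl
        exact hi b (by omega) hab
      omega
    · intro h
      refine ⟨h.mono (by omega) le_rfl, fun t hit hr => ?_⟩
      have := h.both hr hit.ne
      omega
  -- The default `0` is never met: partitions in which nothing after `i` is related to `i` have been
  -- split off.
  · let nxt : Setoid ℕ → ℕ := fun π => if h : ∃ t, i < t ∧ π i t then Nat.find h else 0
    have hnxt : ∀ {π v}, i < v → π i v → (∀ t, i < t → t < v → ¬ π i t) → nxt π = v := by
      intro π v hiv hr hmin
      have h : ∃ t, i < t ∧ π i t := ⟨v, hiv, hr⟩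
      simp only [nxt, dif_pos h]
      rw [Nat.find_eq_iff]
      exact ⟨⟨hiv, hr⟩, fun t ht h' => hmin t h'.1 ht h'.2⟩
    have hspec : ∀ {π}, (¬ ∀ t, i < t → ¬ π i t) →
        i < nxt π ∧ π i (nxt π) ∧ ∀ t, i < t → t < nxt π → ¬ π i t := by
      intro π hπ
      push Not at hπ
      simp only [nxt, dif_pos hπ]
      obtain ⟨h1, h2⟩ := Nat.find_spec hπ
      exact ⟨h1, h2, fun t ht ht' hr => Nat.find_min hπ ht' ⟨ht, hr⟩⟩
    rw [← Finset.sum_fiberwise_of_maps_to (g := nxt) (t := Finset.Ioo i j)]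
    · refine Finset.sum_congr rfl fun v hv => ?_
      rw [Finset.mem_Ioo] at hv
      rw [← Finset.sum_product']
      have hinv : ∀ π, IsNCOn i j π → (¬ ∀ t, i < t → ¬ π i t) → nxt π = v →
          glueSetoid i v (restrictSetoid (i + 1) v π) (restrictSetoid v j π) = π := by
        rintro π hπ hne rfl
        obtain ⟨h1, h2, h3⟩ := hspec hne
        -- Such a relation would put `a` into the block of `i`, by the noncrossing condition or, if
        -- `b = nxt π`, by transitivity; but `nxt π` is the first point of that block after `i`.
        have hfar : ∀ a b, π a b → i < a → a < nxt π → nxt π ≤ b → False := by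
          intro a b hab ha ha' hb
          refine h3 a ha ha' ?_
          rcases Nat.eq_or_lt_of_le hb with rfl | hb
          · exact π.trans h2 (π.symm hab)
          · exact hπ.1 i a (nxt π) b ha ha' hb h2 hab
        have hmain : ∀ a b, a ≠ i → b ≠ i → a ≠ b →
            (joinSetoid (nxt π) (restrictSetoid (i + 1) (nxt π) π)
              (restrictSetoid (nxt π) j π) a b ↔ π a b) := by
          intro a b ha hb hab
          rw [joinSetoid_iff, restrictSetoid_iff, restrictSetoid_iff]
          constructor
          · rintro (⟨-, -, h | h⟩ | ⟨-, -, h | h⟩)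
            · exact absurd h hab
            · exact h.2.2.2.2
            · exact absurd h hab
            · exact h.2.2.2.2
          · intro hr
            have hb := hπ.both hr hab
            rcases lt_or_ge a (nxt π) with hav | hav <;> rcases lt_or_ge b (nxt π) with hbv | hbv
            · exact Or.inl ⟨hav, hbv, Or.inr ⟨by omega, hav, by omega, hbv, hr⟩⟩
            · exact (hfar a b hr (by omega) hav hbv).elim
            · exact (hfar b a (π.symm hr) (by omega) hbv hav).elim
            · exact Or.inr ⟨hav, hbv, Or.inr ⟨hav, by omega, hbv, by omega, hr⟩⟩
        have hleft : ∀ b, b ≠ i → (glueSetoid i (nxt π) (restrictSetoid (i + 1) (nxt π) π)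
              (restrictSetoid (nxt π) j π) i b ↔ π i b) := by
          intro b hb
          rw [glueSetoid_left hb, restrictSetoid_iff]
          constructor
          · rintro ⟨-, rfl | h⟩
            · exact h2
            · exact π.trans h2 h.2.2.2.2
          · intro hr
            have := hπ.both hr hb.symm
            have hge : nxt π ≤ b := by
              by_contra hlt
              exact h3 b (by omega) (by omega) hr
            exact ⟨hge, Or.inr ⟨le_rfl, by omega, hge, by omega, π.trans (π.symm h2) hr⟩⟩
        ext a b
        by_cases hab : a = b
        · rw [hab]
          exact ⟨fun _ => π.refl b, fun _ => Setoid.refl' _ b⟩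
        by_cases ha : a = i
        · subst ha
          exact hleft b (Ne.symm hab)
        by_cases hb : b = i
        · subst hb
          exact ⟨fun h => π.symm ((hleft a hab).1 (Setoid.symm' _ h)),
            fun h => Setoid.symm' _ ((hleft a hab).2 (π.symm h))⟩
        · rw [glueSetoid_of_ne ha hb]
          exact hmain a b ha hb hab
      refine Finset.sum_bij' (fun π _ => (restrictSetoid (i + 1) v π, restrictSetoid v j π))
        (fun p _ => glueSetoid i v p.1 p.2) ?_ ?_ ?_ ?_ ?_
      · intro π hπ
        simp only [Finset.mem_filter, mem_NCOn] at hπ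
        simp only [Finset.mem_product, mem_NCOn]
        exact ⟨hπ.1.1.restrict _ _, hπ.1.1.restrict _ _⟩
      · intro p hp
        simp only [Finset.mem_product, mem_NCOn] at hp
        simp only [Finset.mem_filter, mem_NCOn]
        have hr : glueSetoid i v p.1 p.2 i v :=
          (glueSetoid_left (by omega)).2 ⟨le_rfl, p.2.refl v⟩
        refine ⟨⟨isNCOn_glue hv.1 hv.2 hp.1 hp.2, fun h => h v hv.1 hr⟩, hnxt hv.1 hr ?_⟩
        intro t ht htv hr'
        rw [glueSetoid_left (by omega)] at hr'
        omega
      · intro π hπ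
        simp only [Finset.mem_filter, mem_NCOn] at hπ
        exact hinv π hπ.1.1 hπ.1.2 hπ.2
      · intro p hp
        simp only [Finset.mem_product, mem_NCOn] at hp
        obtain ⟨h1, h2⟩ := hp
        ext a b
        · simp only [restrictSetoid_iff]
          constructor
          · rintro (rfl | ⟨h3, h4, h5, h6, h7⟩)
            · exact p.1.refl _
            · rw [glueSetoid_of_ne (by omega) (by omega), joinSetoid_iff] at h7
              rcases h7 with h7 | h7
              · exact h7.2.2
              · omega
          · intro hr
            by_cases hab : a = b
            · exact Or.inl hab
            · have hb := h1.both hr hab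
              refine Or.inr ⟨by omega, by omega, by omega, by omega, ?_⟩
              rw [glueSetoid_of_ne (by omega) (by omega), joinSetoid_iff]
              exact Or.inl ⟨by omega, by omega, hr⟩
        · simp only [restrictSetoid_iff]
          constructor
          · rintro (rfl | ⟨h3, h4, h5, h6, h7⟩)
            · exact p.2.refl _
            · rw [glueSetoid_of_ne (by omega) (by omega), joinSetoid_iff] at h7
              rcases h7 with h7 | h7
              · omega
              · exact h7.2.2
          · intro hr
            by_cases hab : a = b
            · exact Or.inl hab
            · have hb := h2.both hr hab
              refine Or.inr ⟨by omega, by omega, by omega, by omega, ?_⟩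
              rw [glueSetoid_of_ne (by omega) (by omega), joinSetoid_iff]
              exact Or.inr ⟨by omega, by omega, hr⟩
      · intro π hπ
        simp only [Finset.mem_filter, mem_NCOn] at hπ
        exact congrArg f (hinv π hπ.1.1 hπ.1.2 hπ.2).symm
    · intro π hπ
      simp only [Finset.mem_filter, mem_NCOn] at hπ
      obtain ⟨h1, h2, -⟩ := hspec hπ.2
      have := hπ.1.both h2 h1.ne
      simp only [Finset.mem_Ioo]
      omega

/-- Decomposition of the noncrossing partitions according to the last element of the block of the
first point. -/
theorem sum_NCOn_last {M : Type*} [AddCommMonoid M] (f : Setoid ℕ → M) {i j : ℕ} (hij : i < j) :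
    ∑ π ∈ NCOn i j, f π =
      ∑ t ∈ Finset.Ico i j, ∑ π₁ ∈ open Classical in {π ∈ NCOn i (t + 1) | π i t},
        ∑ π₂ ∈ NCOn (t + 1) j, f (joinSetoid (t + 1) π₁ π₂) := by
  classical
  have hbd : ∀ {π}, IsNCOn i j π → ∀ b, π i b → b < j := by
    intro π hπ b hb
    by_cases h : i = b
    · omega
    · exact (hπ.both hb h).2.2
  let lst : Setoid ℕ → ℕ := fun π => Nat.findGreatest (fun t => π i t) j
  have hlst : ∀ {π}, IsNCOn i j π → π i (lst π) ∧ ∀ b, π i b → b ≤ lst π := by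
    intro π hπ
    refine ⟨Nat.findGreatest_spec (P := fun t => π i t) hij.le (π.refl i), fun b hb => ?_⟩
    exact Nat.le_findGreatest (hbd hπ b hb).le hb
  have heq : ∀ {π}, IsNCOn i j π → ∀ t, π i t → (∀ b, π i b → b ≤ t) → lst π = t :=
    fun hπ t ht hmax => le_antisymm (hmax _ (hlst hπ).1) ((hlst hπ).2 t ht)
  rw [← Finset.sum_fiberwise_of_maps_to (g := lst) (t := Finset.Ico i j)]
  · refine Finset.sum_congr rfl fun t ht => ?_
    rw [Finset.mem_Ico] at ht
    rw [← Finset.sum_product']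
    have hinv : ∀ π, IsNCOn i j π → lst π = t →
        joinSetoid (t + 1) (restrictSetoid i (t + 1) π) (restrictSetoid (t + 1) j π) = π := by
      rintro π hπ rfl
      obtain ⟨h1, h2⟩ := hlst hπ
      -- A relation across the last point of the block of `i` would put `b` into that block, beyond
      -- its last point.
      have hfar : ∀ a b, π a b → i ≤ a → a < lst π + 1 → lst π + 1 ≤ b → False := by
        intro a b hab ha ha' hb
        have : π i b := by
          by_cases hia : i = a
          · rwa [hia]
          by_cases hal : a = lst π
          · exact π.trans h1 (hal ▸ hab)
          · exact π.trans (hπ.1 i a (lst π) b (by omega) (by omega) (by omega) h1 hab) hab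
        have := h2 b this
        omega
      ext a b
      rw [joinSetoid_iff, restrictSetoid_iff, restrictSetoid_iff]
      constructor
      · rintro (⟨-, -, rfl | h⟩ | ⟨-, -, rfl | h⟩)
        · exact π.refl _
        · exact h.2.2.2.2
        · exact π.refl _
        · exact h.2.2.2.2
      · intro hr
        by_cases hab : a = b
        · subst hab
          rcases lt_or_ge a (lst π + 1) with h | h
          · exact Or.inl ⟨h, h, Or.inl rfl⟩
          · exact Or.inr ⟨h, h, Or.inl rfl⟩
        have hb := hπ.both hr hab
        rcases lt_or_ge a (lst π + 1) with hav | hav <;>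
          rcases lt_or_ge b (lst π + 1) with hbv | hbv
        · exact Or.inl ⟨hav, hbv, Or.inr ⟨by omega, hav, by omega, hbv, hr⟩⟩
        · exact (hfar a b hr (by omega) hav hbv).elim
        · exact (hfar b a (π.symm hr) (by omega) hbv hav).elim
        · exact Or.inr ⟨hav, hbv, Or.inr ⟨hav, by omega, hbv, by omega, hr⟩⟩
    refine Finset.sum_bij' (fun π _ => (restrictSetoid i (t + 1) π, restrictSetoid (t + 1) j π))
      (fun p _ => joinSetoid (t + 1) p.1 p.2) ?_ ?_ ?_ ?_ ?_
    · intro π hπ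
      simp only [Finset.mem_filter, mem_NCOn] at hπ
      simp only [Finset.mem_product, Finset.mem_filter, mem_NCOn]
      refine ⟨⟨hπ.1.restrict _ _, Or.inr ⟨by omega, by omega, by omega, by omega, ?_⟩⟩,
        hπ.1.restrict _ _⟩
      exact hπ.2 ▸ (hlst hπ.1).1
    · intro p hp
      simp only [Finset.mem_product, Finset.mem_filter, mem_NCOn] at hp
      simp only [Finset.mem_filter, mem_NCOn]
      have hJ := isNCOn_join (by omega) (by omega) hp.1.1 hp.2
      refine ⟨hJ, heq hJ t (Or.inl ⟨by omega, by omega, hp.1.2⟩) ?_⟩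
      intro b hb
      rw [joinSetoid_iff] at hb
      omega
    · intro π hπ
      simp only [Finset.mem_filter, mem_NCOn] at hπ
      exact hinv π hπ.1 hπ.2
    · intro p hp
      simp only [Finset.mem_product, Finset.mem_filter, mem_NCOn] at hp
      obtain ⟨⟨h1, -⟩, h2⟩ := hp
      ext a b
      · simp only [restrictSetoid_iff, joinSetoid_iff]
        constructor
        · rintro (rfl | ⟨h3, h4, h5, h6, h7 | h7⟩)
          · exact p.1.refl _
          · exact h7.2.2
          · omega
        · intro hr
          by_cases hab : a = b
          · exact Or.inl hab
          · have hb := h1.both hr hab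
            exact Or.inr ⟨by omega, by omega, by omega, by omega, Or.inl ⟨by omega, by omega, hr⟩⟩
      · simp only [restrictSetoid_iff, joinSetoid_iff]
        constructor
        · rintro (rfl | ⟨h3, h4, h5, h6, h7 | h7⟩)
          · exact p.2.refl _
          · omega
          · exact h7.2.2
        · intro hr
          by_cases hab : a = b
          · exact Or.inl hab
          · have hb := h2.both hr hab
            exact Or.inr ⟨by omega, by omega, by omega, by omega, Or.inr ⟨by omega, by omega, hr⟩⟩
    · intro π hπ
      simp only [Finset.mem_filter, mem_NCOn] at hπ
      exact congrArg f (hinv π hπ.1 hπ.2).symm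
  · intro π hπ
    rw [mem_NCOn] at hπ
    obtain ⟨h1, h2⟩ := hlst hπ
    exact Finset.mem_Ico.2 ⟨h2 i (π.refl i), hbd hπ _ h1⟩

theorem NCOn_self (i : ℕ) : NCOn i i = {⊥} := by
  ext π
  rw [mem_NCOn, Finset.mem_singleton]
  constructor
  · intro h
    ext a b
    rw [Setoid.bot_def]
    refine ⟨fun hab => by_contra fun hne => ?_, fun hab => hab ▸ π.refl a⟩
    have := h.2 a b hab hne
    omega
  · rintro rfl
    exact ⟨fun a b d e _ _ _ hac _ => by rw [Setoid.bot_def] at hac; omega,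
      fun a b hab hne => absurd (by simpa [Setoid.bot_def] using hab) hne⟩

theorem NCOn_succ_self (i : ℕ) : NCOn i (i + 1) = {⊥} := by
  rw [← NCOn_self i]
  ext π
  rw [mem_NCOn, mem_NCOn]
  refine ⟨fun h => ⟨h.1, fun a b hab hne => ?_⟩, fun h => h.mono le_rfl (by omega)⟩
  have := h.both hab hne
  omega

end NCInterval

/-! ### The moment-cumulant formula -/

theorem splitSum_Ico {D : Type*} [Ring D] (f : List ℕ → ℕ → List ℕ → D) (i j : ℕ) :
    splitSum f (List.Ico i j) =
      ∑ v ∈ Finset.Ico i j, f (List.Ico i v) v (List.Ico (v + 1) j) := by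
  induction hn : j - i generalizing i f with
  | zero =>
    rw [List.Ico.eq_nil_of_le (by omega), Finset.Ico_eq_empty_of_le (by omega)]
    rfl
  | succ n ih =>
    have hij : i < j := by omega
    rw [List.Ico.eq_cons hij, splitSum_cons, Finset.sum_eq_sum_Ico_succ_bot hij,
      List.Ico.self_empty, ih _ _ (by omega)]
    congr 1
    refine Finset.sum_congr rfl fun v hv => ?_
    rw [Finset.mem_Ico] at hv
    rw [List.Ico.eq_cons (n := i) (m := v) (by omega)]

section SumNC

variable {A D : Type*} [Ring A] [Ring D] {ι : D →+* A} {E : A →+ D} {c : List A → D}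

/-- Both sides obey one recursion: `sum_NCOn_next` for the partitions, `headMom_eq` for the model.
The gap before the second point of the block sums to a moment and becomes the new inserted element.
-/
theorem sum_chainEval_NCOn (hl : ∀ d a, E (ι d * a) = d * E a) (hr : ∀ a d, E (a * ι d) = E a * d)
    (hE1 : E 1 = 1) (hc : SlotAdd c) (a : ℕ → A) (u : List A) (d : D) {i j : ℕ} (hij : i < j) :
    ∑ π ∈ NCOn i j, chainEval ι c a (fun s t => π s t) u d i j =
      headMom ι E c (u ++ [ι d * a i]) ((List.Ico (i + 1) j).map a) := by
  induction hn : j - i using Nat.strong_induction_on generalizing i j u d with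
  | _ n ih =>
    have hev : ∀ i' j', j' - i' < n → ∑ π ∈ NCOn i' j', relEval ι c a (fun s t => π s t)
        (Finset.Ico i' j') = mom ι E c ((List.Ico i' j').map a) := by
      intro i' j' hlt
      rcases lt_or_ge i' j' with h | h
      · rw [List.Ico.eq_cons h, List.map_cons, mom_cons,
          Finset.sum_congr rfl fun π _ => relEval_Ico a (fun s t => π s t) h,
          ih _ hlt [] 1 h rfl]
        simp
      · have : ∀ π ∈ NCOn i' j', π = ⊥ := by
          intro π hπ
          rw [mem_NCOn] at hπ
          rw [← Finset.mem_singleton, ← NCOn_self i', mem_NCOn]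
          exact hπ.mono le_rfl h
        have hs : NCOn i' j' = {⊥} := by
          refine Finset.eq_singleton_iff_unique_mem.2 ⟨?_, this⟩
          have hb : (⊥ : Setoid ℕ) ∈ NCOn i' i' := by simp [NCOn_self]
          rw [mem_NCOn] at hb ⊢
          refine ⟨hb.1, fun a b hab hne => absurd (by simpa [Setoid.bot_def] using hab) hne⟩
        rw [hs, Finset.sum_singleton, Finset.Ico_eq_empty_of_le h, relEval_empty,
          List.Ico.eq_nil_of_le h]
        simp [mom, vac, hE1]
    rw [sum_NCOn_next _ hij, headMom_eq hl hr hE1 hc, splitSum_map, splitSum_Ico]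
    congr 1
    · rw [← hev (i + 1) j (by omega), Finset.mul_sum]
      refine Finset.sum_congr rfl fun π hπ => chainEval_last a _ u d fun t hit _ hr => ?_
      rw [mem_NCOn] at hπ
      have := hπ.both hr hit.ne
      omega
    · have : Finset.Ioo i j = Finset.Ico (i + 1) j := by ext; simp
      rw [this]
      refine Finset.sum_congr rfl fun v hv => ?_
      rw [Finset.mem_Ico] at hv
      have e1 : ∀ π₁ ∈ NCOn (i + 1) v, ∀ π₂ ∈ NCOn v j,
          chainEval ι c a (fun s t => glueSetoid i v π₁ π₂ s t) u d i j =
          chainEval ι c a (fun s t => π₂ s t) (u ++ [ι d * a i])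
            (relEval ι c a (fun s t => π₁ s t) (Finset.Ico (i + 1) v)) v j := by
        intro π₁ _ π₂ _
        rw [chainEval_next a _ u d (v := v) (by omega) (by omega)]
        · rw [chainEval_congr (r := fun s t => π₂ s t) (by omega)]
          · congr 1
            refine relEval_congr (fun _ _ => rfl) fun s hs t ht => ?_
            rw [Finset.mem_Ico] at hs ht
            rw [glueSetoid_of_ne (by omega) (by omega), joinSetoid_iff]
            constructor
            · rintro (h | h)
              · exact h.2.2
              · omega
            · exact fun h => Or.inl ⟨by omega, by omega, h⟩
          · intro s hs t ht
            rw [Finset.mem_Ico] at hs ht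
            rw [glueSetoid_of_ne (by omega) (by omega), joinSetoid_iff]
            constructor
            · rintro (h | h)
              · omega
              · exact h.2.2
            · exact fun h => Or.inr ⟨by omega, by omega, h⟩
        · exact (glueSetoid_left (by omega)).2 ⟨le_rfl, π₂.refl v⟩
        · intro t hit htv h
          rw [glueSetoid_left (by omega)] at h
          omega
        · intro t hvt htj
          rw [glueSetoid_left (by omega), glueSetoid_of_ne (by omega) (by omega), joinSetoid_iff]
          constructor
          · exact fun h => Or.inr ⟨le_rfl, h.1, h.2⟩
          · rintro (h | h)
            · omega
            · exact ⟨h.2.1, h.2.2⟩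
      rw [Finset.sum_congr rfl fun π₁ h₁ => Finset.sum_congr rfl fun π₂ h₂ => e1 π₁ h₁ π₂ h₂,
        Finset.sum_comm]
      simp only [← chainEval_sum hc]
      rw [hev (i + 1) v (by omega), ih (j - v) (by omega) _ _ hv.2 rfl]

theorem sum_relEval_NCOn (hl : ∀ d a, E (ι d * a) = d * E a) (hr : ∀ a d, E (a * ι d) = E a * d)
    (hE1 : E 1 = 1) (hc : SlotAdd c) (a : ℕ → A) {i j : ℕ} (hij : i < j) :
    ∑ π ∈ NCOn i j, relEval ι c a (fun s t => π s t) (Finset.Ico i j) =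
      mom ι E c ((List.Ico i j).map a) := by
  rw [List.Ico.eq_cons hij, List.map_cons, mom_cons,
    Finset.sum_congr rfl fun π _ => relEval_Ico a (fun s t => π s t) hij,
    sum_chainEval_NCOn hl hr hE1 hc a [] 1 hij]
  simp

/-- The extension of an equivalence relation by singletons. -/
def extendSetoid {n : ℕ} (π : Setoid (Fin n)) : Setoid ℕ where
  r a b := a = b ∨ ∃ (ha : a < n) (hb : b < n), π ⟨a, ha⟩ ⟨b, hb⟩
  iseqv := by
    refine ⟨fun a => Or.inl rfl, ?_, ?_⟩
    · rintro a b (h | ⟨ha, hb, h⟩)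
      · exact Or.inl h.symm
      · exact Or.inr ⟨hb, ha, π.symm h⟩
    · rintro a b d (rfl | ⟨ha, hb, h⟩) (rfl | ⟨ha', hb', h'⟩)
      · exact Or.inl rfl
      · exact Or.inr ⟨ha', hb', h'⟩
      · exact Or.inr ⟨ha, hb, h⟩
      · exact Or.inr ⟨ha, hb', π.trans h h'⟩

theorem extendSetoid_iff {n : ℕ} {π : Setoid (Fin n)} {a b : ℕ} :
    extendSetoid π a b ↔ a = b ∨ ∃ (ha : a < n) (hb : b < n), π ⟨a, ha⟩ ⟨b, hb⟩ := Iff.rfl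

theorem sum_NC_eq_sum_NCOn {M : Type*} [AddCommMonoid M] {n : ℕ} (f : Setoid (Fin n) → M) :
    ∑ π ∈ NC n, f π = ∑ π ∈ NCOn 0 n, f (π.comap Fin.val) := by
  have hinv : ∀ π : Setoid (Fin n), (extendSetoid π).comap Fin.val = π := by
    intro π
    ext a b
    rw [Setoid.comap_rel, extendSetoid_iff]
    constructor
    · rintro (h | ⟨_, _, h⟩)
      · rw [Fin.ext h]
      · exact h
    · exact fun h => Or.inr ⟨a.2, b.2, h⟩
  refine Finset.sum_bij' (fun π _ => extendSetoid π) (fun π _ => π.comap Fin.val) ?_ ?_ ?_ ?_ ?_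
  · intro π hπ
    rw [mem_NC] at hπ
    rw [mem_NCOn]
    refine ⟨fun a b d e hab hbd hde hac hbe => ?_, fun a b hab hne => ?_⟩
    · beta_reduce at hac hbe ⊢
      rw [extendSetoid_iff] at *
      obtain ⟨h1, h2, h3⟩ := hac.resolve_left (by omega)
      obtain ⟨h4, h5, h6⟩ := hbe.resolve_left (by omega)
      exact Or.inr ⟨h1, h4, hπ _ _ ⟨d, h2⟩ ⟨e, h5⟩ hab hbd hde h3 h6⟩
    · obtain ⟨h1, -⟩ := (extendSetoid_iff.1 hab).resolve_left hne
      omega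
  · intro π hπ
    rw [mem_NCOn] at hπ
    rw [mem_NC]
    exact fun a b d e hab hbd hde hac hbe => hπ.1 a b d e hab hbd hde hac hbe
  · exact fun π _ => hinv π
  · intro π hπ
    rw [mem_NCOn] at hπ
    ext a b
    rw [extendSetoid_iff]
    constructor
    · rintro (h | ⟨_, _, h⟩)
      · rw [h]
      · exact h
    · intro h
      by_cases hab : a = b
      · exact Or.inl hab
      · have := hπ.both h hab
        exact Or.inr ⟨this.1.2, this.2.2, h⟩
  · exact fun π _ => by rw [hinv]

theorem sum_relEval_NC (hl : ∀ d a, E (ι d * a) = d * E a) (hr : ∀ a d, E (a * ι d) = E a * d)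
    (hE1 : E 1 = 1) (hc : SlotAdd c) {n : ℕ} (a : Fin (n + 1) → A) :
    ∑ π ∈ NC (n + 1), relEval ι c a (fun s t => π s t) Finset.univ = mom ι E c (List.ofFn a) := by
  set a' : ℕ → A := fun k => if h : k < n + 1 then a ⟨k, h⟩ else 0 with ha'
  have h1 : (List.Ico 0 (n + 1)).map a' = List.ofFn a := by
    rw [List.Ico.zero_bot]
    refine List.ext_getElem (by simp) fun k hk _ => ?_
    have hk' : k < n + 1 := by simpa using hk
    rw [List.getElem_map, List.getElem_range, List.getElem_ofFn]
    simp only [ha', dif_pos hk']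
  rw [← h1, ← sum_relEval_NCOn hl hr hE1 hc a' (Nat.succ_pos n), sum_NC_eq_sum_NCOn]
  refine Finset.sum_congr rfl fun π _ => ?_
  have h2 : Finset.Ico 0 (n + 1) = (Finset.univ : Finset (Fin (n + 1))).map
      (Fin.valOrderEmb (n + 1)).toEmbedding := by
    ext k
    simp only [Finset.mem_Ico, Finset.mem_map, Finset.mem_univ, true_and]
    exact ⟨fun h => ⟨⟨k, h.2⟩, rfl⟩, fun ⟨i, hi⟩ => by rw [← hi]; exact ⟨Nat.zero_le _, i.2⟩⟩
  rw [h2, relEval_map (a := a) (r := fun s t => π.comap Fin.val s t)]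
  · intro i _
    exact dif_pos i.2
  · exact fun i _ j _ => Iff.rfl

end SumNC

theorem exists_ofFn_eq {A : Type*} {l : List A} {n : ℕ} (hn : l.length = n) :
    ∃ f : Fin n → A, List.ofFn f = l := by
  subst hn
  exact ⟨l.get, List.ofFn_get l⟩

/-! ### The cumulants of a conditional expectation as a function on lists -/

namespace CondExp

variable {𝒜 : Type*} [Ring 𝒜] [Algebra ℂ 𝒜] {A D : Subalgebra ℂ 𝒜} (E : CondExp A D)

/-- The inclusion of `D` into `A`. -/
def incl : D →+* A := (Subalgebra.inclusion E.le : D →+* A)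

/-- The conditional expectation as an additive map. -/
def toAddHom : A →+ D := E.toLinearMap.toAddMonoidHom

theorem toAddHom_mul_left (d : D) (a : A) : E.toAddHom (E.incl d * a) = d * E.toAddHom a := by
  have := E.map_bimodule d 1 a
  rwa [map_one, mul_one, mul_one] at this

theorem toAddHom_mul_right (a : A) (d : D) : E.toAddHom (a * E.incl d) = E.toAddHom a * d := by
  have := E.map_bimodule 1 d a
  rwa [map_one, one_mul, one_mul] at this

theorem toAddHom_one : E.toAddHom 1 = 1 := by
  have := E.map_base 1
  rwa [map_one] at this

/-- The cumulants as a function on lists, with value `0` at the empty list. -/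
def cumulantList (l : List A) : D :=
  open Classical in
  if l = [] then 0 else E.cumulant (l.length - 1) fun i => l.getD i 0

theorem cumulantList_ofFn {n : ℕ} (a : Fin (n + 1) → A) :
    E.cumulantList (List.ofFn a) = E.cumulant n a := by
  have gen : ∀ (m : ℕ) (hm : m = n) (b : Fin (m + 1) → A),
      (∀ i, b i = a (i.cast (by rw [hm]))) → E.cumulant m b = E.cumulant n a := by
    rintro m rfl b hb
    exact congrArg _ (funext hb)
  rw [cumulantList, if_neg (by simp)]
  refine gen _ (by simp) _ fun i => ?_
  have hi : (i : ℕ) < n + 1 := by have := i.2; simp at this; omega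
  rw [List.getD_eq_getElem _ _ (hi.trans_eq List.length_ofFn.symm), List.getElem_ofFn]
  rfl

theorem cumulant_blockArgs {κ : Type*} [LinearOrder κ] (a : κ → A) (p : κ) (V : Finset κ)
    (w : κ → D) :
    E.cumulant V.card (E.blockArgs a p V w) = blockVal E.incl E.cumulantList a p V w := by
  rw [← cumulantList_ofFn, blockVal]
  congr 1
  rw [List.ofFn_succ]
  congr 1
  rw [← Finset.listMap_orderEmbOfFin_finRange V rfl, List.ofFn_eq_map, List.map_map]
  rfl

/-- The cumulants up to order `n`. -/
def cumulantUpTo (n : ℕ) (l : List A) : D := if l.length ≤ n then E.cumulantList l else 0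

/-- The recursive definition subtracts the terms of all partitions but the one with a single block.
With cumulants truncated at order `n` that partition contributes zero, so the subtracted sum is a
full moment of the Fock model. -/
theorem cumulantList_eq_sub {n : ℕ} (hn : SlotAdd (E.cumulantUpTo n)) (a : Fin (n + 1) → A) :
    E.cumulantList (List.ofFn a) = E.toAddHom (List.ofFn a).prod -
      mom E.incl E.toAddHom (E.cumulantUpTo n) (List.ofFn a) := by
  classical
  rw [cumulantList_ofFn, cumulant, ← sum_relEval_NC E.toAddHom_mul_left E.toAddHom_mul_right
    E.toAddHom_one hn]
  have hg : (fun (p : Fin (n + 1)) V w => if V.card < n then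
      E.cumulant V.card (E.blockArgs a p V w) else 0) =
      blockVal E.incl (E.cumulantUpTo n) a := by
    funext p V w
    rw [cumulant_blockArgs, blockVal, blockVal, cumulantUpTo]
    simp only [List.length_cons, List.length_map, Finset.length_sort, Nat.succ_le_iff]
  congr 1
  simp only [hg, relEval]
  symm
  have htop : (⊤ : Setoid (Fin (n + 1))) ∈ NC (n + 1) := by
    rw [mem_NC]; intro a b c d _ _ _ _ _; trivial
  rw [← Finset.add_sum_erase _ _ htop, add_eq_right, nestedEval_top]
  · rw [blockVal, cumulantUpTo, if_neg (by simp)]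
  · exact fun p V w w' h => blockVal_congr rfl fun v hv => ⟨rfl, h v hv⟩

/-- Induction on the order: a cumulant of order `n + 1` is a moment of `E` minus a moment of the
model built from lower cumulants, and both are additive in each entry. -/
theorem slotAdd_cumulantUpTo (n : ℕ) : SlotAdd (E.cumulantUpTo n) := by
  induction n with
  | zero =>
    intro u a b w
    simp [cumulantUpTo]
  | succ n ih =>
    intro u a b w
    have h := ih u a b w
    simp only [cumulantUpTo, List.length_append, List.length_cons] at h ⊢
    by_cases h1 : u.length + (w.length + 1) ≤ n
    · simpa [h1, Nat.le_succ_of_le h1] using h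
    by_cases h2 : u.length + (w.length + 1) ≤ n + 1
    · simp only [if_pos h2]
      have key : ∀ x, E.cumulantList (u ++ x :: w) = E.toAddHom (u ++ x :: w).prod -
          mom E.incl E.toAddHom (E.cumulantUpTo n) (u ++ x :: w) := by
        intro x
        have hlen : (u ++ x :: w).length = n + 1 := by simp; omega
        obtain ⟨f, hf⟩ := exists_ofFn_eq hlen
        rw [← hf]
        exact E.cumulantList_eq_sub ih f
      rw [key, key, key, slotAdd_mom ih u a b w]
      simp only [List.prod_append, List.prod_cons, mul_add, add_mul, map_add]
      abel
    · simp [h2]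

theorem slotAdd_cumulantList : SlotAdd E.cumulantList := by
  intro u a b w
  have := E.slotAdd_cumulantUpTo (u.length + (w.length + 1)) u a b w
  simpa [cumulantUpTo] using this

theorem cumulantList_eq {l : List A} {n : ℕ} (hn : l.length = n + 1) :
    E.cumulantList l = E.toAddHom l.prod - mom E.incl E.toAddHom (E.cumulantUpTo n) l := by
  obtain ⟨f, rfl⟩ := exists_ofFn_eq hn
  exact E.cumulantList_eq_sub (E.slotAdd_cumulantUpTo n) f

theorem leftLin_cumulantUpTo (n : ℕ) : LeftLin E.incl (E.cumulantUpTo n) := by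
  induction n with
  | zero =>
    intro d a w
    simp [cumulantUpTo]
  | succ n ih =>
    intro d a w
    have h := ih d a w
    simp only [cumulantUpTo, List.length_cons] at h ⊢
    by_cases h1 : w.length + 1 ≤ n
    · simpa [h1, Nat.le_succ_of_le h1] using h
    by_cases h2 : w.length + 1 ≤ n + 1
    · have hw : w.length = n := by omega
      simp only [if_pos h2]
      rw [E.cumulantList_eq (n := n) (by simp [hw]), E.cumulantList_eq (n := n) (by simp [hw]),
        leftLin_mom E.toAddHom_mul_left ih, List.prod_cons, List.prod_cons, mul_assoc,
        E.toAddHom_mul_left, mul_sub]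
    · simp [h2]

theorem leftLin_cumulantList : LeftLin E.incl E.cumulantList := by
  intro d a w
  have := E.leftLin_cumulantUpTo (w.length + 1) d a w
  simpa [cumulantUpTo] using this

/-- The moment-cumulant formula for lists. -/
theorem mom_cumulantList (l : List A) :
    mom E.incl E.toAddHom E.cumulantList l = E.toAddHom l.prod := by
  cases l with
  | nil => simp [mom, vac]
  | cons b w =>
    obtain ⟨f, hf⟩ := exists_ofFn_eq (l := b :: w) rfl
    rw [← hf, ← sum_relEval_NC E.toAddHom_mul_left E.toAddHom_mul_right E.toAddHom_one
      E.slotAdd_cumulantList]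
    have := E.moment_cumulant w.length f
    rw [toAddHom]
    refine Eq.trans ?_ this.symm
    refine Finset.sum_congr rfl fun π _ => ?_
    rw [cumulantPart, relEval]
    congr 1
    funext p V w
    rw [cumulant_blockArgs]

/-- The moments of the model are those of `E`, which depend only on the product of the word; merging
two adjacent letters does not change it. -/
theorem mergeDefect_cumulantList (u : List A) (a b : A) (w : List A) :
    mergeDefect E.incl E.cumulantList u a b w = 0 := by
  refine mergeDefect_eq_zero E.toAddHom_mul_left E.toAddHom_one E.slotAdd_cumulantList
    E.leftLin_cumulantList (fun u a b w => ?_) u a b w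
  rw [mom_cumulantList, mom_cumulantList]
  simp [mul_assoc]

end CondExp

/-! ### Sums over the partitions `π ∪ Kr(π)` -/

section Kreweras

theorem kreweras_iff {π : Setoid ℕ} {a b : ℕ} (hab : a ≤ b) :
    kreweras π a b ↔ ∀ s t, a < s → s ≤ b → π s t → a < t ∧ t ≤ b := by
  have h0 : kreweras π a b ↔ ∀ s t, π s t →
    ((min a b < s ∧ s ≤ max a b) ↔ (min a b < t ∧ t ≤ max a b)) := Iff.rfl
  rw [h0, min_eq_left hab, max_eq_right hab]
  constructor
  · exact fun h s t h1 h2 h3 => (h s t h3).1 ⟨h1, h2⟩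
  · exact fun h s t h3 => ⟨fun h' => h s t h'.1 h'.2 h3, fun h' => h t s h'.1 h'.2 (π.symm h3)⟩

/-- The relation `π ∪ Kr(π)` on `ℕ`, where `2 * i` is the point `i` of `π` and `2 * i + 1` is the
point `i` of `Kr(π)`. -/
def altRel (π : Setoid ℕ) (u v : ℕ) : Prop :=
  (u % 2 = 0 ∧ v % 2 = 0 ∧ π (u / 2) (v / 2)) ∨
    (u % 2 = 1 ∧ v % 2 = 1 ∧ kreweras π (u / 2) (v / 2))

theorem altRel_symm {π : Setoid ℕ} {u v : ℕ} (h : altRel π u v) : altRel π v u := by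
  rcases h with ⟨h1, h2, h3⟩ | ⟨h1, h2, h3⟩
  · exact Or.inl ⟨h2, h1, π.symm h3⟩
  · exact Or.inr ⟨h2, h1, (kreweras π).symm h3⟩

theorem altRel_trans {π : Setoid ℕ} {u v w : ℕ} (h : altRel π u v) (h' : altRel π v w) :
    altRel π u w := by
  rcases h with ⟨h1, h2, h3⟩ | ⟨h1, h2, h3⟩ <;> rcases h' with ⟨h4, h5, h6⟩ | ⟨h4, h5, h6⟩
  · exact Or.inl ⟨h1, h5, π.trans h3 h6⟩
  · omega
  · omega
  · exact Or.inr ⟨h1, h5, (kreweras π).trans h3 h6⟩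

theorem altRel_left_iff {π : Setoid ℕ} {u v : ℕ} (h : altRel π u v) (w : ℕ) :
    altRel π u w ↔ altRel π v w :=
  ⟨altRel_trans (altRel_symm h), altRel_trans h⟩

theorem altRel_congr {π π' : Setoid ℕ} {p q : ℕ}
    (he : ∀ a b, p ≤ 2 * a → p ≤ 2 * b → 2 * a < q → 2 * b < q → (π a b ↔ π' a b))
    (ho : ∀ a b, a ≤ b → p ≤ 2 * a + 1 → 2 * b + 1 < q → (kreweras π a b ↔ kreweras π' a b)) :
    ∀ s ∈ Finset.Ico p q, ∀ t ∈ Finset.Ico p q, (altRel π s t ↔ altRel π' s t) := by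
  intro s hs t ht
  rw [Finset.mem_Ico] at hs ht
  have h2 : s % 2 = 1 → t % 2 = 1 → (kreweras π (s / 2) (t / 2) ↔ kreweras π' (s / 2) (t / 2)) := by
    intro h1 h2
    rcases le_total (s / 2) (t / 2) with h | h
    · exact ho _ _ h (by omega) (by omega)
    · rw [(kreweras π).comm', (kreweras π').comm']
      exact ho _ _ h (by omega) (by omega)
  have h1 : s % 2 = 0 → t % 2 = 0 → (π (s / 2) (t / 2) ↔ π' (s / 2) (t / 2)) := fun h1 h2 =>
    he _ _ (by omega) (by omega) (by omega) (by omega)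
  unfold altRel
  constructor
  · rintro (⟨h3, h4, h5⟩ | ⟨h3, h4, h5⟩)
    · exact Or.inl ⟨h3, h4, (h1 h3 h4).1 h5⟩
    · exact Or.inr ⟨h3, h4, (h2 h3 h4).1 h5⟩
  · rintro (⟨h3, h4, h5⟩ | ⟨h3, h4, h5⟩)
    · exact Or.inl ⟨h3, h4, (h1 h3 h4).2 h5⟩
    · exact Or.inr ⟨h3, h4, (h2 h3 h4).2 h5⟩

theorem kreweras_congr {π π' : Setoid ℕ} {a b : ℕ} (hab : a ≤ b)
    (h : ∀ s t, a < s → s ≤ b → (π s t ↔ π' s t)) : kreweras π a b ↔ kreweras π' a b := by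
  rw [kreweras_iff hab, kreweras_iff hab]
  exact ⟨fun hk s t h1 h2 h3 => hk s t h1 h2 ((h s t h1 h2).2 h3),
    fun hk s t h1 h2 h3 => hk s t h1 h2 ((h s t h1 h2).1 h3)⟩

theorem joinSetoid_left {i s a b : ℕ} {π₁ π₂ : Setoid ℕ} (h₁ : IsNCOn i s π₁) (ha : a < s) :
    joinSetoid s π₁ π₂ a b ↔ π₁ a b := by
  rw [joinSetoid_iff]
  constructor
  · rintro (h | h)
    · exact h.2.2
    · omega
  · intro h
    by_cases hab : a = b
    · exact Or.inl ⟨ha, hab ▸ ha, h⟩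
    · exact Or.inl ⟨ha, (h₁.both h hab).2.2, h⟩

theorem joinSetoid_right {s j a b : ℕ} {π₁ π₂ : Setoid ℕ} (h₂ : IsNCOn s j π₂) (ha : s ≤ a) :
    joinSetoid s π₁ π₂ a b ↔ π₂ a b := by
  rw [joinSetoid_iff]
  constructor
  · rintro (h | h)
    · omega
    · exact h.2.2
  · intro h
    by_cases hab : a = b
    · exact Or.inr ⟨ha, hab ▸ ha, h⟩
    · exact Or.inr ⟨ha, (h₂.both h hab).2.1, h⟩

theorem glueSetoid_inner {i v a b : ℕ} {π₁ π₂ : Setoid ℕ} (hiv : i < v)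
    (h₁ : IsNCOn (i + 1) v π₁) (hia : i < a) (hav : a < v) :
    glueSetoid i v π₁ π₂ a b ↔ π₁ a b := by
  by_cases hb : b = i
  · subst hb
    rw [(glueSetoid b v π₁ π₂).comm', glueSetoid_left (by omega)]
    refine ⟨fun h => by omega, fun h => ?_⟩
    have := h₁.both h (by omega)
    omega
  · rw [glueSetoid_of_ne (by omega) hb, joinSetoid_left h₁ hav]

theorem glueSetoid_outer {i v j a b : ℕ} {π₁ π₂ : Setoid ℕ} (hiv : i < v)
    (h₂ : IsNCOn v j π₂) (hva : v ≤ a) (hb : b ≠ i) :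
    glueSetoid i v π₁ π₂ a b ↔ π₂ a b := by
  rw [glueSetoid_of_ne (by omega) hb, joinSetoid_right h₂ hva]

theorem altRel_glue_inner {i v : ℕ} {π₁ π₂ : Setoid ℕ} (hiv : i < v)
    (h₁ : IsNCOn (i + 1) v π₁) :
    ∀ s ∈ Finset.Ico (2 * i + 1) (2 * v), ∀ t ∈ Finset.Ico (2 * i + 1) (2 * v),
      (altRel (glueSetoid i v π₁ π₂) s t ↔ altRel π₁ s t) :=
  altRel_congr (fun a b _ _ _ _ => glueSetoid_inner hiv h₁ (by omega) (by omega))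
    fun a b hab _ _ => kreweras_congr hab fun s t _ _ =>
      glueSetoid_inner hiv h₁ (by omega) (by omega)

/-- For Kreweras points from `v` on, attaching `i` to the block of `v` adds no condition: a point of
that block in `{a + 1, …, b}` already has the partner `v` outside. -/
theorem altRel_glue_outer {i v j : ℕ} {π₁ π₂ : Setoid ℕ} (hiv : i < v)
    (h₂ : IsNCOn v j π₂) (q : ℕ) :
    ∀ s ∈ Finset.Ico (2 * v) q, ∀ t ∈ Finset.Ico (2 * v) q,
      (altRel (glueSetoid i v π₁ π₂) s t ↔ altRel π₂ s t) := by
  refine altRel_congr (fun a b _ _ _ _ => glueSetoid_outer hiv h₂ (by omega) (by omega))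
    fun a b hab ha _ => ?_
  rw [kreweras_iff hab, kreweras_iff hab]
  constructor
  · intro h s t h1 h2 h3
    have ht : t ≠ i := by
      by_cases hst : s = t
      · omega
      · have := h₂.both h3 hst
        omega
    exact h s t h1 h2 ((glueSetoid_outer hiv h₂ (by omega) ht).2 h3)
  · intro h s t h1 h2 h3
    by_cases ht : t = i
    · subst ht
      rw [(glueSetoid t v π₁ π₂).comm', glueSetoid_left (by omega)] at h3
      have := h s v h1 h2 (π₂.symm h3.2)
      omega
    · exact h s t h1 h2 ((glueSetoid_outer hiv h₂ (by omega) ht).1 h3)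

theorem altRel_join_left {i t : ℕ} {π₁ π₂ : Setoid ℕ} (h₁ : IsNCOn i (t + 1) π₁) (p : ℕ) :
    ∀ s ∈ Finset.Ico p (2 * t + 1), ∀ r ∈ Finset.Ico p (2 * t + 1),
      (altRel (joinSetoid (t + 1) π₁ π₂) s r ↔ altRel π₁ s r) :=
  altRel_congr (fun a b _ _ _ _ => joinSetoid_left h₁ (by omega))
    fun a b hab _ _ => kreweras_congr hab fun s r _ _ => joinSetoid_left h₁ (by omega)

theorem altRel_join_right {t j : ℕ} {π₁ π₂ : Setoid ℕ} (h₂ : IsNCOn (t + 1) j π₂) (q : ℕ) :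
    ∀ s ∈ Finset.Ico (2 * t + 1) q, ∀ r ∈ Finset.Ico (2 * t + 1) q,
      (altRel (joinSetoid (t + 1) π₁ π₂) s r ↔ altRel π₂ s r) :=
  altRel_congr (fun a b _ _ _ _ => joinSetoid_right h₂ (by omega))
    fun a b hab _ _ => kreweras_congr hab fun s r _ _ => joinSetoid_right h₂ (by omega)

theorem not_altRel_of_isNCOn {i j : ℕ} {π : Setoid ℕ} (h : IsNCOn (i + 1) j π) {t : ℕ}
    (ht : 2 * i < t) : ¬ altRel π (2 * i) t := by
  rintro (⟨h1, h2, h3⟩ | ⟨h1, h2, h3⟩)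
  · have := h.both h3 (by omega)
    omega
  · omega

theorem altRel_even {π : Setoid ℕ} {a b : ℕ} : altRel π (2 * a) (2 * b) ↔ π a b := by
  have ha : 2 * a / 2 = a := by omega
  have hb : 2 * b / 2 = b := by omega
  rw [altRel, ha, hb]
  constructor
  · rintro (h | h)
    · exact h.2.2
    · omega
  · exact fun h => Or.inl ⟨by omega, by omega, h⟩

theorem altRel_odd {π : Setoid ℕ} {a b : ℕ} :
    altRel π (2 * a + 1) (2 * b + 1) ↔ kreweras π a b := by
  have ha : (2 * a + 1) / 2 = a := by omega
  have hb : (2 * b + 1) / 2 = b := by omega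
  rw [altRel, ha, hb]
  constructor
  · rintro (h | h)
    · omega
    · exact h.2.2
  · exact fun h => Or.inr ⟨by omega, by omega, h⟩

/-! ### Matching the expansion of products with the blocks of `π ∪ Kr(π)` -/

section Chains

variable {A D : Type*} [Ring A] [Ring D] {ι : D →+* A} {c : List A → D}

/-- The block of `2 * i` continues with `2 * v`. -/
theorem chainEval_glue (a : ℕ → A) (u : List A) (d : D) {i v j q : ℕ} {π₁ π₂ : Setoid ℕ}
    (hiv : i < v) (hvq : 2 * v < q) (h₁ : IsNCOn (i + 1) v π₁) (h₂ : IsNCOn v j π₂) :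
    chainEval ι c a (altRel (glueSetoid i v π₁ π₂)) u d (2 * i) q =
      chainEval ι c a (altRel π₂) (u ++ [ι d * a (2 * i)])
        (relEval ι c a (altRel π₁) (Finset.Ico (2 * i + 1) (2 * v))) (2 * v) q := by
  have hr : altRel (glueSetoid i v π₁ π₂) (2 * i) (2 * v) :=
    altRel_even.2 ((glueSetoid_left (by omega)).2 ⟨le_rfl, π₂.refl v⟩)
  rw [chainEval_next a _ u d (v := 2 * v) (by omega) hvq hr,
    chainEval_congr hvq (altRel_glue_outer hiv h₂ q),
    relEval_congr (fun _ _ => rfl) (altRel_glue_inner hiv h₁)]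
  · rintro t h1 h2 (⟨h3, h4, h5⟩ | ⟨h3, h4, h5⟩)
    · have e : 2 * i / 2 = i := by omega
      rw [e, glueSetoid_left (by omega)] at h5
      omega
    · omega
  · exact fun t _ _ => altRel_left_iff hr t

/-- The block of `2 * i + 1` continues with `2 * t + 1`. -/
theorem chainEval_join (a : ℕ → A) (u : List A) (d : D) {i t j : ℕ} {π₁ π₂ : Setoid ℕ}
    (hit : i < t) (htj : t < j) (h₁ : IsNCOn (i + 1) (t + 1) π₁) (h₁' : π₁ (i + 1) t)
    (h₂ : IsNCOn (t + 1) j π₂) :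
    chainEval ι c a (altRel (joinSetoid (t + 1) π₁ π₂)) u d (2 * i + 1) (2 * j) =
      chainEval ι c a (altRel π₂) (u ++ [ι d * a (2 * i + 1)])
        (relEval ι c a (altRel π₁) (Finset.Ico (2 * (i + 1)) (2 * t + 1))) (2 * t + 1) (2 * j) := by
  -- The interval `{i + 1, …, t}` carries `π₁` and is a union of blocks of the joined partition.
  have hr : altRel (joinSetoid (t + 1) π₁ π₂) (2 * i + 1) (2 * t + 1) := by
    rw [altRel_odd, kreweras_iff hit.le]
    intro s r h1 h2 h3
    rw [joinSetoid_left h₁ (by omega)] at h3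
    by_cases hsr : s = r
    · omega
    · have := h₁.both h3 hsr
      omega
  rw [chainEval_next a _ u d (v := 2 * t + 1) (by omega) (by omega) hr,
    chainEval_congr (by omega) (altRel_join_right h₂ (2 * j)),
    show 2 * i + 1 + 1 = 2 * (i + 1) by ring,
    relEval_congr (fun _ _ => rfl) (altRel_join_left h₁ (2 * (i + 1)))]
  -- An earlier Kreweras partner would cut off an interval containing `i + 1` but not the related
  -- point `t`.
  · rintro s h1 h2 (⟨h3, h4, h5⟩ | ⟨h3, h4, h5⟩)
    · omega
    · have e : (2 * i + 1) / 2 = i := by omega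
      rw [e, kreweras_iff (by omega)] at h5
      have := h5 (i + 1) t (by omega) (by omega) ((joinSetoid_left h₁ (by omega)).2 h₁')
      omega
  · exact fun t _ _ => altRel_left_iff hr t

/-- `ι d` multiplied to the first entry of a list. -/
def headMul (ι : D →+* A) (d : D) : List A → List A
  | [] => []
  | e :: l => (ι d * e) :: l

variable {X Y : Set A}

/-- The sums over `π ∪ Kr(π)` on intervals whose ends have the same colour. -/
theorem sum_chainEval_same_colour (h : FreeCumulants ι c X Y) {x y a : ℕ → A} (hx : ∀ i, x i ∈ X)
    (hy : ∀ i, y i ∈ Y) (hax : ∀ i, a (2 * i) = x i) (hay : ∀ i, a (2 * i + 1) = y i) (n : ℕ) :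
    (∀ i j u d, i < j → j - i = n → (∀ e ∈ u, e ∈ Y) →
      ∑ π ∈ NCOn (i + 1) j, chainEval ι c a (altRel π) u d (2 * i + 1) (2 * j) =
        c (u ++ (ι d * y i) :: (List.Ico (i + 1) j).map fun k => x k * y k)) ∧
    (∀ i t u d, i ≤ t → t + 1 - i = n → (∀ e ∈ u, e ∈ X) →
      ∑ π ∈ open Classical in {π ∈ NCOn i (t + 1) | π i t},
        chainEval ι c a (altRel π) u d (2 * i) (2 * t + 1) =
          c (u ++ headMul ι d ((List.Ico i t).map (fun k => x k * y k) ++ [x t]))) := by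
  classical
  induction n using Nat.strong_induction_on with
  | _ n ih =>
    -- The two statements are proved together because they supply each other's gaps: a step of a
    -- Kreweras block encloses an interval with both ends in `π`, and a step of a block of `π`
    -- encloses one with both ends in `Kr(π)`.
    refine ⟨fun i j u d hij hn hu => ?_, fun i t u d hit hn hu => ?_⟩
    · rcases Nat.eq_or_lt_of_le (Nat.succ_le_of_lt hij) with hj | hj
      · subst hj
        rw [NCOn_self, Finset.sum_singleton, chainEval_last a _ u d (fun t h1 h2 => by omega),
          Finset.Ico_eq_empty_of_le (by omega), relEval_empty, List.Ico.self_empty, hay]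
        simp
      have hP : ∀ t ∈ Finset.Ico (i + 1) j, ∑ π ∈ NCOn (i + 1) (t + 1) with π (i + 1) t,
          relEval ι c a (altRel π) (Finset.Ico (2 * (i + 1)) (2 * t + 1)) =
          c ((List.Ico (i + 1) t).map (fun k => x k * y k) ++ [x t]) := by
        intro t ht
        rw [Finset.mem_Ico] at ht
        have := (ih (t + 1 - (i + 1)) (by omega)).2 (i + 1) t [] 1 ht.1 rfl (by simp)
        rw [Finset.sum_congr rfl fun π _ => relEval_Ico a (altRel π) (by omega), this]
        cases hL : (List.Ico (i + 1) t).map (fun k => x k * y k) ++ [x t] with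
        | nil => rfl
        | cons e l => simp [headMul]
      have hY : ∀ e ∈ u ++ [ι d * y i], e ∈ Y :=
        List.forall_mem_append.2 ⟨hu, by simpa using h.mul_mem_right d _ (hy i)⟩
      -- The marked product `t` in this expansion is the last point of the block of `i + 1` in
      -- `sum_NCOn_last`.
      have e0 := h.products_among_right hx hy (v := u ++ [ι d * y i]) (w := []) (by simp) hY
        (by simp) (L := List.Ico (i + 1) j) (by rw [List.Ico.eq_cons hj]; simp)
      rw [List.append_nil, List.append_assoc, List.singleton_append] at e0
      rw [e0, splitSum_Ico, sum_NCOn_last _ hj]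
      refine Finset.sum_congr rfl fun t ht => ?_
      rw [← hP t ht]
      rw [Finset.mem_Ico] at ht
      rw [List.append_nil, ← (ih (j - t) (by omega)).1 t j (u ++ [ι d * y i]) _ ht.2 rfl hY,
        Finset.sum_comm]
      refine Finset.sum_congr rfl fun π₂ h₂ => ?_
      rw [chainEval_sum h.slotAdd]
      refine Finset.sum_congr rfl fun π₁ h₁ => ?_
      rw [Finset.mem_filter, mem_NCOn] at h₁
      rw [mem_NCOn] at h₂
      rw [chainEval_join a u d (by omega) ht.2 h₁.1 h₁.2 h₂, hay]
    · rcases Nat.eq_or_lt_of_le hit with rfl | hit'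
      · rw [NCOn_succ_self, Finset.filter_singleton, if_pos (Setoid.refl' _ i),
          Finset.sum_singleton, chainEval_last a _ u d (fun t h1 h2 => by omega),
          Finset.Ico_eq_empty_of_le (by omega), relEval_empty, List.Ico.self_empty, hax]
        simp [headMul]
      have hL : ∀ v ∈ Finset.Ico (i + 1) (t + 1), ∑ π ∈ NCOn (i + 1) v,
          relEval ι c a (altRel π) (Finset.Ico (2 * i + 1) (2 * v)) =
          c (y i :: (List.Ico (i + 1) v).map fun k => x k * y k) := by
        intro v hv
        rw [Finset.mem_Ico] at hv
        have := (ih (v - i) (by omega)).1 i v [] 1 (by omega) rfl (by simp)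
        rw [Finset.sum_congr rfl fun π _ => relEval_Ico a (altRel π) (by omega), this]
        simp
      have hX : ∀ e ∈ u ++ [ι d * x i], e ∈ X :=
        List.forall_mem_append.2 ⟨hu, by simpa using h.mul_mem_left d _ (hx i)⟩
      have hz : ∀ l : List ℕ, ∀ e ∈ l.map fun k => x k * y k, IsLetter X Y e := by
        simp only [List.forall_mem_map]
        exact fun _ k _ => Or.inr ⟨x k, hx k, y k, hy k, rfl⟩
      have hz' : ∀ e ∈ (List.Ico (i + 1) t).map (fun k => x k * y k) ++ [x t], IsLetter X Y e :=
        List.forall_mem_append.2 ⟨hz _, fun e he => List.mem_singleton.1 he ▸ Or.inl (Or.inl (hx t))⟩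
      -- In `first_product` the side-by-side term contains a cumulant from `y i` to `x t` and
      -- vanishes. Its counterpart, the partitions in which `i` is a singleton, is excluded by the
      -- condition that `i` and `t` are related.
      rw [List.Ico.eq_cons hit', List.map_cons, List.cons_append, headMul, ← mul_assoc,
        h.first_product hu (h.mul_mem_left d _ (hx i)) (hy i) hz',
        h.eq_zero_of_ends _ _ _ (hz _) (hy i) (hx t), mul_zero, zero_add, splitSum_append,
        splitSum_map, splitSum_Ico, splitSum_cons, splitSum_nil, add_zero, List.append_nil,
        Finset.sum_filter, sum_NCOn_next _ (by omega), Finset.sum_eq_zero, zero_add]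
      · have hI : Finset.Ioo i (t + 1) = Finset.Ico (i + 1) (t + 1) := by ext; simp
        have key : ∀ v ∈ Finset.Ico (i + 1) (t + 1), ∑ π₁ ∈ NCOn (i + 1) v, ∑ π₂ ∈ NCOn v (t + 1),
            (if glueSetoid i v π₁ π₂ i t then chainEval ι c a (altRel (glueSetoid i v π₁ π₂)) u d
              (2 * i) (2 * t + 1) else 0) =
            c (u ++ [ι d * x i] ++ headMul ι (c (y i :: (List.Ico (i + 1) v).map fun k => x k * y k))
              ((List.Ico v t).map (fun k => x k * y k) ++ [x t])) := by
          intro v hv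
          rw [← hL v hv]
          rw [Finset.mem_Ico] at hv
          rw [← (ih (t + 1 - v) (by omega)).2 v t _ _ (by omega) rfl hX, Finset.sum_comm,
            Finset.sum_filter]
          refine Finset.sum_congr rfl fun π₂ h₂ => ?_
          rw [mem_NCOn] at h₂
          have hg : ∀ π₁, glueSetoid i v π₁ π₂ i t ↔ π₂ v t := by
            intro π₁
            rw [glueSetoid_left (by omega)]
            exact ⟨fun h => h.2, fun h => ⟨by omega, h⟩⟩
          simp only [hg]
          split_ifs
          · rw [chainEval_sum h.slotAdd]
            refine Finset.sum_congr rfl fun π₁ h₁ => ?_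
            rw [mem_NCOn] at h₁
            rw [chainEval_glue a u d (by omega) (by omega) h₁ h₂, hax]
          · simp
        rw [hI, Finset.sum_congr rfl key, Finset.sum_Ico_succ_top (by omega), List.Ico.self_empty]
        congr 1
        · refine Finset.sum_congr rfl fun v hv => ?_
          rw [Finset.mem_Ico] at hv
          rw [List.Ico.eq_cons hv.2]
          simp [headMul]
        · simp [headMul]
      · intro π hπ
        rw [mem_NCOn] at hπ
        refine if_neg fun hr => ?_
        have := hπ.both hr hit'.ne
        omega

/-- The cumulants of products as sums over the partitions `π ∪ Kr(π)`. -/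
theorem sum_chainEval_altRel (h : FreeCumulants ι c X Y) {x y a : ℕ → A} (hx : ∀ i, x i ∈ X)
    (hy : ∀ i, y i ∈ Y) (hax : ∀ i, a (2 * i) = x i) (hay : ∀ i, a (2 * i + 1) = y i)
    {i j : ℕ} (u : List A) (d : D) (hij : i < j) (hu : ∀ e ∈ u, e ∈ X) :
    ∑ π ∈ NCOn i j, chainEval ι c a (altRel π) u d (2 * i) (2 * j) =
      c (u ++ (ι d * (x i * y i)) :: (List.Ico (i + 1) j).map fun k => x k * y k) := by
  induction hn : j - i using Nat.strong_induction_on generalizing i u d with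
  | _ n ih =>
    have hL : ∀ v, i < v → ∑ π ∈ NCOn (i + 1) v,
        relEval ι c a (altRel π) (Finset.Ico (2 * i + 1) (2 * v)) =
        c (y i :: (List.Ico (i + 1) v).map fun k => x k * y k) := by
      intro v hv
      have := (sum_chainEval_same_colour h hx hy hax hay (v - i)).1 i v [] 1 hv rfl (by simp)
      rw [Finset.sum_congr rfl fun π _ => relEval_Ico a (altRel π) (by omega), this]
      simp
    have hX : ∀ e ∈ u ++ [ι d * x i], e ∈ X :=
      List.forall_mem_append.2 ⟨hu, by simpa using h.mul_mem_left d _ (hx i)⟩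
    have hz : ∀ l : List ℕ, ∀ e ∈ l.map fun k => x k * y k, IsLetter X Y e := by
      simp only [List.forall_mem_map]
      exact fun _ k _ => Or.inr ⟨x k, hx k, y k, hy k, rfl⟩
    -- Here the interval ends with a Kreweras point, so the side-by-side term survives and accounts
    -- for the partitions in which `i` has no later partner.
    rw [← mul_assoc, h.first_product hu (h.mul_mem_left d _ (hx i)) (hy i) (hz _), splitSum_map,
      splitSum_Ico, sum_NCOn_next _ hij]
    congr 1
    · rw [← hL j hij, Finset.mul_sum]
      refine Finset.sum_congr rfl fun π hπ => ?_
      rw [mem_NCOn] at hπ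
      rw [chainEval_last a _ u d (fun t h1 _ => not_altRel_of_isNCOn hπ h1), hax]
    · have hI : Finset.Ioo i j = Finset.Ico (i + 1) j := by ext; simp
      rw [hI]
      refine Finset.sum_congr rfl fun v hv => ?_
      rw [Finset.mem_Ico] at hv
      have := ih (j - v) (by omega) (u ++ [ι d * x i])
        (c (y i :: (List.Ico (i + 1) v).map fun k => x k * y k)) hv.2 hX rfl
      rw [List.append_assoc, List.singleton_append] at this
      rw [← this, ← hL v (by omega), Finset.sum_comm]
      refine Finset.sum_congr rfl fun π₂ h₂ => ?_
      rw [mem_NCOn] at h₂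
      rw [chainEval_sum h.slotAdd]
      refine Finset.sum_congr rfl fun π₁ h₁ => ?_
      rw [mem_NCOn] at h₁
      rw [chainEval_glue a u d (by omega) (by omega) h₁ h₂, hax]

theorem sum_relEval_altRel (h : FreeCumulants ι c X Y) {x y a : ℕ → A} (hx : ∀ i, x i ∈ X)
    (hy : ∀ i, y i ∈ Y) (hax : ∀ i, a (2 * i) = x i) (hay : ∀ i, a (2 * i + 1) = y i) {n : ℕ}
    (hn : 0 < n) :
    ∑ π ∈ NCOn 0 n, relEval ι c a (altRel π) (Finset.Ico 0 (2 * n)) =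
      c ((List.Ico 0 n).map fun k => x k * y k) := by
  rw [Finset.sum_congr rfl fun π _ => relEval_Ico a (altRel π) (by omega)]
  have := sum_chainEval_altRel h hx hy hax hay [] 1 hn (by simp)
  rw [mul_zero] at this
  rw [this, List.Ico.eq_cons hn]
  simp

end Chains

end Kreweras

/-! ### R-transforms of free families -/

namespace CondExp

variable {𝒜 : Type*} [Ring 𝒜] [Algebra ℂ 𝒜] {A D : Subalgebra ℂ 𝒜}

/-- Cumulants do not change when the algebra is enlarged compatibly. -/
theorem cumulant_inclusion {A' : Subalgebra ℂ 𝒜} (E : CondExp A D) (F : CondExp A' D)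
    (h : A' ≤ A) (hEF : ∀ a, E.toLinearMap (Subalgebra.inclusion h a) = F.toLinearMap a) (n : ℕ)
    (a : Fin (n + 1) → A') :
    E.cumulant n (fun i => Subalgebra.inclusion h (a i)) = F.cumulant n a := by
  classical
  induction n using Nat.strong_induction_on with
  | _ n ih =>
    rw [cumulant, cumulant]
    congr 1
    · rw [← hEF, map_list_prod (Subalgebra.inclusion h), List.map_ofFn]
      rfl
    · refine Finset.sum_congr rfl fun π _ => ?_
      congr 1
      funext p V w
      split_ifs with hV
      · rw [← ih _ hV]
        congr 1
        funext j
        refine Fin.cases rfl (fun j => ?_) j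
        simp only [blockArgs, Fin.cons_succ, map_mul]
        rfl
      · rfl

theorem rTransform_inclusion {A' : Subalgebra ℂ 𝒜} (E : CondExp A D) (F : CondExp A' D)
    (h : A' ≤ A) (hEF : ∀ a, E.toLinearMap (Subalgebra.inclusion h a) = F.toLinearMap a)
    {I : Type*} (x : I → A') :
    E.rTransform (fun i => Subalgebra.inclusion h (x i)) = F.rTransform x := by
  funext n i b
  rw [rTransform, rTransform, ← E.cumulant_inclusion F h hEF]
  congr 1
  funext j
  refine Fin.cases rfl (fun j => ?_) j
  simp only [Fin.cons_succ, map_mul]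
  rfl

/-- The added `1` in front of the first entry gives all entries the same form. -/
theorem rTransform_eq (E : CondExp A D) {I : Type*} (x : I → A) (n : ℕ) (i : Fin (n + 1) → I)
    (b : Fin n → D) :
    E.rTransform x n i b = E.cumulantList (List.ofFn fun j =>
      E.incl (Fin.cons (α := fun _ => D) 1 b j) * x (i j)) := by
  rw [cumulantList_ofFn, rTransform]
  congr 1
  funext j
  refine Fin.cases ?_ (fun j => ?_) j
  · simp
  · rfl

/-- The subalgebra generated by `D` and `S`. -/
def genAlg (E : CondExp A D) (S : Set A) : Subalgebra ℂ A :=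
  Algebra.adjoin ℂ (Set.range (Subalgebra.inclusion E.le) ∪ S)

theorem incl_mem_genAlg (E : CondExp A D) (S : Set A) (d : D) : E.incl d ∈ E.genAlg S :=
  Algebra.subset_adjoin (Or.inl ⟨d, rfl⟩)

theorem mem_genAlg (E : CondExp A D) {S : Set A} {s : A} (hs : s ∈ S) : s ∈ E.genAlg S :=
  Algebra.subset_adjoin (Or.inr hs)

theorem Free.cumulantList_eq_zero {E : CondExp A D} {S₁ S₂ : Set A} (h : E.Free ![S₁, S₂])
    (u v w : List A) (a b : A)
    (hu : ∀ e ∈ u ++ v ++ w, e ∈ (E.genAlg S₁ : Set A) ∨ e ∈ (E.genAlg S₂ : Set A))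
    (hab : a ∈ (E.genAlg S₁ : Set A) ∧ b ∈ (E.genAlg S₂ : Set A) ∨
      a ∈ (E.genAlg S₂ : Set A) ∧ b ∈ (E.genAlg S₁ : Set A)) :
    E.cumulantList (u ++ a :: v ++ b :: w) = 0 := by
  classical
  obtain ⟨ta, tb, hne, ha, hb⟩ : ∃ ta tb : Fin 2, ta ≠ tb ∧ a ∈ E.genAlg (![S₁, S₂] ta) ∧
      b ∈ E.genAlg (![S₁, S₂] tb) := by
    rcases hab with ⟨ha, hb⟩ | ⟨ha, hb⟩
    · exact ⟨0, 1, by decide, ha, hb⟩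
    · exact ⟨1, 0, by decide, ha, hb⟩
  -- An entry may lie in both algebras, for instance in `D`, so a label is chosen for each; the
  -- labels of `a` and `b` are fixed to be different.
  have htag : ∀ l : List A, (∀ e ∈ l, e ∈ (E.genAlg S₁ : Set A) ∨ e ∈ (E.genAlg S₂ : Set A)) →
      ∃ T : List (Fin 2), List.Forall₂ (fun t e => e ∈ E.genAlg (![S₁, S₂] t)) T l := by
    intro l hl
    induction l with
    | nil => exact ⟨[], .nil⟩
    | cons e l ih =>
      rw [List.forall_mem_cons] at hl
      obtain ⟨T, hT⟩ := ih hl.2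
      rcases hl.1 with he | he
      · exact ⟨0 :: T, .cons he hT⟩
      · exact ⟨1 :: T, .cons he hT⟩
  rw [List.forall_mem_append, List.forall_mem_append] at hu
  obtain ⟨Tu, hTu⟩ := htag u hu.1.1
  obtain ⟨Tv, hTv⟩ := htag v hu.1.2
  obtain ⟨Tw, hTw⟩ := htag w hu.2
  have hT := List.rel_append (List.rel_append hTu (.cons ha hTv)) (.cons hb hTw)
  set T := Tu ++ ta :: Tv ++ tb :: Tw with hTdef
  set l := u ++ a :: v ++ b :: w with hldef
  have hlen : l.length = (u.length + v.length + w.length + 1) + 1 := by simp [hldef]; omega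
  obtain ⟨f, hf⟩ := exists_ofFn_eq hlen
  have hTl : T.length = (u.length + v.length + w.length + 1) + 1 := by
    rw [hT.length_eq, hlen]
  obtain ⟨ε, hε⟩ := exists_ofFn_eq hTl
  rw [← hf, cumulantList_ofFn]
  refine h _ ε ?_ f fun j => ?_
  · by_contra hall
    push Not at hall
    have hmem : ∀ t ∈ T, t = ε 0 := by
      intro t ht
      rw [← hε, List.mem_ofFn] at ht
      obtain ⟨j, rfl⟩ := ht
      exact hall j 0
    exact hne ((hmem ta (by simp [hTdef])).trans (hmem tb (by simp [hTdef])).symm)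
  · have := (List.forall₂_iff_get.1 hT).2 j (by rw [hTl]; exact j.2) (by rw [hlen]; exact j.2)
    have e1 : l[(j : ℕ)]'(by rw [hlen]; exact j.2) = f j := by
      simp only [← hf, List.getElem_ofFn, Fin.eta]
    have e2 : T[(j : ℕ)]'(by rw [hTl]; exact j.2) = ε j := by
      simp only [← hε, List.getElem_ofFn, Fin.eta]
    simp only [List.get_eq_getElem] at this
    rw [← e1, ← e2]
    exact this

theorem Free.freeCumulants {E : CondExp A D} {S₁ S₂ : Set A} (h : E.Free ![S₁, S₂]) :
    FreeCumulants E.incl E.cumulantList (E.genAlg S₁ : Set A) (E.genAlg S₂ : Set A) where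
  slotAdd := E.slotAdd_cumulantList
  merge := E.mergeDefect_cumulantList
  mul_mem_left d _ hx := mul_mem (E.incl_mem_genAlg S₁ d) hx
  mul_mem_right d _ hy := mul_mem (E.incl_mem_genAlg S₂ d) hy
  mixed := h.cumulantList_eq_zero

/-- The R-transform of a sum of two free tuples. -/
theorem Free.rTransform_add {E : CondExp A D} {I : Type*} {x y : I → A}
    (h : E.Free ![Set.range x, Set.range y]) :
    E.rTransform (x + y) = E.rTransform x + E.rTransform y := by
  funext n i b
  simp only [Pi.add_apply, rTransform_eq, List.ofFn_eq_map, mul_add]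
  refine h.freeCumulants.map_add_eq (fun j => ?_) (fun j => ?_) (by simp)
  · exact mul_mem (E.incl_mem_genAlg _ _) (E.mem_genAlg ⟨i j, rfl⟩)
  · exact mul_mem (E.incl_mem_genAlg _ _) (E.mem_genAlg ⟨i j, rfl⟩)

end CondExp

theorem FormalSeries.rename_comp {D I J : Type*} [AddCommMonoid D] [Fintype I] {e : I → J}
    (he : Function.Injective e) (f : FormalSeries D I) (n : ℕ) (l : Fin (n + 1) → I)
    (b : Fin n → D) : f.rename e n (e ∘ l) b = f n l b := by
  classical
  rw [FormalSeries.rename, Finset.sum_eq_single_of_mem l (by simp)]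
  intro l' hl' hne
  simp only [Finset.mem_filter, Finset.mem_univ, true_and] at hl'
  exact absurd (he.comp_left hl') hne

theorem FormalSeries.rename_eq_zero {D I J : Type*} [AddCommMonoid D] [Fintype I] {e : I → J}
    (f : FormalSeries D I) (n : ℕ) (i : Fin (n + 1) → J) (b : Fin n → D) {k : Fin (n + 1)}
    (hk : ∀ l, e l ≠ i k) : f.rename e n i b = 0 := by
  classical
  refine Finset.sum_eq_zero fun l hl => ?_
  simp only [Finset.mem_filter, Finset.mem_univ, true_and] at hl
  exact absurd (congrFun hl k) (hk (l k))

/-! ### Unions and products of free tuples -/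

namespace CondExp

variable {𝒜 : Type*} [Ring 𝒜] [Algebra ℂ 𝒜] {A D : Subalgebra ℂ 𝒜}

/-- The R-transform of the union of two free tuples. -/
theorem Free.rTransform_append {E : CondExp A D} {s : ℕ} {x y : Fin s → A}
    (h : E.Free ![Set.range x, Set.range y]) :
    E.rTransform (Fin.append x y) =
      (E.rTransform x).rename (Fin.castAdd s) + (E.rTransform y).rename (Fin.natAdd s) := by
  funext n i b
  simp only [Pi.add_apply]
  by_cases hl : ∀ j, ∃ l, Fin.castAdd s l = i j
  · choose l hl using hl
    obtain rfl : Fin.castAdd s ∘ l = i := funext hl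
    rw [FormalSeries.rename_comp (Fin.castAdd_injective s s),
      FormalSeries.rename_eq_zero _ _ _ _ (k := 0), add_zero, rTransform_eq, rTransform_eq]
    · simp only [Function.comp_apply, Fin.append_left]
    · intro l' h'
      simp [Fin.ext_iff] at h'
      omega
  by_cases hr : ∀ j, ∃ l, Fin.natAdd s l = i j
  · choose l hr using hr
    obtain rfl : Fin.natAdd s ∘ l = i := funext hr
    rw [FormalSeries.rename_comp (Fin.natAdd_injective s s),
      FormalSeries.rename_eq_zero _ _ _ _ (k := 0), zero_add, rTransform_eq, rTransform_eq]
    · simp only [Function.comp_apply, Fin.append_right]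
    · intro l' h'
      simp [Fin.ext_iff] at h'
      omega
  -- The remaining words use indeterminates of both kinds: the coefficients on the right vanish, and
  -- on the left stands a mixed cumulant.
  push Not at hl hr
  obtain ⟨p, hp⟩ := hl
  obtain ⟨q, hq⟩ := hr
  rw [FormalSeries.rename_eq_zero _ _ _ _ hp, FormalSeries.rename_eq_zero _ _ _ _ hq, add_zero,
    rTransform_eq, cumulantList_ofFn]
  have hside : ∀ t : Fin (s + s), (∃ l, Fin.castAdd s l = t) ∨ ∃ l, Fin.natAdd s l = t :=
    fun t => Fin.addCases (fun l => Or.inl ⟨l, rfl⟩) (fun l => Or.inr ⟨l, rfl⟩) t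
  classical
  refine h n (fun j => if ∃ l, Fin.castAdd s l = i j then 0 else 1) ⟨p, q, ?_⟩ _ fun j => ?_
  · rw [if_neg (by push Not; exact hp),
      if_pos ((hside (i q)).resolve_right (by push Not; exact hq))]
    decide
  · refine mul_mem (E.incl_mem_genAlg _ _) (E.mem_genAlg ?_)
    split_ifs with hj
    · obtain ⟨l, hl⟩ := hj
      rw [← hl, Fin.append_left]
      exact ⟨l, rfl⟩
    · obtain ⟨l, hl⟩ := (hside (i j)).resolve_left hj
      rw [← hl, Fin.append_right]
      exact ⟨l, rfl⟩

/-- The order embedding of the points `0 < 0' < 1 < 1' < ⋯` into `ℕ`. -/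
def altEmb (n : ℕ) : Fin n ×ₗ Bool ↪o ℕ :=
  OrderEmbedding.ofStrictMono (fun v => 2 * ((ofLex v).1 : ℕ) + (ofLex v).2.toNat) (by
    intro u v huv
    rw [Prod.Lex.lt_iff] at huv
    have hu := Bool.toNat_le (ofLex u).2
    rcases huv with h | ⟨h1, h2⟩
    · have : ((ofLex u).1 : ℕ) < (ofLex v).1 := h
      show 2 * ((ofLex u).1 : ℕ) + _ < 2 * ((ofLex v).1 : ℕ) + _
      omega
    · show 2 * ((ofLex u).1 : ℕ) + _ < 2 * ((ofLex v).1 : ℕ) + _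
      rw [Bool.lt_iff] at h2
      rw [h1, h2.1, h2.2]
      simp)

theorem altEmb_apply {n : ℕ} (v : Fin n ×ₗ Bool) :
    altEmb n v = 2 * ((ofLex v).1 : ℕ) + (ofLex v).2.toNat := rfl

theorem map_altEmb (n : ℕ) : (Finset.univ : Finset (Fin n ×ₗ Bool)).map (altEmb n).toEmbedding =
    Finset.Ico 0 (2 * n) := by
  ext k
  simp only [Finset.mem_map, Finset.mem_univ, true_and, Finset.mem_Ico, RelEmbedding.coe_toEmbedding]
  constructor
  · rintro ⟨v, rfl⟩
    have := (ofLex v).1.2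
    have := Bool.toNat_le (ofLex v).2
    rw [altEmb_apply]
    omega
  · rintro ⟨-, hk⟩
    refine ⟨toLex (⟨k / 2, by omega⟩, decide (k % 2 = 1)), ?_⟩
    rw [altEmb_apply]
    rcases Nat.mod_two_eq_zero_or_one k with h | h <;> simp [h] <;> omega

theorem kreweras_comap {n : ℕ} {π : Setoid ℕ} (h : IsNCOn 0 n π) (a b : Fin n) :
    kreweras π a b ↔ kreweras (π.comap Fin.val) a b := by
  have h1 : kreweras π a b ↔ ∀ s t : ℕ, π s t → ((min (a : ℕ) b < s ∧ s ≤ max (a : ℕ) b) ↔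
    (min (a : ℕ) b < t ∧ t ≤ max (a : ℕ) b)) := Iff.rfl
  have h2 : kreweras (π.comap Fin.val) a b ↔ ∀ s t : Fin n, π s t →
    ((min a b < s ∧ s ≤ max a b) ↔ (min a b < t ∧ t ≤ max a b)) := Iff.rfl
  rw [h1, h2]
  simp only [min_lt_iff, le_max_iff, Fin.lt_def, Fin.le_def]
  constructor
  · exact fun hk s t hst => hk s t hst
  · intro hk s t hst
    by_cases hne : s = t
    · rw [hne]
    · have := h.both hst hne
      exact hk ⟨s, this.1.2⟩ ⟨t, this.2.2⟩ hst

theorem altRel_altEmb {n : ℕ} {π : Setoid ℕ} (h : IsNCOn 0 n π) (u v : Fin n ×ₗ Bool) :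
    altRel π (altEmb n u) (altEmb n v) ↔
      alternatingUnion (π.comap Fin.val) (kreweras (π.comap Fin.val)) u v := by
  rw [altRel, alternatingUnion, ← kreweras_comap h, altEmb_apply, altEmb_apply]
  have e : ∀ (k : ℕ) (b : Bool), (2 * k + b.toNat) / 2 = k := by
    intro k b
    have := Bool.toNat_le b
    omega
  have e0 : ∀ (k : ℕ) (b : Bool), (2 * k + b.toNat) % 2 = 0 ↔ b = false := by
    intro k b
    cases b <;> simp
  have e1 : ∀ (k : ℕ) (b : Bool), (2 * k + b.toNat) % 2 = 1 ↔ b = true := by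
    intro k b
    cases b <;> simp [Nat.add_mod]
  rw [e, e, e0, e0, e1, e1]
  exact Iff.rfl

/-- The R-transform of a product of two free tuples. -/
theorem Free.rTransform_mul {E : CondExp A D} {I : Type*} {x y : I → A}
    (h : E.Free ![Set.range x, Set.range y]) :
    E.rTransform (x * y) = boxedConvTrivial (E.rTransform x) (E.rTransform y) := by
  classical
  funext n i b
  set d : Fin (n + 1) ×ₗ Bool → D := fun v =>
    Fin.cons (α := fun _ => D) 1 (if (ofLex v).2 then (1 : Fin n → D) else b) (ofLex v).1 with hd
  set z : Fin (n + 1) ×ₗ Bool → A := fun v =>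
    E.incl (d v) * (if (ofLex v).2 then y else x) (i (ofLex v).1) with hz
  have hbox : boxedConvTrivial (E.rTransform x) (E.rTransform y) n i b =
      ∑ π ∈ NC (n + 1), relEval E.incl E.cumulantList z (alternatingUnion π (kreweras π))
        Finset.univ := by
    refine Finset.sum_congr rfl fun π _ => nestedEval_congr (fun S p _ => ?_) _
    funext w
    set V := blockRest (alternatingUnion π (kreweras π)) S p with hV
    -- A block of the alternating union has one colour, so the series chosen at its first point is
    -- right for all its entries.
    have hcol : ∀ v ∈ V, (ofLex v).2 = (ofLex p).2 := by
      intro v hv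
      rw [hV, mem_blockRest] at hv
      rcases hv.2.2 with hr | hr
      · rw [hr.1, hr.2.1]
      · rw [hr.1, hr.2.1]
    have hif : (if (ofLex p).2 then E.rTransform y else E.rTransform x) =
        E.rTransform (if (ofLex p).2 then y else x) := by
      split_ifs <;> rfl
    -- Left `D`-linearity moves the factor `d p` in front of the block into its first entry, which
    -- becomes `z p`.
    rw [hif, rTransform, ← cumulantList_ofFn, List.ofFn_succ, Fin.cons_zero,
      ← E.leftLin_cumulantList, blockVal]
    congr 2
    rw [← Finset.listMap_orderEmbOfFin_finRange V rfl, List.ofFn_eq_map, List.map_map]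
    refine List.map_congr_left fun j _ => ?_
    have hj := hcol _ (V.orderEmbOfFin_mem rfl j)
    simp only [Fin.cons_succ, Function.comp_apply, hz, hd, hj]
    rw [← mul_assoc, ← map_mul]
    rfl
  -- The two colours are continued to `ℕ` by zero, which lies in both generated algebras; the
  -- inserted elements are absorbed into the entries.
  set x' : ℕ → A := fun k => if hk : k < n + 1 then z (toLex (⟨k, hk⟩, false)) else 0 with hx'
  set y' : ℕ → A := fun k => if hk : k < n + 1 then z (toLex (⟨k, hk⟩, true)) else 0 with hy'
  set a : ℕ → A := fun k => if k % 2 = 0 then x' (k / 2) else y' (k / 2) with ha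
  have hxm : ∀ k, x' k ∈ (E.genAlg (Set.range x) : Set A) := by
    intro k
    simp only [hx']
    split_ifs
    · exact mul_mem (E.incl_mem_genAlg _ _) (E.mem_genAlg ⟨_, rfl⟩)
    · exact zero_mem _
  have hym : ∀ k, y' k ∈ (E.genAlg (Set.range y) : Set A) := by
    intro k
    simp only [hy']
    split_ifs
    · exact mul_mem (E.incl_mem_genAlg _ _) (E.mem_genAlg ⟨_, rfl⟩)
    · exact zero_mem _
  have hax : ∀ k, a (2 * k) = x' k := by
    intro k
    have : 2 * k / 2 = k := by omega
    simp [ha]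
  have hay : ∀ k, a (2 * k + 1) = y' k := by
    intro k
    have : (2 * k + 1) / 2 = k := by omega
    simp [ha, this]
  have key := sum_relEval_altRel h.freeCumulants hxm hym hax hay (Nat.succ_pos n)
  rw [hbox, sum_NC_eq_sum_NCOn]
  have hsum : ∀ π ∈ NCOn 0 (n + 1), relEval E.incl E.cumulantList z
      (alternatingUnion (π.comap Fin.val) (kreweras (π.comap Fin.val))) Finset.univ =
      relEval E.incl E.cumulantList a (altRel π) (Finset.Ico 0 (2 * (n + 1))) := by
    intro π hπ
    rw [mem_NCOn] at hπ
    rw [← map_altEmb, relEval_map]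
    · intro v _
      rw [altEmb_apply]
      have hlt := (ofLex v).1.2
      cases hv : (ofLex v).2 with
      | false =>
        rw [Bool.toNat_false, add_zero, hax]
        simp only [hx', dif_pos hlt]
        rw [← hv]
        rfl
      | true =>
        rw [Bool.toNat_true, hay]
        simp only [hy', dif_pos hlt]
        rw [← hv]
        rfl
    · exact fun u _ v _ => altRel_altEmb hπ u v
  rw [Finset.sum_congr rfl hsum]
  refine Eq.trans ?_ key.symm
  rw [rTransform_eq]
  congr 1
  rw [List.Ico.zero_bot]
  refine List.ext_getElem (by simp) fun k h1 _ => ?_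
  have hk : k < n + 1 := by rwa [List.length_ofFn] at h1
  rw [List.getElem_map, List.getElem_range, List.getElem_ofFn]
  simp only [hx', hy', dif_pos hk, hz, hd, ofLex_toLex, if_true, Pi.mul_apply, Bool.false_eq_true,
    if_false]
  -- The trivial series enters here: with no element inserted before `y`, each entry of the cumulant
  -- is an inserted element times a product `x * y`.
  have h1 : (Fin.cons (α := fun _ => D) 1 (1 : Fin n → D) : Fin (n + 1) → D) ⟨k, hk⟩ = 1 :=
    Fin.cases (motive := fun j => (Fin.cons (α := fun _ => D) 1 (1 : Fin n → D) :
      Fin (n + 1) → D) j = 1) rfl (fun _ => rfl) ⟨k, hk⟩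
  rw [h1, map_one, one_mul, mul_assoc]
  rfl

end CondExp

/-! ### Compatibility of the conditional expectations in the tower -/

namespace NCTower

variable {𝒜 : Type*} [Ring 𝒜] [Algebra ℂ 𝒜] (T : NCTower 𝒜)

theorem condExpDown_succ {i l : ℕ} (h : i ≤ l) :
    T.condExpDown i (l + 1) (h.trans (Nat.le_succ l)) = (T.condExpDown i l h).comp (T.φ l) :=
  Nat.leRec_succ _ _ h

/-- Every expectation above level `m` fixes the elements of `A_m`, so only the levels from `m`
downwards act. -/
theorem condExpDown_inclusion {i m N : ℕ} (him : i ≤ m) (hmN : m ≤ N) (a : T.alg m) :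
    (T.condExpDown i N (him.trans hmN)).toLinearMap
      (Subalgebra.inclusion (T.alg_mono hmN) a) = (T.condExpDown i m him).toLinearMap a := by
  induction N, hmN using Nat.le_induction with
  | base => rfl
  | succ N hmN ih =>
    rw [T.condExpDown_succ (him.trans hmN), ← ih]
    have := (T.φ N).map_base (Subalgebra.inclusion (T.alg_mono hmN) a)
    rw [Subalgebra.inclusion_inclusion] at this
    exact congrArg _ this

theorem rTransform_lift {I : Type*} {k p m N : ℕ} (hkm : k ≤ m) (hmN : m ≤ N) (x : I → 𝒜)
    (hx : ∀ i, x i ∈ ⋃ j ∈ Set.Icc p m, (T.alg j : Set 𝒜)) :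
    (T.condExp k N (hkm.trans hmN)).rTransform (T.lift hmN x hx) =
      (T.condExp k m hkm).rTransform (T.lift le_rfl x hx) :=
  (T.condExp k N (hkm.trans hmN)).rTransform_inclusion (T.condExp k m hkm) (T.alg_mono hmN)
    (T.condExpDown_inclusion _ hmN) (T.lift le_rfl x hx)

end NCTower

end

theorem mainTheorem2 {𝒜 : Type*} [Ring 𝒜] [Algebra ℂ 𝒜] (T : NCTower 𝒜)
    (k m n N s : ℕ) (hk : 1 ≤ k) (hkm : k < m) (hmn : m < n) (hnN : n < N)
    (x y : Fin s → 𝒜)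
    (hx : ∀ i, x i ∈ ⋃ j ∈ Set.Icc k m, (T.alg j : Set 𝒜))
    (hy : ∀ i, y i ∈ ⋃ j ∈ Set.Icc (m + 1) n, (T.alg j : Set 𝒜))
    (hfree : (T.condExp k N (by omega)).Free
      ![Set.range (T.lift (by omega : m ≤ N) x hx), Set.range (T.lift (by omega : n ≤ N) y hy)]) :
    (T.condExp k N (by omega)).rTransform
        (Fin.append (T.lift (by omega : m ≤ N) x hx) (T.lift (by omega : n ≤ N) y hy)) =
      ((T.condExp k m (by omega)).rTransform (T.lift le_rfl x hx)).rename (Fin.castAdd s) +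
        ((T.condExp k n (by omega)).rTransform (T.lift le_rfl y hy)).rename (Fin.natAdd s) ∧
    (T.condExp k N (by omega)).rTransform
        (T.lift (by omega : m ≤ N) x hx + T.lift (by omega : n ≤ N) y hy) =
      (T.condExp k m (by omega)).rTransform (T.lift le_rfl x hx) +
        (T.condExp k n (by omega)).rTransform (T.lift le_rfl y hy) ∧
    (T.condExp k N (by omega)).rTransform
        (T.lift (by omega : m ≤ N) x hx * T.lift (by omega : n ≤ N) y hy) =
      boxedConvTrivial ((T.condExp k m (by omega)).rTransform (T.lift le_rfl x hx))
        ((T.condExp k n (by omega)).rTransform (T.lift le_rfl y hy)) := by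
  -- All R-transforms are computed in `A_N`, where freeness is assumed.
  rw [← T.rTransform_lift (by omega) (by omega : m ≤ N) x hx,
    ← T.rTransform_lift (by omega) (by omega : n ≤ N) y hy]
  exact ⟨hfree.rTransform_append, hfree.rTransform_add, hfree.rTransform_mul⟩
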